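/- Let $a,\alpha,\beta>0$ and $b,c_o\in\mathbb R$. For an immersion $X:\Sigma\to\mathbb R^3$, of class $C^4$ up to the boundary, of a compact connected oriented surface with boundary, with unit normal $\nu$, let $$E[X]=\int_\Sigma\big(a(H+c_o)^2+bK\big)\,d\Sigma+\oint_{\partial\Sigma}(\alpha\kappa^2+\beta)\,ds ,$$ where $K$ is the Gaussian curvature, $H$ is the mean curvature (half the sum of the principal curvatures, with $\Delta X=2H\nu$) and $\kappa$ is the curvature of the boundary curves in $\mathbb R^3$. Let $T$ be the unit tangent of the positively oriented boundary, $n=T\times\nu$ its outward conormal, and let $\kappa_g=T'\cdot n$ be the geodesic curvature of the boundary (so that $\kappa_g=-1$ for the flat unit disc). The immersion $X$ is critical for $E$ if $\frac{d}{dt}\big|_{t=0}E[X+tV]=0$ for every vector field $V:\Sigma\to\mathbb R^3$ of class $C^4$ up to the boundary (no condition is imposed on $\partial\Sigma$). A critical $X$ is unstable if there is a variation $(X_t)$ of $X=X_0$, of class $C^4$ jointly in $t$ and the point, with $\frac{d^2}{dt^2}\big|_{t=0}E[X_t]<0$. Let $X$ be axially symmetric, i.e. a surface of revolution, so that $\Sigma$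 is a closed disc or a closed annulus; its boundary components are then circles. Suppose that $X$ is critical for $E$ and that one of the following holds: (i) $b=0$ and some boundary component is a geodesic circle ($\kappa_g\equiv0$), of radius $r$, along which $\left(\frac{\alpha}{r^2}-\beta\right)K<0$; (ii) $b<0$ and some boundary component is a geodesic circle of radius $r>\sqrt{\alpha/\beta}$; (iii) $b>0$ and some boundary component is a geodesic circle of radius $r<\sqrt{\alpha/\beta}$; (iv) $c_o\neq0$, $$\alpha>\frac{\beta^3(a+b)^2}{4c_o^2\left(b^2(a+b)^2c_o^2+a^2\beta^2\right)},$$ and some boundary component is a circle of radius $\sqrt{\alpha/\beta}$ along which $b\kappa_g>0$. Then $X$ is unstable. -/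

import Mathlib

open Matrix MeasureTheory

noncomputable section

namespace EulerHelfrich

/-! ### Parameter domains

A compact surface of revolution with boundary is a topological disc or a topological annulus. The
two models are the closed unit disc and the closed annulus `1 ≤ |p| ≤ 2` in the oriented plane. -/

/-- The two topological types. -/
inductive SurfaceType where
  | disc : SurfaceType
  | annulus : SurfaceType

/-- The model surface of each type. -/
def domain : SurfaceType → Set (ℝ × ℝ)
  | SurfaceType.disc => {p | p.1 ^ 2 + p.2 ^ 2 ≤ 1}
  | SurfaceType.annulus => {p | 1 ≤ p.1 ^ 2 + p.2 ^ 2 ∧ p.1 ^ 2 + p.2 ^ 2 ≤ 4}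

/-- Labels of the boundary components: the label `s` stands for the boundary circle of radius
`|s|`; it is positive for an outer circle and negative for an inner one. -/
def boundaryLabels : SurfaceType → Finset ℝ
  | SurfaceType.disc => {1}
  | SurfaceType.annulus => {2, -1}

/-- The boundary circle with label `s`, run through in the positive direction relative to the
domain (counterclockwise if it is an outer circle, clockwise if it is an inner one). -/
def bdryPoint (s θ : ℝ) : ℝ × ℝ := (|s| * Real.cos θ, s * Real.sin θ)

/-! ### Geometry of a parametrized surface in `ℝ³`

`ℝ³` is `Fin 3 → ℝ` with the Euclidean inner product `⬝ᵥ` and the cross product. -/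

/-- Partial derivative in the first variable. -/
def du (X : ℝ × ℝ → Fin 3 → ℝ) (p : ℝ × ℝ) : Fin 3 → ℝ := fderiv ℝ X p (1, 0)

/-- Partial derivative in the second variable. -/
def dv (X : ℝ × ℝ → Fin 3 → ℝ) (p : ℝ × ℝ) : Fin 3 → ℝ := fderiv ℝ X p (0, 1)

/-- Coefficients of the first fundamental form. -/
def gE (X : ℝ × ℝ → Fin 3 → ℝ) (p : ℝ × ℝ) : ℝ := du X p ⬝ᵥ du X p

/-- Coefficients of the first fundamental form. -/
def gF (X : ℝ × ℝ → Fin 3 → ℝ) (p : ℝ × ℝ) : ℝ := du X p ⬝ᵥ dv X p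

/-- Coefficients of the first fundamental form. -/
def gG (X : ℝ × ℝ → Fin 3 → ℝ) (p : ℝ × ℝ) : ℝ := dv X p ⬝ᵥ dv X p

/-- Determinant of the first fundamental form. -/
def gDet (X : ℝ × ℝ → Fin 3 → ℝ) (p : ℝ × ℝ) : ℝ := gE X p * gG X p - gF X p ^ 2

/-- The unit normal `X_u × X_v / |X_u × X_v|`. -/
def normal (X : ℝ × ℝ → Fin 3 → ℝ) (p : ℝ × ℝ) : Fin 3 → ℝ :=
  (Real.sqrt (gDet X p))⁻¹ • crossProduct (du X p) (dv X p)

/-- Coefficients of the second fundamental form. -/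
def hL (X : ℝ × ℝ → Fin 3 → ℝ) (p : ℝ × ℝ) : ℝ := du (du X) p ⬝ᵥ normal X p

/-- Coefficients of the second fundamental form. -/
def hM (X : ℝ × ℝ → Fin 3 → ℝ) (p : ℝ × ℝ) : ℝ := dv (du X) p ⬝ᵥ normal X p

/-- Coefficients of the second fundamental form. -/
def hN (X : ℝ × ℝ → Fin 3 → ℝ) (p : ℝ × ℝ) : ℝ := dv (dv X) p ⬝ᵥ normal X p

/-- Mean curvature `H = (κ₁ + κ₂) / 2`, with the sign for which `ΔX = 2 H ν`
(a unit sphere with its outward normal has `H = -1`). -/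
def meanCurv (X : ℝ × ℝ → Fin 3 → ℝ) (p : ℝ × ℝ) : ℝ :=
  (hL X p * gG X p - 2 * hM X p * gF X p + hN X p * gE X p) / (2 * gDet X p)

/-- Gaussian curvature. -/
def gaussCurv (X : ℝ × ℝ → Fin 3 → ℝ) (p : ℝ × ℝ) : ℝ :=
  (hL X p * hN X p - hM X p ^ 2) / gDet X p

/-! ### Curves and boundary curves -/

/-- Speed of a curve. -/
def speed (C : ℝ → Fin 3 → ℝ) (θ : ℝ) : ℝ := Real.sqrt (deriv C θ ⬝ᵥ deriv C θ)

/-- Unit tangent `T` of a curve. -/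
def unitTangent (C : ℝ → Fin 3 → ℝ) (θ : ℝ) : Fin 3 → ℝ := (speed C θ)⁻¹ • deriv C θ

/-- The derivative `T'` of the unit tangent with respect to arc length. -/
def curvVec (C : ℝ → Fin 3 → ℝ) (θ : ℝ) : Fin 3 → ℝ :=
  (speed C θ)⁻¹ • deriv (unitTangent C) θ

/-- The Frenet curvature `κ = |T'|`. -/
def curvature (C : ℝ → Fin 3 → ℝ) (θ : ℝ) : ℝ := Real.sqrt (curvVec C θ ⬝ᵥ curvVec C θ)

/-- The boundary curve of the surface `X` with label `s`, positively oriented. -/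
def bdryCurve (X : ℝ × ℝ → Fin 3 → ℝ) (s θ : ℝ) : Fin 3 → ℝ := X (bdryPoint s θ)

/-- The outward conormal `n = T × ν` along a boundary curve. -/
def conormal (X : ℝ × ℝ → Fin 3 → ℝ) (s θ : ℝ) : Fin 3 → ℝ :=
  crossProduct (unitTangent (bdryCurve X s) θ) (normal X (bdryPoint s θ))

/-- The geodesic curvature `κ_g = T' · n` of a boundary curve relative to the outward conormal
(so the boundary of a flat unit disc has `κ_g = -1`). -/
def geodCurv (X : ℝ × ℝ → Fin 3 → ℝ) (s θ : ℝ) : ℝ :=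
  curvVec (bdryCurve X s) θ ⬝ᵥ conormal X s θ

/-- `S` is a round circle of radius `R` in `ℝ³`. -/
def IsCircle (S : Set (Fin 3 → ℝ)) (R : ℝ) : Prop :=
  0 < R ∧ ∃ q u v : Fin 3 → ℝ, u ⬝ᵥ u = 1 ∧ v ⬝ᵥ v = 1 ∧ u ⬝ᵥ v = 0 ∧
    S = Set.range fun t : ℝ => q + R • (Real.cos t • u + Real.sin t • v)

/-! ### The energy -/

/-- `∫_Σ (a (H + c)² + b K) dΣ`. -/
def surfaceEnergy (a c b : ℝ) (τ : SurfaceType) (X : ℝ × ℝ → Fin 3 → ℝ) : ℝ :=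
  ∫ p in domain τ, (a * (meanCurv X p + c) ^ 2 + b * gaussCurv X p) * Real.sqrt (gDet X p)

/-- `∮ (α κ² + β) ds` for a closed curve of period `2π`. -/
def curveEnergy (α β : ℝ) (C : ℝ → Fin 3 → ℝ) : ℝ :=
  ∫ θ in (0 : ℝ)..(2 * Real.pi), (α * curvature C θ ^ 2 + β) * speed C θ

/-- The Euler-Helfrich energy `E_{a,c,b,α,β}`. -/
def energy (a c b α β : ℝ) (τ : SurfaceType) (X : ℝ × ℝ → Fin 3 → ℝ) : ℝ :=
  surfaceEnergy a c b τ X + ∑ s ∈ boundaryLabels τ, curveEnergy α β (bdryCurve X s)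

/-! ### Immersions, symmetry, criticality, instability

Being of class `C⁴` up to the boundary means to be given by a map that is `C⁴` near the compact
domain. Nothing below depends on the values of that map off the domain. -/

/-- `X` is an immersion of class `C⁴` up to the boundary. -/
def IsC4Immersion (τ : SurfaceType) (X : ℝ × ℝ → Fin 3 → ℝ) : Prop :=
  ∀ p ∈ domain τ, ContDiffAt ℝ 4 X p ∧ Function.Injective (fderiv ℝ X p)

/-- `X` is a surface of revolution: it is obtained by rotating the profile curve `ρ ↦ (r ρ, z ρ)`
about the axis through `q` in the direction `e 2`, where `e` is an orthonormal frame. Either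
orientation of the surface is obtained from a suitable frame. -/
def IsAxiallySymmetric (τ : SurfaceType) (X : ℝ × ℝ → Fin 3 → ℝ) : Prop :=
  ∃ (q : Fin 3 → ℝ) (e : Fin 3 → Fin 3 → ℝ) (r z : ℝ → ℝ),
    (∀ i j, e i ⬝ᵥ e j = if i = j then 1 else 0) ∧
    ∀ ρ θ : ℝ, 0 ≤ ρ → (ρ * Real.cos θ, ρ * Real.sin θ) ∈ domain τ →
      X (ρ * Real.cos θ, ρ * Real.sin θ) =
        q + r ρ • (Real.cos θ • e 0 + Real.sin θ • e 1) + z ρ • e 2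

/-- `X` is critical for the energy: the first variation vanishes for every variation field of
class `C⁴` up to the boundary, with no condition at the boundary. -/
def IsCritical (a c b α β : ℝ) (τ : SurfaceType) (X : ℝ × ℝ → Fin 3 → ℝ) : Prop :=
  ∀ V : ℝ × ℝ → Fin 3 → ℝ, (∀ p ∈ domain τ, ContDiffAt ℝ 4 V p) →
    HasDerivAt (fun t : ℝ => energy a c b α β τ (fun p => X p + t • V p)) 0 0

/-- `F` is a variation of `X`: a one-parameter family of surfaces through `X`, of class `C⁴` in
the parameter and the point jointly. For small parameters it consists of immersions if `X` is
one. -/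
def IsVariation (τ : SurfaceType) (X : ℝ × ℝ → Fin 3 → ℝ)
    (F : ℝ → ℝ × ℝ → Fin 3 → ℝ) : Prop :=
  (∀ p ∈ domain τ, F 0 p = X p) ∧
  ∀ p ∈ domain τ, ContDiffAt ℝ 4 (fun w : ℝ × (ℝ × ℝ) => F w.1 w.2) ((0 : ℝ), p)

/-- A critical surface `X` is unstable if the second variation of the energy is negative for some
variation. -/
def IsUnstable (a c b α β : ℝ) (τ : SurfaceType) (X : ℝ × ℝ → Fin 3 → ℝ) : Prop :=
  ∃ F : ℝ → ℝ × ℝ → Fin 3 → ℝ, IsVariation τ X F ∧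
    iteratedDeriv 2 (fun t : ℝ => energy a c b α β τ (F t)) 0 < 0

/-- The boundary component with label `s` is a geodesic circle of radius `R`. -/
def IsGeodesicCircle (X : ℝ × ℝ → Fin 3 → ℝ) (s R : ℝ) : Prop :=
  IsCircle (Set.range (bdryCurve X s)) R ∧ ∀ θ, geodCurv X s θ = 0

end EulerHelfrich

end

open Matrix MeasureTheory

noncomputable section

namespace EulerHelfrich

open Filter Topology Set

/-! All variations used are rotationally symmetric, so the problem lives on the profile curve (r, z)
with speed S, unit tangent (r', z')/S and principal curvatures k₁ = z'/(rS) and k₂. The energy is 2π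
times the integral of a(H + c')² r S, minus b times the increment of r'/S (Gauss–Bonnet,
`integral_prDens`), plus α/r + βr for each boundary circle. Here c' = `frameDet e * c` absorbs the
orientation.

Write h = H + c', B = β − α/r², and ς = 1 or −1 at an outer or inner circle. The first variation
with a free end (`IsProfile.euler_lagrange`) gives the vanishing of the axial flux, an integrated
equation for the radial flux, and the natural condition a h = −b k₁. At the end they combine to a h
(h − k₂) r S = −ς B r' (`IsProfile.boundary_equations`).

The main test variation slides one boundary circle along the surface itself, prolonged slightly
beyond its edge if necessary. The energy becomes a function of the end parameter, and the
Euler–Lagrange equations reduce its second derivative to 2π times ς b r' S (k₂ − k₁)² + (2α/r³ −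
B/r) r'² − B S z' k₂ (`IsProfile.isUnstable_of_shift`). On a geodesic circle r' = 0 and this is a
positive multiple of (α/r² − β) K, which is criterion (i). If moreover b ≠ 0, then h = k₂ there, so
K = −b k₁²/a, and (ii), (iii) follow from the same sign.

On a circle of radius √(α/β) one has B = 0, hence h = k₂ or h = 0. If h = k₂, then k₂ − k₁ = 2c' and
all boundary data are explicit; the bound on α is what makes the displayed expression negative
(`critical_radius_inequality`).

If h = 0, sliding one end is not enough. Now h and the radial flux solve a homogeneous linear system
with zero data, so H = −c' everywhere (`IsProfile.prH_eq_zero`). The natural condition then forces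
z' = 0 at every boundary circle, and the first integral r z'/S = c'(R² − r²) forces all of them to
have radius R. A disc is impossible, since r tends to 0 at the axis. An annulus is a Delaunay piece;
there the slides of both ends are combined with the derivative of the Delaunay family in R at fixed
tangent direction. Along this family h vanishes to first order, so bending does not contribute to
the second variation. What remains is a quadratic expression in the two end speeds whose direction
terms have coefficients of equal modulus, at least one of them negative; it takes a negative value
(`exists_quadratic_neg`). -/

/-! ### Orthonormal frames -/

/-- `e` is an orthonormal frame of `ℝ³`. -/
def IsFrame (e : Fin 3 → Fin 3 → ℝ) : Prop := ∀ i j, e i ⬝ᵥ e j = if i = j then 1 else 0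

/-- The determinant of a frame. -/
def frameDet (e : Fin 3 → Fin 3 → ℝ) : ℝ := crossProduct (e 0) (e 1) ⬝ᵥ e 2

/-- A matrix with orthonormal rows also has orthonormal columns, and column orthonormality is the
expansion of the standard basis vectors in the frame. -/
lemma IsFrame.expand {e : Fin 3 → Fin 3 → ℝ} (he : IsFrame e) (v : Fin 3 → ℝ) :
    v = (v ⬝ᵥ e 0) • e 0 + (v ⬝ᵥ e 1) • e 1 + (v ⬝ᵥ e 2) • e 2 := by
  have h1 : (Matrix.of e) * (Matrix.of e)ᵀ = 1 := by
    ext i j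
    have := he i j
    simpa [Matrix.mul_apply, dotProduct, Matrix.one_apply] using this
  have h2 : (Matrix.of e)ᵀ * (Matrix.of e) = 1 := mul_eq_one_comm.mp h1
  have h3 : ∀ i j, ∑ k, e k i * e k j = if i = j then 1 else 0 := by
    intro i j
    have := congrFun (congrFun h2 i) j
    simpa [Matrix.mul_apply, Matrix.one_apply] using this
  ext j
  have h0 := h3 0 j
  have h1 := h3 1 j
  have h2 := h3 2 j
  simp only [Fin.sum_univ_three] at h0 h1 h2
  simp only [dotProduct, Fin.sum_univ_three, Pi.add_apply, Pi.smul_apply, smul_eq_mul]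
  have : v j = v 0 * (if (0 : Fin 3) = j then 1 else 0) + v 1 * (if (1 : Fin 3) = j then 1 else 0)
      + v 2 * (if (2 : Fin 3) = j then 1 else 0) := by
    fin_cases j <;> simp
  rw [this, ← h0, ← h1, ← h2]
  ring

lemma IsFrame.cross01 {e : Fin 3 → Fin 3 → ℝ} (he : IsFrame e) :
    crossProduct (e 0) (e 1) = frameDet e • e 2 := by
  rw [he.expand (crossProduct (e 0) (e 1))]
  have h0 : crossProduct (e 0) (e 1) ⬝ᵥ e 0 = 0 := by
    rw [dotProduct_comm]; exact dot_self_cross _ _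
  have h1 : crossProduct (e 0) (e 1) ⬝ᵥ e 1 = 0 := by
    rw [dotProduct_comm]; exact dot_cross_self _ _
  rw [h0, h1, frameDet]
  simp

lemma IsFrame.cross12 {e : Fin 3 → Fin 3 → ℝ} (he : IsFrame e) :
    crossProduct (e 1) (e 2) = frameDet e • e 0 := by
  rw [he.expand (crossProduct (e 1) (e 2))]
  have h0 : crossProduct (e 1) (e 2) ⬝ᵥ e 1 = 0 := by
    rw [dotProduct_comm]; exact dot_self_cross _ _
  have h1 : crossProduct (e 1) (e 2) ⬝ᵥ e 2 = 0 := by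
    rw [dotProduct_comm]; exact dot_cross_self _ _
  have h2 : crossProduct (e 1) (e 2) ⬝ᵥ e 0 = frameDet e := by
    rw [frameDet, dotProduct_comm, dotProduct_comm (crossProduct _ _)]
    exact (triple_product_permutation (e 2) (e 0) (e 1)).symm
  rw [h0, h1, h2]
  simp

lemma IsFrame.cross20 {e : Fin 3 → Fin 3 → ℝ} (he : IsFrame e) :
    crossProduct (e 2) (e 0) = frameDet e • e 1 := by
  rw [he.expand (crossProduct (e 2) (e 0))]
  have h0 : crossProduct (e 2) (e 0) ⬝ᵥ e 2 = 0 := by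
    rw [dotProduct_comm]; exact dot_self_cross _ _
  have h1 : crossProduct (e 2) (e 0) ⬝ᵥ e 0 = 0 := by
    rw [dotProduct_comm]; exact dot_cross_self _ _
  have h2 : crossProduct (e 2) (e 0) ⬝ᵥ e 1 = frameDet e := by
    rw [frameDet, dotProduct_comm, dotProduct_comm (crossProduct _ _)]
    exact triple_product_permutation (e 1) (e 2) (e 0)
  rw [h0, h1, h2]
  simp

lemma IsFrame.dot {e : Fin 3 → Fin 3 → ℝ} (he : IsFrame e) (x y z x' y' z' : ℝ) :
    (x • e 0 + y • e 1 + z • e 2) ⬝ᵥ (x' • e 0 + y' • e 1 + z' • e 2) =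
      x * x' + y * y' + z * z' := by
  simp [add_dotProduct, dotProduct_add, smul_dotProduct, dotProduct_smul, he _ _]
  try ring

lemma IsFrame.cross {e : Fin 3 → Fin 3 → ℝ} (he : IsFrame e) (x y z x' y' z' : ℝ) :
    crossProduct (x • e 0 + y • e 1 + z • e 2) (x' • e 0 + y' • e 1 + z' • e 2) =
      (frameDet e * (y * z' - z * y')) • e 0 + (frameDet e * (z * x' - x * z')) • e 1 +
        (frameDet e * (x * y' - y * x')) • e 2 := by
  have h10 : crossProduct (e 1) (e 0) = -(frameDet e • e 2) := by
    rw [← he.cross01, cross_anticomm]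
  have h21 : crossProduct (e 2) (e 1) = -(frameDet e • e 0) := by
    rw [← he.cross12, cross_anticomm]
  have h02 : crossProduct (e 0) (e 2) = -(frameDet e • e 1) := by
    rw [← he.cross20, cross_anticomm]
  simp only [map_add, map_smul, LinearMap.add_apply, LinearMap.smul_apply, cross_self, h10, h21, h02,
    he.cross01, he.cross12, he.cross20]
  module

/-- Frames of both orientations have to be allowed, because the orientation of the surface is
encoded in the frame. Reversing it changes the sign of H, which for the energy amounts to changing
the sign of c; this is why `frameDet e * c` appears below. -/
lemma IsFrame.frameDet_sq {e : Fin 3 → Fin 3 → ℝ} (he : IsFrame e) : frameDet e ^ 2 = 1 := by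
  have h := cross_dot_cross (e 0) (e 1) (e 0) (e 1)
  rw [he.cross01] at h
  simp [he _ _] at h
  nlinarith [h]

/-! ### Rotationally symmetric surfaces in terms of the squared radius -/

/-- The rotationally symmetric surface with radial factor `A` and height `B`, both functions of the
squared distance to the origin. -/
def sqSurf (q : Fin 3 → ℝ) (e : Fin 3 → Fin 3 → ℝ) (A B : ℝ → ℝ) (p : ℝ × ℝ) : Fin 3 → ℝ :=
  q + A (p.1 ^ 2 + p.2 ^ 2) • (p.1 • e 0 + p.2 • e 1) + B (p.1 ^ 2 + p.2 ^ 2) • e 2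

lemma du_eq_of_hasDerivAt {X : ℝ × ℝ → Fin 3 → ℝ} {p : ℝ × ℝ} {v : Fin 3 → ℝ}
    (hX : DifferentiableAt ℝ X p) (h : HasDerivAt (fun u => X (u, p.2)) v p.1) : du X p = v := by
  have h1 : HasDerivAt (fun u : ℝ => (u, p.2)) (1, 0) p.1 :=
    (hasDerivAt_id p.1).prodMk (hasDerivAt_const _ _)
  have h2 : HasDerivAt (X ∘ fun u : ℝ => (u, p.2)) (fderiv ℝ X p (1, 0)) p.1 :=
    HasFDerivAt.comp_hasDerivAt (x := p.1) (f := fun u : ℝ => (u, p.2)) hX.hasFDerivAt h1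
  exact h2.unique h

lemma dv_eq_of_hasDerivAt {X : ℝ × ℝ → Fin 3 → ℝ} {p : ℝ × ℝ} {v : Fin 3 → ℝ}
    (hX : DifferentiableAt ℝ X p) (h : HasDerivAt (fun u => X (p.1, u)) v p.2) : dv X p = v := by
  have h1 : HasDerivAt (fun u : ℝ => (p.1, u)) (0, 1) p.2 :=
    (hasDerivAt_const _ _).prodMk (hasDerivAt_id p.2)
  have h2 : HasDerivAt (X ∘ fun u : ℝ => (p.1, u)) (fderiv ℝ X p (0, 1)) p.2 :=
    HasFDerivAt.comp_hasDerivAt (x := p.2) (f := fun u : ℝ => (p.1, u)) hX.hasFDerivAt h1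
  exact h2.unique h

lemma du_congr {X Y : ℝ × ℝ → Fin 3 → ℝ} {p : ℝ × ℝ} (h : X =ᶠ[𝓝 p] Y) : du X p = du Y p := by
  simp only [du, h.fderiv_eq]

lemma dv_congr {X Y : ℝ × ℝ → Fin 3 → ℝ} {p : ℝ × ℝ} (h : X =ᶠ[𝓝 p] Y) : dv X p = dv Y p := by
  simp only [dv, h.fderiv_eq]

variable {q : Fin 3 → ℝ} {e : Fin 3 → Fin 3 → ℝ} {A B : ℝ → ℝ} {p : ℝ × ℝ}

/-- Writing the surface in terms of the squared radius keeps the Cartesian partial derivatives free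
of square roots: the inner function is a polynomial. -/
lemma differentiableAt_sqSurf
    (hA : DifferentiableAt ℝ A (p.1 ^ 2 + p.2 ^ 2)) (hB : DifferentiableAt ℝ B (p.1 ^ 2 + p.2 ^ 2)) :
    DifferentiableAt ℝ (sqSurf q e A B) p := by
  have h : DifferentiableAt ℝ (fun p : ℝ × ℝ => p.1 ^ 2 + p.2 ^ 2) p := by fun_prop
  have hA' : DifferentiableAt ℝ (fun p : ℝ × ℝ => A (p.1 ^ 2 + p.2 ^ 2)) p :=
    DifferentiableAt.comp (g := A) p hA h
  have hB' : DifferentiableAt ℝ (fun p : ℝ × ℝ => B (p.1 ^ 2 + p.2 ^ 2)) p :=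
    DifferentiableAt.comp (g := B) p hB h
  unfold sqSurf
  fun_prop

/-- First partial derivative of `sqSurf` in frame coordinates. -/
lemma du_sqSurf {A₁ B₁ : ℝ} (hA : HasDerivAt A A₁ (p.1 ^ 2 + p.2 ^ 2))
    (hB : HasDerivAt B B₁ (p.1 ^ 2 + p.2 ^ 2)) :
    du (sqSurf q e A B) p = (A (p.1 ^ 2 + p.2 ^ 2) + 2 * p.1 ^ 2 * A₁) • e 0 +
      (2 * p.1 * p.2 * A₁) • e 1 + (2 * p.1 * B₁) • e 2 := by
  apply du_eq_of_hasDerivAt (differentiableAt_sqSurf hA.differentiableAt hB.differentiableAt)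
  have hw : HasDerivAt (fun u : ℝ => u ^ 2 + p.2 ^ 2) (2 * p.1) p.1 := by
    simpa using (hasDerivAt_pow 2 p.1).add_const (p.2 ^ 2)
  have hA' : HasDerivAt (fun u : ℝ => A (u ^ 2 + p.2 ^ 2)) (A₁ * (2 * p.1)) p.1 :=
    HasDerivAt.comp (h₂ := A) p.1 hA hw
  have hB' : HasDerivAt (fun u : ℝ => B (u ^ 2 + p.2 ^ 2)) (B₁ * (2 * p.1)) p.1 :=
    HasDerivAt.comp (h₂ := B) p.1 hB hw
  have hP : HasDerivAt (fun u : ℝ => u • e 0 + p.2 • e 1) ((1 : ℝ) • e 0) p.1 :=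
    ((hasDerivAt_id p.1).smul_const (e 0)).add_const _
  have := ((hA'.smul hP).const_add q).add (hB'.smul_const (e 2))
  refine this.congr_deriv ?_
  module

lemma dv_sqSurf {A₁ B₁ : ℝ} (hA : HasDerivAt A A₁ (p.1 ^ 2 + p.2 ^ 2))
    (hB : HasDerivAt B B₁ (p.1 ^ 2 + p.2 ^ 2)) :
    dv (sqSurf q e A B) p = (2 * p.1 * p.2 * A₁) • e 0 +
      (A (p.1 ^ 2 + p.2 ^ 2) + 2 * p.2 ^ 2 * A₁) • e 1 + (2 * p.2 * B₁) • e 2 := by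
  apply dv_eq_of_hasDerivAt (differentiableAt_sqSurf hA.differentiableAt hB.differentiableAt)
  have hw : HasDerivAt (fun u : ℝ => p.1 ^ 2 + u ^ 2) (2 * p.2) p.2 := by
    simpa using (hasDerivAt_pow 2 p.2).const_add (p.1 ^ 2)
  have hA' : HasDerivAt (fun u : ℝ => A (p.1 ^ 2 + u ^ 2)) (A₁ * (2 * p.2)) p.2 :=
    HasDerivAt.comp (h₂ := A) p.2 hA hw
  have hB' : HasDerivAt (fun u : ℝ => B (p.1 ^ 2 + u ^ 2)) (B₁ * (2 * p.2)) p.2 :=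
    HasDerivAt.comp (h₂ := B) p.2 hB hw
  have hP : HasDerivAt (fun u : ℝ => p.1 • e 0 + u • e 1) ((1 : ℝ) • e 1) p.2 :=
    ((hasDerivAt_id p.2).smul_const (e 1)).const_add _
  have := ((hA'.smul hP).const_add q).add (hB'.smul_const (e 2))
  refine this.congr_deriv ?_
  module

/-- The partial derivatives of second order of `sqSurf` in frame coordinates. -/
lemma second_sqSurf {A' B' : ℝ → ℝ} {A₂ B₂ : ℝ}
    (hA : ∀ᶠ w in 𝓝 (p.1 ^ 2 + p.2 ^ 2), HasDerivAt A (A' w) w)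
    (hB : ∀ᶠ w in 𝓝 (p.1 ^ 2 + p.2 ^ 2), HasDerivAt B (B' w) w)
    (hA' : HasDerivAt A' A₂ (p.1 ^ 2 + p.2 ^ 2)) (hB' : HasDerivAt B' B₂ (p.1 ^ 2 + p.2 ^ 2)) :
    du (du (sqSurf q e A B)) p =
      (6 * p.1 * A' (p.1 ^ 2 + p.2 ^ 2) + 4 * p.1 ^ 3 * A₂) • e 0 +
      (2 * p.2 * A' (p.1 ^ 2 + p.2 ^ 2) + 4 * p.1 ^ 2 * p.2 * A₂) • e 1 +
      (2 * B' (p.1 ^ 2 + p.2 ^ 2) + 4 * p.1 ^ 2 * B₂) • e 2 ∧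
    dv (du (sqSurf q e A B)) p =
      (2 * p.2 * A' (p.1 ^ 2 + p.2 ^ 2) + 4 * p.1 ^ 2 * p.2 * A₂) • e 0 +
      (2 * p.1 * A' (p.1 ^ 2 + p.2 ^ 2) + 4 * p.1 * p.2 ^ 2 * A₂) • e 1 +
      (4 * p.1 * p.2 * B₂) • e 2 ∧
    dv (dv (sqSurf q e A B)) p =
      (2 * p.1 * A' (p.1 ^ 2 + p.2 ^ 2) + 4 * p.1 * p.2 ^ 2 * A₂) • e 0 +
      (6 * p.2 * A' (p.1 ^ 2 + p.2 ^ 2) + 4 * p.2 ^ 3 * A₂) • e 1 +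
      (2 * B' (p.1 ^ 2 + p.2 ^ 2) + 4 * p.2 ^ 2 * B₂) • e 2 := by
  have hcw : ContinuousAt (fun p : ℝ × ℝ => p.1 ^ 2 + p.2 ^ 2) p := by fun_prop
  have hdu : du (sqSurf q e A B) =ᶠ[𝓝 p] fun p =>
      (A (p.1 ^ 2 + p.2 ^ 2) + 2 * p.1 ^ 2 * A' (p.1 ^ 2 + p.2 ^ 2)) • e 0 +
      (2 * p.1 * p.2 * A' (p.1 ^ 2 + p.2 ^ 2)) • e 1 + (2 * p.1 * B' (p.1 ^ 2 + p.2 ^ 2)) • e 2 := by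
    filter_upwards [hcw.eventually hA, hcw.eventually hB] with p' h1 h2 using du_sqSurf h1 h2
  have hdv : dv (sqSurf q e A B) =ᶠ[𝓝 p] fun p =>
      (2 * p.1 * p.2 * A' (p.1 ^ 2 + p.2 ^ 2)) • e 0 +
      (A (p.1 ^ 2 + p.2 ^ 2) + 2 * p.2 ^ 2 * A' (p.1 ^ 2 + p.2 ^ 2)) • e 1 +
      (2 * p.2 * B' (p.1 ^ 2 + p.2 ^ 2)) • e 2 := by
    filter_upwards [hcw.eventually hA, hcw.eventually hB] with p' h1 h2 using dv_sqSurf h1 h2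
  have hA0 := hA.self_of_nhds
  have hB0 := hB.self_of_nhds
  have dA := hA0.differentiableAt
  have dA' := hA'.differentiableAt
  have dB' := hB'.differentiableAt
  have hwu : HasDerivAt (fun u : ℝ => u ^ 2 + p.2 ^ 2) (2 * p.1) p.1 := by
    simpa using (hasDerivAt_pow 2 p.1).add_const (p.2 ^ 2)
  have hwv : HasDerivAt (fun u : ℝ => p.1 ^ 2 + u ^ 2) (2 * p.2) p.2 := by
    simpa using (hasDerivAt_pow 2 p.2).const_add (p.1 ^ 2)
  have uA : HasDerivAt (fun u : ℝ => A (u ^ 2 + p.2 ^ 2)) _ p.1 :=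
    HasDerivAt.comp (h₂ := A) p.1 hA0 hwu
  have uA' : HasDerivAt (fun u : ℝ => A' (u ^ 2 + p.2 ^ 2)) _ p.1 :=
    HasDerivAt.comp (h₂ := A') p.1 hA' hwu
  have uB' : HasDerivAt (fun u : ℝ => B' (u ^ 2 + p.2 ^ 2)) _ p.1 :=
    HasDerivAt.comp (h₂ := B') p.1 hB' hwu
  have vA : HasDerivAt (fun u : ℝ => A (p.1 ^ 2 + u ^ 2)) _ p.2 :=
    HasDerivAt.comp (h₂ := A) p.2 hA0 hwv
  have vA' : HasDerivAt (fun u : ℝ => A' (p.1 ^ 2 + u ^ 2)) _ p.2 :=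
    HasDerivAt.comp (h₂ := A') p.2 hA' hwv
  have vB' : HasDerivAt (fun u : ℝ => B' (p.1 ^ 2 + u ^ 2)) _ p.2 :=
    HasDerivAt.comp (h₂ := B') p.2 hB' hwv
  have idu : HasDerivAt (fun u : ℝ => u) 1 p.1 := hasDerivAt_id' _
  have idv : HasDerivAt (fun u : ℝ => u) 1 p.2 := hasDerivAt_id' _
  refine ⟨?_, ?_, ?_⟩
  · rw [du_congr hdu]
    apply du_eq_of_hasDerivAt (by fun_prop)
    have := (((uA.add (((hasDerivAt_pow 2 p.1).const_mul 2).mul uA')).smul_const (e 0)).add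
      ((((idu.const_mul 2).mul_const p.2).mul uA').smul_const (e 1))).add
      (((idu.const_mul 2).mul uB').smul_const (e 2))
    refine this.congr_deriv ?_
    push_cast
    module
  · rw [dv_congr hdu]
    apply dv_eq_of_hasDerivAt (by fun_prop)
    have := (((vA.add (vA'.const_mul (2 * p.1 ^ 2))).smul_const (e 0)).add
      (((idv.const_mul (2 * p.1)).mul vA').smul_const (e 1))).add
      ((vB'.const_mul (2 * p.1)).smul_const (e 2))
    refine this.congr_deriv ?_
    module
  · rw [dv_congr hdv]
    apply dv_eq_of_hasDerivAt (by fun_prop)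
    have := ((((idv.const_mul (2 * p.1)).mul vA').smul_const (e 0)).add
      ((vA.add (((hasDerivAt_pow 2 p.2).const_mul 2).mul vA')).smul_const (e 1))).add
      (((idv.const_mul 2).mul vB').smul_const (e 2))
    refine this.congr_deriv ?_
    push_cast
    module

/-! ### Curvatures of a surface of revolution -/

/-- The surface of revolution with profile curve `(r, z)`. -/
def revol (q : Fin 3 → ℝ) (e : Fin 3 → Fin 3 → ℝ) (r z : ℝ → ℝ) : ℝ × ℝ → Fin 3 → ℝ :=
  sqSurf q e (fun w => r (Real.sqrt w) / Real.sqrt w) (fun w => z (Real.sqrt w))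

/-- Distance to the origin in the parameter plane. -/
def rad (p : ℝ × ℝ) : ℝ := Real.sqrt (p.1 ^ 2 + p.2 ^ 2)

/-- Speed of the profile curve. -/
def prSpeed (r z : ℝ → ℝ) (x : ℝ) : ℝ := Real.sqrt (deriv r x ^ 2 + deriv z x ^ 2)

/-- Principal curvature of a surface of revolution along the parallels. -/
def prK1 (r z : ℝ → ℝ) (x : ℝ) : ℝ := deriv z x / (r x * prSpeed r z x)

/-- Principal curvature of a surface of revolution along the meridians. -/
def prK2 (r z : ℝ → ℝ) (x : ℝ) : ℝ :=
  (deriv r x * deriv (deriv z) x - deriv z x * deriv (deriv r) x) / prSpeed r z x ^ 3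

/-- The integrand of `surfaceEnergy`. -/
def surfDens (a c b : ℝ) (X : ℝ × ℝ → Fin 3 → ℝ) (p : ℝ × ℝ) : ℝ :=
  (a * (meanCurv X p + c) ^ 2 + b * gaussCurv X p) * Real.sqrt (gDet X p)

/-- The energy density of a surface of revolution per unit of the profile parameter and angle. -/
def prDens (a c b : ℝ) (r z : ℝ → ℝ) (x : ℝ) : ℝ :=
  (a * ((prK1 r z x + prK2 r z x) / 2 + c) ^ 2 + b * (prK1 r z x * prK2 r z x)) *
    (r x * prSpeed r z x)

variable {q : Fin 3 → ℝ} {e : Fin 3 → Fin 3 → ℝ} {p : ℝ × ℝ}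

/-- For a profile (r, z) with parameter x = √w one has A = r/x, A + 2wA₁ = r' and 2xB₁ = z', so S is
the speed of the profile. Only its square is prescribed, which keeps radicals out of the algebra. -/
lemma normal_sqSurf (he : IsFrame e) {A B : ℝ → ℝ} {A₁ B₁ : ℝ}
    (hA : HasDerivAt A A₁ (p.1 ^ 2 + p.2 ^ 2)) (hB : HasDerivAt B B₁ (p.1 ^ 2 + p.2 ^ 2))
    {S : ℝ} (hS : 0 < S) (hA0 : 0 < A (p.1 ^ 2 + p.2 ^ 2))
    (hSq : S ^ 2 = (A (p.1 ^ 2 + p.2 ^ 2) + 2 * (p.1 ^ 2 + p.2 ^ 2) * A₁) ^ 2 +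
      4 * (p.1 ^ 2 + p.2 ^ 2) * B₁ ^ 2) :
    gDet (sqSurf q e A B) p = (A (p.1 ^ 2 + p.2 ^ 2) * S) ^ 2 ∧
    normal (sqSurf q e A B) p = (-(frameDet e * (2 * p.1 * B₁) / S)) • e 0 +
      (-(frameDet e * (2 * p.2 * B₁) / S)) • e 1 +
      (frameDet e * (A (p.1 ^ 2 + p.2 ^ 2) + 2 * (p.1 ^ 2 + p.2 ^ 2) * A₁) / S) • e 2 := by
  have h1 : gDet (sqSurf q e A B) p = (A (p.1 ^ 2 + p.2 ^ 2) * S) ^ 2 := by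
    simp only [gDet, gE, gF, gG]
    rw [du_sqSurf hA hB, dv_sqSurf hA hB, he.dot, he.dot, he.dot, mul_pow, hSq]
    ring
  refine ⟨h1, ?_⟩
  have h2 : Real.sqrt (gDet (sqSurf q e A B) p) = A (p.1 ^ 2 + p.2 ^ 2) * S := by
    rw [h1, Real.sqrt_sq (by positivity)]
  rw [normal, h2, du_sqSurf hA hB, dv_sqSurf hA hB, he.cross, smul_add, smul_add, smul_smul,
    smul_smul, smul_smul]
  have := hA0.ne'
  have := hS.ne'
  congr 1
  · congr 1
    · congr 1; field_simp; ring
    · congr 1; field_simp; ring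
  · congr 1; field_simp; ring

lemma curvatures_sqSurf (he : IsFrame e) {A B A' B' : ℝ → ℝ} {A₂ B₂ : ℝ}
    (hA : ∀ᶠ w in 𝓝 (p.1 ^ 2 + p.2 ^ 2), HasDerivAt A (A' w) w)
    (hB : ∀ᶠ w in 𝓝 (p.1 ^ 2 + p.2 ^ 2), HasDerivAt B (B' w) w)
    (hA' : HasDerivAt A' A₂ (p.1 ^ 2 + p.2 ^ 2)) (hB' : HasDerivAt B' B₂ (p.1 ^ 2 + p.2 ^ 2))
    {S w a₀ a₁ b₁ : ℝ} (hS : 0 < S) (hw : w = p.1 ^ 2 + p.2 ^ 2)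
    (ha₀ : A (p.1 ^ 2 + p.2 ^ 2) = a₀) (ha₁ : A' (p.1 ^ 2 + p.2 ^ 2) = a₁)
    (hb₁ : B' (p.1 ^ 2 + p.2 ^ 2) = b₁) (h0 : 0 < a₀)
    (hSq : S ^ 2 = (a₀ + 2 * w * a₁) ^ 2 + 4 * w * b₁ ^ 2) :
    meanCurv (sqSurf q e A B) p = frameDet e * (2 * b₁ / (a₀ * S) + (2 * a₀ * b₁ + 4 * w *
      ((a₀ + 2 * w * a₁) * B₂ - 2 * a₁ * b₁ - 2 * w * A₂ * b₁)) / S ^ 3) / 2 ∧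
    gaussCurv (sqSurf q e A B) p = (2 * b₁ / (a₀ * S)) * ((2 * a₀ * b₁ + 4 * w *
      ((a₀ + 2 * w * a₁) * B₂ - 2 * a₁ * b₁ - 2 * w * A₂ * b₁)) / S ^ 3) := by
  subst hw ha₀ ha₁ hb₁
  obtain ⟨hdet, hnor⟩ := normal_sqSurf (q := q) he hA.self_of_nhds hB.self_of_nhds hS h0 hSq
  obtain ⟨huu, huv, hvv⟩ := second_sqSurf (q := q) (e := e) hA hB hA' hB'
  have hd := he.frameDet_sq
  set w := p.1 ^ 2 + p.2 ^ 2 with hw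
  set a₀ := A w
  set a₁ := A' w
  set b₁ := B' w
  -- Both fundamental forms are a multiple of the identity plus a multiple of p ⊗ p. The number 4k
  -- is, up to the factor `frameDet e / S`, the p ⊗ p coefficient of the second form; that of the
  -- first is 4(a₀a₁ + wa₁² + b₁²). Hence the principal directions are the angular and the radial
  -- one.
  set k := (a₀ + 2 * w * a₁) * B₂ - 2 * a₁ * b₁ - 2 * w * A₂ * b₁ with hk
  have hL : hL (sqSurf q e A B) p = frameDet e * (2 * a₀ * b₁ + 4 * p.1 ^ 2 * k) / S := by
    rw [EulerHelfrich.hL, huu, hnor, he.dot, hk, hw]; field_simp; ring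
  have hM : hM (sqSurf q e A B) p = frameDet e * (4 * p.1 * p.2 * k) / S := by
    rw [EulerHelfrich.hM, huv, hnor, he.dot, hk, hw]; field_simp; ring
  have hN : hN (sqSurf q e A B) p = frameDet e * (2 * a₀ * b₁ + 4 * p.2 ^ 2 * k) / S := by
    rw [EulerHelfrich.hN, hvv, hnor, he.dot, hk, hw]; field_simp; ring
  have hE : gE (sqSurf q e A B) p = a₀ ^ 2 + 4 * p.1 ^ 2 * (a₀ * a₁ + w * a₁ ^ 2 + b₁ ^ 2) := by
    rw [gE, du_sqSurf hA.self_of_nhds hB.self_of_nhds, he.dot, hw]; ring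
  have hF : gF (sqSurf q e A B) p = 4 * p.1 * p.2 * (a₀ * a₁ + w * a₁ ^ 2 + b₁ ^ 2) := by
    rw [gF, du_sqSurf hA.self_of_nhds hB.self_of_nhds, dv_sqSurf hA.self_of_nhds hB.self_of_nhds,
      he.dot, hw]; ring
  have hG : gG (sqSurf q e A B) p = a₀ ^ 2 + 4 * p.2 ^ 2 * (a₀ * a₁ + w * a₁ ^ 2 + b₁ ^ 2) := by
    rw [gG, dv_sqSurf hA.self_of_nhds hB.self_of_nhds, he.dot, hw]; ring
  have hSq' : S ^ 2 = a₀ ^ 2 + 4 * w * (a₀ * a₁ + w * a₁ ^ 2 + b₁ ^ 2) := by rw [hSq]; ring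
  constructor
  · rw [meanCurv, hdet, hL, hM, hN, hE, hF, hG]
    have e1 : 2 * b₁ / (a₀ * S) + (2 * a₀ * b₁ + 4 * w * k) / S ^ 3 =
        (2 * b₁ * S ^ 2 + a₀ * (2 * a₀ * b₁ + 4 * w * k)) / (a₀ * S ^ 3) := by
      field_simp
    rw [e1, hSq']
    generalize a₀ * a₁ + w * a₁ ^ 2 + b₁ ^ 2 = m
    generalize k = k'
    field_simp
    rw [hw]
    ring
  · rw [gaussCurv, hdet, hL, hM, hN]
    have : frameDet e * (2 * a₀ * b₁ + 4 * p.1 ^ 2 * k) / S *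
        (frameDet e * (2 * a₀ * b₁ + 4 * p.2 ^ 2 * k) / S) -
        (frameDet e * (4 * p.1 * p.2 * k) / S) ^ 2 = frameDet e ^ 2 *
        (2 * a₀ * b₁ * (2 * a₀ * b₁ + 4 * w * k)) / S ^ 2 := by
      rw [hw]; field_simp; ring
    rw [this, hd]
    field_simp

lemma rad_sq (p : ℝ × ℝ) : rad p ^ 2 = p.1 ^ 2 + p.2 ^ 2 := Real.sq_sqrt (by positivity)

lemma rad_polar {x : ℝ} (hx : 0 ≤ x) (θ : ℝ) : rad (x * Real.cos θ, x * Real.sin θ) = x := by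
  have : (x * Real.cos θ) ^ 2 + (x * Real.sin θ) ^ 2 = x ^ 2 := by
    linear_combination x ^ 2 * Real.sin_sq_add_cos_sq θ
  simp only [rad]
  rw [this, Real.sqrt_sq hx]

lemma continuous_rad : Continuous rad := by unfold rad; fun_prop

lemma hasDerivAt_comp_sqrt {f : ℝ → ℝ} {f' w : ℝ} (hw : 0 < w)
    (hf : HasDerivAt f f' (Real.sqrt w)) :
    HasDerivAt (fun w => f (Real.sqrt w)) (f' / (2 * Real.sqrt w)) w := by
  have := HasDerivAt.comp (h₂ := f) w hf (Real.hasDerivAt_sqrt hw.ne')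
  refine this.congr_deriv ?_
  ring

section pointwise

variable {r z : ℝ → ℝ}

lemma hasDerivAt_deriv_of_contDiffAt {f : ℝ → ℝ} {x : ℝ} (hf : ContDiffAt ℝ 2 f x) :
    (∀ᶠ y in 𝓝 x, HasDerivAt f (deriv f y) y) ∧ HasDerivAt (deriv f) (deriv (deriv f) x) x := by
  constructor
  · filter_upwards [hf.eventually (by simp)] with y hy
    exact (hy.differentiableAt (by simp)).hasDerivAt
  · have : ContDiffAt ℝ 1 (deriv f) x := by
      exact hf.derivWithin (by norm_num)
    exact (this.differentiableAt (by simp)).hasDerivAt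

/-- The geometry of a surface of revolution at a point off the axis. -/
lemma revol_geometry (he : IsFrame e) (hp : 0 < rad p) (hr : ContDiffAt ℝ 2 r (rad p))
    (hz : ContDiffAt ℝ 2 z (rad p)) (hr0 : 0 < r (rad p)) (hS : 0 < prSpeed r z (rad p)) :
    Real.sqrt (gDet (revol q e r z) p) = r (rad p) * prSpeed r z (rad p) / rad p ∧
    meanCurv (revol q e r z) p = frameDet e * (prK1 r z (rad p) + prK2 r z (rad p)) / 2 ∧
    gaussCurv (revol q e r z) p = prK1 r z (rad p) * prK2 r z (rad p) ∧
    normal (revol q e r z) p =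
      (-(frameDet e * (p.1 / rad p * deriv z (rad p)) / prSpeed r z (rad p))) • e 0 +
      (-(frameDet e * (p.2 / rad p * deriv z (rad p)) / prSpeed r z (rad p))) • e 1 +
      (frameDet e * deriv r (rad p) / prSpeed r z (rad p)) • e 2 := by
  set x := rad p with hx
  have hw0 : 0 < p.1 ^ 2 + p.2 ^ 2 := by rw [← rad_sq]; positivity
  have hxw : Real.sqrt (p.1 ^ 2 + p.2 ^ 2) = x := rfl
  have hxx : p.1 ^ 2 + p.2 ^ 2 = x ^ 2 := (rad_sq p).symm
  obtain ⟨hr1, hr2⟩ := hasDerivAt_deriv_of_contDiffAt hr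
  obtain ⟨hz1, hz2⟩ := hasDerivAt_deriv_of_contDiffAt hz
  have hsq : Tendsto Real.sqrt (𝓝 (p.1 ^ 2 + p.2 ^ 2)) (𝓝 x) := Real.continuous_sqrt.continuousAt
  have hpos : ∀ᶠ w in 𝓝 (p.1 ^ 2 + p.2 ^ 2), 0 < w := lt_mem_nhds hw0
  have hA : ∀ᶠ w in 𝓝 (p.1 ^ 2 + p.2 ^ 2),
      HasDerivAt (fun w => r (Real.sqrt w) / Real.sqrt w)
        ((Real.sqrt w * deriv r (Real.sqrt w) - r (Real.sqrt w)) / (2 * Real.sqrt w ^ 3)) w := by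
    filter_upwards [hsq.eventually hr1, hpos] with w h1 h2
    have h3 : 0 < Real.sqrt w := Real.sqrt_pos.2 h2
    have := (hasDerivAt_comp_sqrt h2 h1).div (Real.hasDerivAt_sqrt h2.ne') h3.ne'
    refine this.congr_deriv ?_
    field_simp
  have hB : ∀ᶠ w in 𝓝 (p.1 ^ 2 + p.2 ^ 2),
      HasDerivAt (fun w => z (Real.sqrt w)) (deriv z (Real.sqrt w) / (2 * Real.sqrt w)) w := by
    filter_upwards [hsq.eventually hz1, hpos] with w h1 h2
    exact hasDerivAt_comp_sqrt h2 h1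
  have hsd := Real.hasDerivAt_sqrt hw0.ne'
  have hr1' := hasDerivAt_comp_sqrt hw0 (f := r) (hxw.symm ▸ hr1.self_of_nhds)
  have hr2' := hasDerivAt_comp_sqrt hw0 (f := deriv r) (hxw.symm ▸ hr2)
  have hz2' := hasDerivAt_comp_sqrt hw0 (f := deriv z) (hxw.symm ▸ hz2)
  have hA' : HasDerivAt (fun w => (Real.sqrt w * deriv r (Real.sqrt w) - r (Real.sqrt w)) /
      (2 * Real.sqrt w ^ 3))
      ((x ^ 2 * deriv (deriv r) x - 3 * (x * deriv r x - r x)) / (4 * x ^ 5))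
      (p.1 ^ 2 + p.2 ^ 2) := by
    have := ((hsd.mul hr2').sub hr1').div ((hsd.pow 3).const_mul 2)
      (by simp only [Pi.pow_apply]; rw [hxw]; positivity)
    refine this.congr_deriv ?_
    simp only [Pi.mul_apply, Pi.sub_apply, Pi.pow_apply]
    rw [hxw]
    field_simp
    ring
  have hB' : HasDerivAt (fun w => deriv z (Real.sqrt w) / (2 * Real.sqrt w))
      ((x * deriv (deriv z) x - deriv z x) / (4 * x ^ 3)) (p.1 ^ 2 + p.2 ^ 2) := by
    have := hz2'.div (hsd.const_mul 2) (by rw [hxw]; positivity)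
    refine this.congr_deriv ?_
    rw [hxw]
    field_simp
    ring
  have hSq : prSpeed r z x ^ 2 = deriv r x ^ 2 + deriv z x ^ 2 := Real.sq_sqrt (by positivity)
  have hSq' : prSpeed r z x ^ 2 = (r x / x + 2 * x ^ 2 * ((x * deriv r x - r x) / (2 * x ^ 3))) ^ 2
      + 4 * x ^ 2 * (deriv z x / (2 * x)) ^ 2 := by
    rw [hSq]; field_simp; ring
  obtain ⟨h1, h2⟩ := normal_sqSurf (q := q) he hA.self_of_nhds hB.self_of_nhds hS
    (by rw [hxw]; positivity) (by rw [hxw, hxx]; exact hSq')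
  obtain ⟨h3, h4⟩ := curvatures_sqSurf (q := q) he hA hB hA' hB' hS hxx.symm rfl rfl rfl
    (by rw [hxw]; positivity) (by rw [hxw]; exact hSq')
  have i1 : 2 * (deriv z x / (2 * x)) / (r x / x * prSpeed r z x) = prK1 r z x := by
    rw [prK1]; field_simp
  have i2 : (2 * (r x / x) * (deriv z x / (2 * x)) + 4 * x ^ 2 *
      ((r x / x + 2 * x ^ 2 * ((x * deriv r x - r x) / (2 * x ^ 3))) *
        ((x * deriv (deriv z) x - deriv z x) / (4 * x ^ 3)) -
        2 * ((x * deriv r x - r x) / (2 * x ^ 3)) * (deriv z x / (2 * x)) - 2 * x ^ 2 *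
        ((x ^ 2 * deriv (deriv r) x - 3 * (x * deriv r x - r x)) / (4 * x ^ 5)) *
        (deriv z x / (2 * x)))) / prSpeed r z x ^ 3 = prK2 r z x := by
    rw [prK2]; congr 1; field_simp; ring
  refine ⟨?_, ?_, ?_, ?_⟩
  · rw [revol, h1, hxw, Real.sqrt_sq (by positivity)]
    ring
  · rw [revol, h3, hxw, i1, i2]
  · rw [revol, h4, hxw, i1, i2]
  · rw [revol, h2, hxw, hxx]
    congr 1
    · congr 1
      · congr 1; field_simp
      · congr 1; field_simp
    · congr 1; field_simp; ring

/-- The denominator `rad p` is what the Jacobian of polar coordinates cancels. The sign of the frame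
moves from H to c because only the square of H + c enters. -/
lemma surfDens_revol {a c b : ℝ} (he : IsFrame e) (hp : 0 < rad p)
    (hr : ContDiffAt ℝ 2 r (rad p)) (hz : ContDiffAt ℝ 2 z (rad p)) (hr0 : 0 < r (rad p))
    (hS : 0 < prSpeed r z (rad p)) :
    surfDens a c b (revol q e r z) p = prDens a (frameDet e * c) b r z (rad p) / rad p := by
  obtain ⟨h1, h2, h3, -⟩ := revol_geometry (q := q) he hp hr hz hr0 hS
  have hd := he.frameDet_sq
  rw [surfDens, prDens, h1, h2, h3, mul_div_assoc']
  congr 2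
  set m := prK1 r z (rad p) + prK2 r z (rad p)
  linear_combination a * ((m / 2) ^ 2 - c ^ 2) * hd

end pointwise

/-! ### Integrals of radial functions -/

/-- By Fubini: each vertical line meets the circle in at most two points. -/
lemma ae_rad_ne (x : ℝ) : ∀ᵐ p : ℝ × ℝ, rad p ≠ x := by
  have hm : MeasurableSet {p : ℝ × ℝ | rad p = x} :=
    (isClosed_eq continuous_rad continuous_const).measurableSet
  rw [ae_iff]
  simp only [not_not]
  rw [Measure.volume_eq_prod, Measure.measure_prod_null hm]
  refine Eventually.of_forall fun u => ?_
  apply Set.Finite.measure_zero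
  refine Set.Finite.subset (Set.toFinite {Real.sqrt (x ^ 2 - u ^ 2), -Real.sqrt (x ^ 2 - u ^ 2)}) ?_
  intro v hv
  simp only [mem_preimage, mem_ofPred_eq] at hv
  have h1 := rad_sq (u, v)
  rw [hv] at h1
  simp only at h1
  have h2 : x ^ 2 - u ^ 2 = v ^ 2 := by linarith
  rw [h2, Real.sqrt_sq_eq_abs]
  rcases abs_choice v with h | h <;> simp [h]

lemma setIntegral_radial {x₀ x₁ : ℝ} (h0 : 0 ≤ x₀) (h1 : x₀ ≤ x₁) {F : ℝ × ℝ → ℝ} {f : ℝ → ℝ}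
    (h : ∀ p, x₀ < rad p → rad p < x₁ → F p = f (rad p) / rad p) :
    ∫ p in {p : ℝ × ℝ | x₀ < rad p ∧ rad p < x₁}, F p = 2 * Real.pi * ∫ x in x₀..x₁, f x := by
  have hm : MeasurableSet {p : ℝ × ℝ | x₀ < rad p ∧ rad p < x₁} :=
    ((isOpen_lt continuous_const continuous_rad).inter
      (isOpen_lt continuous_rad continuous_const)).measurableSet
  rw [← integral_indicator hm, ← integral_comp_polarCoord_symm]
  have hmt : MeasurableSet polarCoord.target := polarCoord.open_target.measurableSet
  rw [setIntegral_congr_fun (g := fun p : ℝ × ℝ => (Ioo x₀ x₁).indicator f p.1 * 1) hmt]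
  · rw [polarCoord_target, Measure.volume_eq_prod,
      setIntegral_prod_mul ((Ioo x₀ x₁).indicator f) (fun _ => (1 : ℝ))]
    rw [setIntegral_indicator measurableSet_Ioo, intervalIntegral.integral_of_le h1,
      integral_Ioc_eq_integral_Ioo]
    have : Ioi (0 : ℝ) ∩ Ioo x₀ x₁ = Ioo x₀ x₁ := by
      apply inter_eq_right.2
      intro y hy
      exact lt_of_le_of_lt h0 hy.1
    rw [this]
    have hpi := Real.pi_pos
    simp [Measure.real]
    rw [ENNReal.toReal_ofReal (by linarith)]
    ring
  · intro p hp
    rw [polarCoord_target] at hp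
    have hp0 : (0 : ℝ) < p.1 := hp.1
    have hr : rad (polarCoord.symm p) = p.1 := by
      rw [polarCoord_symm_apply]; exact rad_polar hp0.le p.2
    by_cases hx : x₀ < p.1 ∧ p.1 < x₁
    · have hx' : polarCoord.symm p ∈ {p : ℝ × ℝ | x₀ < rad p ∧ rad p < x₁} := by
        simp only [mem_ofPred_eq, hr]; exact hx
      simp only [indicator_of_mem hx']
      rw [indicator_of_mem (show p.1 ∈ Ioo x₀ x₁ from hx), h _ hx'.1 hx'.2, hr, smul_eq_mul]
      field_simp
    · have hx' : polarCoord.symm p ∉ {p : ℝ × ℝ | x₀ < rad p ∧ rad p < x₁} := by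
        simp only [mem_ofPred_eq, hr]; exact hx
      simp only [indicator_of_notMem hx']
      rw [indicator_of_notMem (show p.1 ∉ Ioo x₀ x₁ from hx)]
      simp

lemma isCompact_closedAnnulus (x₀ x₁ : ℝ) : IsCompact {p : ℝ × ℝ | x₀ ≤ rad p ∧ rad p ≤ x₁} := by
  apply Metric.isCompact_of_isClosed_isBounded
  · exact (isClosed_le continuous_const continuous_rad).inter
      (isClosed_le continuous_rad continuous_const)
  · refine (Metric.isBounded_closedBall (x := (0 : ℝ × ℝ)) (r := x₁)).subset ?_
    rintro ⟨u, v⟩ ⟨-, h⟩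
    have h2 := rad_sq (u, v)
    have h3 : 0 ≤ rad (u, v) := Real.sqrt_nonneg _
    simp only at h2
    rw [mem_closedBall_zero_iff, Prod.norm_def]
    apply max_le
    · simp only [Real.norm_eq_abs]
      exact (abs_le_of_sq_le_sq (by nlinarith [sq_nonneg v]) h3).trans h
    · simp only [Real.norm_eq_abs]
      exact (abs_le_of_sq_le_sq (by nlinarith [sq_nonneg u]) h3).trans h

lemma integrableOn_radial {x₀ x₁ : ℝ} (h0 : 0 < x₀) {F : ℝ × ℝ → ℝ} {f : ℝ → ℝ}
    (hf : ContinuousOn f (Icc x₀ x₁))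
    (h : ∀ p, x₀ < rad p → rad p < x₁ → F p = f (rad p) / rad p) :
    IntegrableOn F {p : ℝ × ℝ | x₀ < rad p ∧ rad p < x₁} := by
  have hm : MeasurableSet {p : ℝ × ℝ | x₀ < rad p ∧ rad p < x₁} :=
    ((isOpen_lt continuous_const continuous_rad).inter
      (isOpen_lt continuous_rad continuous_const)).measurableSet
  have h1 : IntegrableOn (fun p => f (rad p) / rad p) {p : ℝ × ℝ | x₀ ≤ rad p ∧ rad p ≤ x₁} := by
    apply ContinuousOn.integrableOn_compact (isCompact_closedAnnulus x₀ x₁)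
    apply ContinuousOn.div
    · exact hf.comp continuous_rad.continuousOn fun p hp => hp
    · exact continuous_rad.continuousOn
    · intro p hp; exact (h0.trans_le hp.1).ne'
  refine (h1.mono_set fun p hp => ⟨hp.1.le, hp.2.le⟩).congr_fun ?_ hm
  intro p hp
  exact (h p hp.1 hp.2).symm

/-! ### Continuity of the energy density -/

lemma contDiffAt_du {X : ℝ × ℝ → Fin 3 → ℝ} {p : ℝ × ℝ} {m n : WithTop ℕ∞}
    (h : ContDiffAt ℝ n X p) (hmn : m + 1 ≤ n) : ContDiffAt ℝ m (du X) p :=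
  (h.fderiv_right hmn).clm_apply contDiffAt_const

lemma contDiffAt_dv {X : ℝ × ℝ → Fin 3 → ℝ} {p : ℝ × ℝ} {m n : WithTop ℕ∞}
    (h : ContDiffAt ℝ n X p) (hmn : m + 1 ≤ n) : ContDiffAt ℝ m (dv X) p :=
  (h.fderiv_right hmn).clm_apply contDiffAt_const

lemma gDet_pos {X : ℝ × ℝ → Fin 3 → ℝ} {p : ℝ × ℝ} (h : Function.Injective (fderiv ℝ X p)) :
    0 < gDet X p := by
  have hlin : ∀ x y : ℝ, fderiv ℝ X p (x, y) = x • du X p + y • dv X p := by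
    intro x y
    rw [du, dv, ← map_smul, ← map_smul, ← map_add]
    simp
  have hne : ∀ x y : ℝ, (x • du X p + y • dv X p) ⬝ᵥ (x • du X p + y • dv X p) = 0 →
      x = 0 ∧ y = 0 := by
    intro x y hxy
    rw [dotProduct_self_eq_zero, ← hlin] at hxy
    have := h (hxy.trans (map_zero (fderiv ℝ X p)).symm)
    simpa using this
  have hexp : ∀ x y : ℝ, (x • du X p + y • dv X p) ⬝ᵥ (x • du X p + y • dv X p) =
      x ^ 2 * gE X p + 2 * x * y * gF X p + y ^ 2 * gG X p := by
    intro x y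
    simp only [add_dotProduct, dotProduct_add, smul_dotProduct, dotProduct_smul, smul_eq_mul, gE,
      gF, gG, dotProduct_comm (dv X p) (du X p)]
    ring
  have hpos : ∀ x y : ℝ, 0 ≤ x ^ 2 * gE X p + 2 * x * y * gF X p + y ^ 2 * gG X p := by
    intro x y
    rw [← hexp]
    exact Finset.sum_nonneg fun i _ => mul_self_nonneg _
  have hG0 : 0 < gG X p := by
    rcases (by simpa using hpos 0 1 : 0 ≤ gG X p).lt_or_eq with h1 | h1
    · exact h1
    · have := hne 0 1 (by rw [hexp]; simp [← h1])
      simp at this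
  rw [gDet]
  -- On the vector (G, −F) the first fundamental form takes the value G(EG − F²), so its positivity
  -- is that of the determinant.
  have h2 := hpos (gG X p) (-gF X p)
  have h3 : 0 ≤ gG X p * (gE X p * gG X p - gF X p ^ 2) := by nlinarith
  have h4 := nonneg_of_mul_nonneg_right h3 hG0
  rcases h4.lt_or_eq with h5 | h5
  · exact h5
  · exfalso
    have := hne (gG X p) (-gF X p) (by rw [hexp]; linear_combination -gG X p * h5)
    exact hG0.ne' this.1

lemma continuousAt_dotProduct {f g : ℝ × ℝ → Fin 3 → ℝ} {p : ℝ × ℝ} (hf : ContinuousAt f p)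
    (hg : ContinuousAt g p) : ContinuousAt (fun p => f p ⬝ᵥ g p) p := by
  simp only [dotProduct, Fin.sum_univ_three]
  have hf' := continuousAt_pi.1 hf
  have hg' := continuousAt_pi.1 hg
  exact (((hf' 0).mul (hg' 0)).add ((hf' 1).mul (hg' 1))).add ((hf' 2).mul (hg' 2))

lemma continuousAt_crossProduct {f g : ℝ × ℝ → Fin 3 → ℝ} {p : ℝ × ℝ} (hf : ContinuousAt f p)
    (hg : ContinuousAt g p) : ContinuousAt (fun p => crossProduct (f p) (g p)) p := by
  have hf' := continuousAt_pi.1 hf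
  have hg' := continuousAt_pi.1 hg
  simp only [cross_apply]
  rw [continuousAt_pi]
  intro i
  fin_cases i
  · exact ((hf' 1).mul (hg' 2)).sub ((hf' 2).mul (hg' 1))
  · exact ((hf' 2).mul (hg' 0)).sub ((hf' 0).mul (hg' 2))
  · exact ((hf' 0).mul (hg' 1)).sub ((hf' 1).mul (hg' 0))

lemma continuousAt_gDet {X : ℝ × ℝ → Fin 3 → ℝ} {p : ℝ × ℝ} (h : ContDiffAt ℝ 2 X p) :
    ContinuousAt (gDet X) p := by
  have h1 := (contDiffAt_du (m := 1) h (by norm_num)).continuousAt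
  have h2 := (contDiffAt_dv (m := 1) h (by norm_num)).continuousAt
  exact ((continuousAt_dotProduct h1 h1).mul (continuousAt_dotProduct h2 h2)).sub
    ((continuousAt_dotProduct h1 h2).pow 2)

lemma continuousAt_normal {X : ℝ × ℝ → Fin 3 → ℝ} {p : ℝ × ℝ} (h : ContDiffAt ℝ 2 X p)
    (hd : 0 < gDet X p) : ContinuousAt (normal X) p := by
  have h1 := (contDiffAt_du (m := 1) h (by norm_num)).continuousAt
  have h2 := (contDiffAt_dv (m := 1) h (by norm_num)).continuousAt
  exact ((Real.continuous_sqrt.continuousAt.comp (continuousAt_gDet h)).inv₀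
    (Real.sqrt_pos.2 hd).ne').smul (continuousAt_crossProduct h1 h2)

/-- Continuity up to the boundary gives integrability over the compact domain and carries identities
from the interior to the boundary circles. -/
lemma continuousAt_curvatures {X : ℝ × ℝ → Fin 3 → ℝ} {p : ℝ × ℝ} (h : ContDiffAt ℝ 2 X p)
    (hd : 0 < gDet X p) : ContinuousAt (meanCurv X) p ∧ ContinuousAt (gaussCurv X) p := by
  have h1 := contDiffAt_du (m := 1) h (by norm_num)
  have h2 := contDiffAt_dv (m := 1) h (by norm_num)
  have h11 := (contDiffAt_du (m := 0) h1 (by norm_num)).continuousAt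
  have h12 := (contDiffAt_dv (m := 0) h1 (by norm_num)).continuousAt
  have h22 := (contDiffAt_dv (m := 0) h2 (by norm_num)).continuousAt
  have hn := continuousAt_normal h hd
  have hL := continuousAt_dotProduct h11 hn
  have hM := continuousAt_dotProduct h12 hn
  have hN := continuousAt_dotProduct h22 hn
  have hE := continuousAt_dotProduct h1.continuousAt h1.continuousAt
  have hF := continuousAt_dotProduct h1.continuousAt h2.continuousAt
  have hG := continuousAt_dotProduct h2.continuousAt h2.continuousAt
  have hD := continuousAt_gDet h
  constructor
  · exact (((hL.mul hG).sub ((hM.const_mul 2).mul hF)).add (hN.mul hE)).div (hD.const_mul 2)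
      (by positivity)
  · exact ((hL.mul hN).sub (hM.pow 2)).div hD hd.ne'

lemma continuousAt_surfDens {a c b : ℝ} {X : ℝ × ℝ → Fin 3 → ℝ} {p : ℝ × ℝ}
    (h : ContDiffAt ℝ 2 X p) (hd : 0 < gDet X p) : ContinuousAt (surfDens a c b X) p := by
  obtain ⟨h1, h2⟩ := continuousAt_curvatures h hd
  exact ((((h1.add continuousAt_const).pow 2).const_mul a).add (h2.const_mul b)).mul
    (Real.continuous_sqrt.continuousAt.comp (continuousAt_gDet h))

/-! ### Boundary circles -/

section circle

variable {e : Fin 3 → Fin 3 → ℝ} {Q : Fin 3 → ℝ} {R ς : ℝ} {C : ℝ → Fin 3 → ℝ}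

/-- The sign ς records the sense in which the circle is traversed, opposite for outer and inner
boundary components. -/
lemma circle_geometry (he : IsFrame e) (hR : 0 < R) (hς : ς ^ 2 = 1)
    (hC : ∀ θ, C θ = Q + R • (Real.cos θ • e 0 + (ς * Real.sin θ) • e 1)) (θ : ℝ) :
    speed C θ = R ∧ unitTangent C θ =
      (-Real.sin θ) • e 0 + (ς * Real.cos θ) • e 1 + (0 : ℝ) • e 2 ∧
    curvVec C θ = (-Real.cos θ / R) • e 0 + (-(ς * Real.sin θ) / R) • e 1 + (0 : ℝ) • e 2 ∧
    curvature C θ = 1 / R := by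
  have hC' : C = fun θ => Q + R • (Real.cos θ • e 0 + (ς * Real.sin θ) • e 1) := funext hC
  have hd : ∀ θ, deriv C θ =
      (-(R * Real.sin θ)) • e 0 + (R * (ς * Real.cos θ)) • e 1 + (0 : ℝ) • e 2 := by
    intro θ
    rw [hC']
    refine HasDerivAt.deriv ?_
    have := ((((Real.hasDerivAt_cos θ).smul_const (e 0)).add
      (((Real.hasDerivAt_sin θ).const_mul ς).smul_const (e 1))).const_smul R).const_add Q
    refine this.congr_deriv ?_
    module
  have hs : ∀ θ, speed C θ = R := by
    intro θ
    rw [speed, hd, he.dot]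
    rw [show -(R * Real.sin θ) * -(R * Real.sin θ) + R * (ς * Real.cos θ) * (R * (ς * Real.cos θ))
      + 0 * 0 = R ^ 2 by
        linear_combination R ^ 2 * Real.sin_sq_add_cos_sq θ + R ^ 2 * Real.cos θ ^ 2 * hς]
    exact Real.sqrt_sq hR.le
  have hT : ∀ θ, unitTangent C θ =
      (-Real.sin θ) • e 0 + (ς * Real.cos θ) • e 1 + (0 : ℝ) • e 2 := by
    intro θ
    rw [unitTangent, hs, hd, smul_add, smul_add, smul_smul, smul_smul, smul_smul]
    rw [show R⁻¹ * -(R * Real.sin θ) = -Real.sin θ by field_simp,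
      show R⁻¹ * (R * (ς * Real.cos θ)) = ς * Real.cos θ by field_simp, mul_zero]
  have hV : curvVec C θ =
      (-Real.cos θ / R) • e 0 + (-(ς * Real.sin θ) / R) • e 1 + (0 : ℝ) • e 2 := by
    rw [curvVec, hs, funext hT]
    have : HasDerivAt (fun θ : ℝ => (-Real.sin θ) • e 0 + (ς * Real.cos θ) • e 1 + (0 : ℝ) • e 2)
        ((-Real.cos θ) • e 0 + (ς * -Real.sin θ) • e 1) θ :=
      (((Real.hasDerivAt_sin θ).neg.smul_const (e 0)).add
        (((Real.hasDerivAt_cos θ).const_mul ς).smul_const (e 1))).add_const _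
    rw [this.deriv, smul_add, smul_smul, smul_smul, zero_smul, add_zero]
    congr 2
    · ring
    · ring
  refine ⟨hs θ, hT θ, hV, ?_⟩
  rw [curvature, hV, he.dot]
  rw [show -Real.cos θ / R * (-Real.cos θ / R) +
    -(ς * Real.sin θ) / R * (-(ς * Real.sin θ) / R) + 0 * 0 = (1 / R) ^ 2 by
      field_simp
      linear_combination Real.sin_sq_add_cos_sq θ + Real.sin θ ^ 2 * hς]
  exact Real.sqrt_sq (by positivity)

lemma curveEnergy_circle {α β : ℝ} (he : IsFrame e) (hR : 0 < R) (hς : ς ^ 2 = 1)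
    (hC : ∀ θ, C θ = Q + R • (Real.cos θ • e 0 + (ς * Real.sin θ) • e 1)) :
    curveEnergy α β C = 2 * Real.pi * (α / R + β * R) := by
  rw [curveEnergy]
  have : ∀ θ, (α * curvature C θ ^ 2 + β) * speed C θ = α / R + β * R := by
    intro θ
    obtain ⟨h1, -, -, h2⟩ := circle_geometry he hR hς hC θ
    rw [h1, h2]
    field_simp
  simp only [this, intervalIntegral.integral_const, sub_zero, smul_eq_mul]

end circle

lemma rad_bdryPoint (s θ : ℝ) : rad (bdryPoint s θ) = |s| := by
  have : (|s| * Real.cos θ) ^ 2 + (s * Real.sin θ) ^ 2 = |s| ^ 2 := by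
    rw [mul_pow, mul_pow, sq_abs]
    linear_combination s ^ 2 * Real.sin_sq_add_cos_sq θ
  simp only [rad, bdryPoint, this]
  exact Real.sqrt_sq (abs_nonneg s)

lemma sign_sq {s : ℝ} (hs : s ≠ 0) : (s / |s|) ^ 2 = 1 := by
  rw [div_pow, sq_abs, div_self (pow_ne_zero 2 hs)]

lemma revol_bdryPoint {q : Fin 3 → ℝ} {e : Fin 3 → Fin 3 → ℝ} {r z : ℝ → ℝ} {s : ℝ} (hs : s ≠ 0)
    (θ : ℝ) : revol q e r z (bdryPoint s θ) = (q + z |s| • e 2) +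
      r |s| • (Real.cos θ • e 0 + (s / |s| * Real.sin θ) • e 1) := by
  have h := rad_bdryPoint s θ
  have hs' : |s| ≠ 0 := abs_ne_zero.2 hs
  simp only [rad] at h
  simp only [revol, sqSurf, h]
  simp only [bdryPoint, smul_add, smul_smul]
  rw [show r |s| / |s| * (|s| * Real.cos θ) = r |s| * Real.cos θ by field_simp,
    show r |s| / |s| * (s * Real.sin θ) = r |s| * (s / |s| * Real.sin θ) by field_simp]
  module

/-! ### Regularity of the curvatures of the profile -/

section regularity

variable {r z : ℝ → ℝ} {x : ℝ} {m n : WithTop ℕ∞}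

lemma prSpeed_sq (r z : ℝ → ℝ) (x : ℝ) : prSpeed r z x ^ 2 = deriv r x ^ 2 + deriv z x ^ 2 :=
  Real.sq_sqrt (by positivity)

lemma contDiffAt_prSpeed (hr : ContDiffAt ℝ n r x) (hz : ContDiffAt ℝ n z x) (hmn : m + 1 ≤ n)
    (hS : 0 < prSpeed r z x) : ContDiffAt ℝ m (prSpeed r z) x := by
  apply ContDiffAt.sqrt
  · exact ((hr.derivWithin hmn).pow 2).add ((hz.derivWithin hmn).pow 2)
  · exact (Real.sqrt_pos.1 hS).ne'

lemma contDiffAt_prK1 (hr : ContDiffAt ℝ n r x) (hz : ContDiffAt ℝ n z x) (hmn : m + 1 ≤ n)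
    (hr0 : 0 < r x) (hS : 0 < prSpeed r z x) : ContDiffAt ℝ m (prK1 r z) x :=
  (hz.derivWithin hmn).div ((hr.of_le (le_self_add.trans hmn)).mul
    (contDiffAt_prSpeed hr hz hmn hS)) (by positivity)

lemma contDiffAt_prK2 (hr : ContDiffAt ℝ n r x) (hz : ContDiffAt ℝ n z x) (hmn : m + 1 + 1 ≤ n)
    (hS : 0 < prSpeed r z x) : ContDiffAt ℝ m (prK2 r z) x := by
  have h1 : m ≤ m + 1 := le_self_add
  have hr1 := hr.derivWithin hmn
  have hz1 := hz.derivWithin hmn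
  exact (((hr1.of_le h1).mul (hz1.derivWithin le_rfl)).sub
    ((hz1.of_le h1).mul (hr1.derivWithin le_rfl))).div
    (((contDiffAt_prSpeed hr hz hmn hS).of_le h1).pow 3) (by positivity)

lemma contDiffAt_prDens {a c b : ℝ} (hr : ContDiffAt ℝ n r x) (hz : ContDiffAt ℝ n z x)
    (hmn : m + 1 + 1 ≤ n) (hr0 : 0 < r x) (hS : 0 < prSpeed r z x) :
    ContDiffAt ℝ m (prDens a c b r z) x := by
  have h1 : m ≤ m + 1 := le_self_add
  have k1 := (contDiffAt_prK1 hr hz hmn hr0 hS).of_le h1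
  have k2 := contDiffAt_prK2 hr hz hmn hS
  have hs := (contDiffAt_prSpeed hr hz hmn hS).of_le h1
  exact ((contDiffAt_const.mul ((((k1.add k2).div_const 2).add contDiffAt_const).pow 2)).add
    (contDiffAt_const.mul (k1.mul k2))).mul ((hr.of_le ((h1.trans le_self_add).trans hmn)).mul hs)

end regularity

/-! ### Splitting the energy at a collar of a boundary component -/

/-- Radii of the parallels of the model surface. -/
def radii : SurfaceType → Set ℝ
  | SurfaceType.disc => Ioc 0 1
  | SurfaceType.annulus => Icc 1 2

/-- The radii between `f` and `|s|` form a collar of the boundary circle with label `s`. -/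
def IsCollar : SurfaceType → ℝ → ℝ → Prop
  | SurfaceType.disc, s, f => s = 1 ∧ 0 < f ∧ f < 1
  | SurfaceType.annulus, s, f => (s = 2 ∨ s = -1) ∧ 1 < f ∧ f < 2

lemma mem_disc_iff {p : ℝ × ℝ} : p ∈ domain SurfaceType.disc ↔ rad p ≤ 1 := by
  rw [show p ∈ domain SurfaceType.disc ↔ p.1 ^ 2 + p.2 ^ 2 ≤ 1 from Iff.rfl, ← rad_sq]
  have : 0 ≤ rad p := Real.sqrt_nonneg _
  constructor <;> intro h <;> nlinarith

lemma mem_annulus_iff {p : ℝ × ℝ} :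
    p ∈ domain SurfaceType.annulus ↔ 1 ≤ rad p ∧ rad p ≤ 2 := by
  rw [show p ∈ domain SurfaceType.annulus ↔ 1 ≤ p.1 ^ 2 + p.2 ^ 2 ∧ p.1 ^ 2 + p.2 ^ 2 ≤ 4
    from Iff.rfl, ← rad_sq]
  have : 0 ≤ rad p := Real.sqrt_nonneg _
  constructor <;> rintro ⟨h1, h2⟩ <;> constructor <;> nlinarith

lemma mem_domain_of_radii {τ : SurfaceType} {p : ℝ × ℝ} (h : rad p ∈ radii τ) : p ∈ domain τ := by
  cases τ
  · exact mem_disc_iff.2 h.2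
  · exact mem_annulus_iff.2 h

lemma rad_mem_radii {τ : SurfaceType} {p : ℝ × ℝ} (h : p ∈ domain τ) (h0 : 0 < rad p) :
    rad p ∈ radii τ := by
  cases τ
  · exact ⟨h0, mem_disc_iff.1 h⟩
  · exact mem_annulus_iff.1 h

lemma isCompact_domain (τ : SurfaceType) : IsCompact (domain τ) := by
  cases τ
  · have : domain SurfaceType.disc = {p | 0 ≤ rad p ∧ rad p ≤ 1} := by
      ext p
      rw [mem_disc_iff]
      exact ⟨fun h => ⟨Real.sqrt_nonneg _, h⟩, fun h => h.2⟩
    rw [this]; exact isCompact_closedAnnulus _ _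
  · have : domain SurfaceType.annulus = {p | 1 ≤ rad p ∧ rad p ≤ 2} := by
      ext p
      rw [mem_annulus_iff]; rfl
    rw [this]; exact isCompact_closedAnnulus _ _

/-! ### Elementary geometry of collars of a boundary circle -/

section collar

variable {τ : SurfaceType} {s f : ℝ}

lemma IsCollar.mem_labels (h : IsCollar τ s f) : s ∈ boundaryLabels τ := by
  cases τ
  · simp only [boundaryLabels, Finset.mem_singleton]; exact h.1
  · simp only [boundaryLabels, Finset.mem_insert, Finset.mem_singleton]; exact h.1

lemma IsCollar.cases (h : IsCollar τ s f) :
    0 < f ∧ ((s = |s| ∧ f < |s|) ∨ (s = -|s| ∧ |s| < f)) ∧ 0 < |s| := by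
  cases τ
  · obtain ⟨rfl, h1, h2⟩ := h
    simp [h1, h2]
  · obtain ⟨rfl | rfl, h1, h2⟩ := h
    · refine ⟨by linarith, Or.inl ?_, ?_⟩ <;> simp [h2]
    · refine ⟨by linarith, Or.inr ?_, ?_⟩ <;> simp [h1]

lemma IsCollar.uIcc_subset (h : IsCollar τ s f) : uIcc f |s| ⊆ radii τ := by
  cases τ
  · obtain ⟨rfl, h1, h2⟩ := h
    rw [abs_one, uIcc_of_le h2.le]
    exact fun x hx => ⟨h1.trans_le hx.1, hx.2⟩
  · obtain ⟨rfl | rfl, h1, h2⟩ := h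
    · rw [abs_of_pos (two_pos : (0 : ℝ) < 2), uIcc_of_le h2.le]
      exact fun x hx => ⟨h1.le.trans hx.1, hx.2⟩
    · rw [abs_neg, abs_one, uIcc_of_ge h1.le]
      exact fun x hx => ⟨hx.1, hx.2.trans h2.le⟩

lemma IsCollar.notMem_of_ne (h : IsCollar τ s f) {s' : ℝ} (hs' : s' ∈ boundaryLabels τ)
    (hne : s' ≠ s) : |s'| ∉ uIcc f |s| := by
  cases τ
  · obtain ⟨rfl, -⟩ := h
    simp only [boundaryLabels, Finset.mem_singleton] at hs'
    exact absurd hs' hne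
  · simp only [boundaryLabels, Finset.mem_insert, Finset.mem_singleton] at hs'
    obtain ⟨rfl | rfl, h1, h2⟩ := h
    · rcases hs' with rfl | rfl
      · exact absurd rfl hne
      · rw [abs_of_pos (two_pos : (0 : ℝ) < 2), uIcc_of_le h2.le, abs_neg, abs_one]
        exact fun hx => absurd hx.1 (not_le.2 h1)
    · rcases hs' with rfl | rfl
      · rw [abs_of_pos (two_pos : (0 : ℝ) < 2), abs_neg, abs_one, uIcc_of_ge h1.le]
        exact fun hx => absurd hx.2 (not_le.2 h2)
      · exact absurd rfl hne

/-- At an inner circle f lies beyond |s| and the integral runs backwards; the factor s/|s| = −1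
undoes this, so outer and inner circles can be treated by the same formulas. -/
lemma IsCollar.sign_mul_integral (h : IsCollar τ s f) (g : ℝ → ℝ) :
    s / |s| * ∫ x in f..|s|, g x = ∫ x in (min f |s|)..(max f |s|), g x := by
  obtain ⟨-, ⟨h1, h2⟩ | ⟨h1, h2⟩, h3⟩ := h.cases
  · rw [min_eq_left h2.le, max_eq_right h2.le]
    have : s / |s| = 1 := by rw [← h1]; exact div_self (by rw [h1]; exact h3.ne')
    rw [this, one_mul]
  · rw [min_eq_right h2.le, max_eq_left h2.le]
    have : s / |s| = -1 := by rw [div_eq_iff h3.ne']; linarith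
    rw [this, intervalIntegral.integral_symm]; ring

end collar

lemma bdryPoint_mem_domain {τ : SurfaceType} {s : ℝ} (hs : s ∈ boundaryLabels τ) (θ : ℝ) :
    bdryPoint s θ ∈ domain τ := by
  apply mem_domain_of_radii
  rw [rad_bdryPoint]
  cases τ
  · simp only [boundaryLabels, Finset.mem_singleton] at hs
    subst hs; simp [radii]
  · simp only [boundaryLabels, Finset.mem_insert, Finset.mem_singleton] at hs
    rcases hs with rfl | rfl <;> simp [radii]

lemma integrableOn_surfDens {τ : SurfaceType} {X : ℝ × ℝ → Fin 3 → ℝ} (hX : IsC4Immersion τ X)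
    (a c b : ℝ) : IntegrableOn (surfDens a c b X) (domain τ) := by
  apply ContinuousOn.integrableOn_compact (isCompact_domain τ)
  intro p hp
  exact (continuousAt_surfDens ((hX p hp).1.of_le (by norm_num))
    (gDet_pos (hX p hp).2)).continuousWithinAt

lemma surfDens_congr {a c b : ℝ} {X Y : ℝ × ℝ → Fin 3 → ℝ} {p : ℝ × ℝ} (h : X =ᶠ[𝓝 p] Y) :
    surfDens a c b X p = surfDens a c b Y p := by
  have hu : du X =ᶠ[𝓝 p] du Y := h.eventuallyEq_nhds.mono fun _ h => du_congr h
  have hv : dv X =ᶠ[𝓝 p] dv Y := h.eventuallyEq_nhds.mono fun _ h => dv_congr h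
  simp only [surfDens, meanCurv, gaussCurv, gDet, hL, hM, hN, normal, gE, gF, gG, du_congr hu,
    dv_congr hu, dv_congr hv, hu.self_of_nhds, hv.self_of_nhds]

/-- The energy of a surface which is a surface of revolution over a collar and agrees with `X`
elsewhere. -/
lemma energy_eq_of_collar {a c b α β : ℝ} {τ : SurfaceType} {X : ℝ × ℝ → Fin 3 → ℝ}
    (hX : IsC4Immersion τ X) {s f : ℝ} (hc : IsCollar τ s f) :
    ∃ K : ℝ, ∀ (q : Fin 3 → ℝ) (e : Fin 3 → Fin 3 → ℝ) (r z : ℝ → ℝ) (Y : ℝ × ℝ → Fin 3 → ℝ),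
      IsFrame e →
      (∀ x ∈ uIcc f |s|, ContDiffAt ℝ 2 r x ∧ ContDiffAt ℝ 2 z x ∧ 0 < r x ∧ 0 < prSpeed r z x) →
      (∀ p ∈ domain τ, rad p ∉ uIcc f |s| ∨ rad p = f → Y =ᶠ[𝓝 p] X) →
      (∀ p, rad p ∈ uIcc f |s| → Y p = revol q e r z p) →
      energy a c b α β τ Y = K + 2 * Real.pi * (s / |s| * (∫ x in f..|s|,
        prDens a (frameDet e * c) b r z x) + (α / r |s| + β * r |s|)) := by
  obtain ⟨hf0, hfs, hs0⟩ := hc.cases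
  have hs : s ≠ 0 := abs_pos.1 hs0
  set Ω := {p : ℝ × ℝ | min f |s| < rad p ∧ rad p < max f |s|} with hΩ
  have hΩo : IsOpen Ω := (isOpen_lt continuous_const continuous_rad).inter
    (isOpen_lt continuous_rad continuous_const)
  have hΩu : ∀ p ∈ Ω, rad p ∈ uIcc f |s| := fun p hp => ⟨hp.1.le, hp.2.le⟩
  have hΩd : Ω ⊆ domain τ := fun p hp => mem_domain_of_radii (hc.uIcc_subset (hΩu p hp))
  -- The constant collects the energy of `X` off the open collar and of the other boundary circles.
  -- It is fixed before the profile, so one value serves a whole family of variations.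
  refine ⟨(∫ p in domain τ \ Ω, surfDens a c b X p) +
    ∑ s' ∈ (boundaryLabels τ).erase s, curveEnergy α β (bdryCurve X s'), ?_⟩
  intro q e r z Y he hrz hout hin
  have hd : ∀ p, min f |s| < rad p → rad p < max f |s| →
      surfDens a c b Y p = prDens a (frameDet e * c) b r z (rad p) / rad p := by
    intro p h1 h2
    have hY : Y =ᶠ[𝓝 p] revol q e r z := by
      filter_upwards [hΩo.mem_nhds ⟨h1, h2⟩] with p' hp' using hin p' (hΩu p' hp')
    rw [surfDens_congr hY]
    obtain ⟨i1, i2, i3, i4⟩ := hrz (rad p) (hΩu p ⟨h1, h2⟩)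
    exact surfDens_revol he ((lt_min hf0 hs0).trans h1) i1 i2 i3 i4
  have hcont : ContinuousOn (prDens a (frameDet e * c) b r z) (uIcc f |s|) := by
    intro x hx
    obtain ⟨i1, i2, i3, i4⟩ := hrz x hx
    exact (contDiffAt_prDens (m := 0) i1 i2 (by norm_num) i3 i4).continuousAt.continuousWithinAt
  have hint1 : IntegrableOn (surfDens a c b Y) Ω := integrableOn_radial (lt_min hf0 hs0) hcont hd
  -- On the boundary circle itself the germs of `X` and `Y` are not comparable, but that circle is a
  -- null set.
  have hae : ∀ᵐ p : ℝ × ℝ, p ∈ domain τ \ Ω → surfDens a c b X p = surfDens a c b Y p := by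
    filter_upwards [ae_rad_ne |s|] with p hp1 hp2
    refine (surfDens_congr (hout p hp2.1 ?_)).symm
    by_contra hcon
    push Not at hcon
    apply hp2.2
    have h1 := hcon.1
    rw [uIcc, mem_Icc] at h1
    have hfm : min f |s| ≠ rad p := by
      rcases min_choice f |s| with h | h <;> rw [h]
      · exact hcon.2.symm
      · exact hp1.symm
    have hfM : rad p ≠ max f |s| := by
      rcases max_choice f |s| with h | h <;> rw [h]
      · exact hcon.2
      · exact hp1
    exact ⟨lt_of_le_of_ne h1.1 hfm, lt_of_le_of_ne h1.2 hfM⟩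
  have hmd : MeasurableSet (domain τ \ Ω) :=
    (isCompact_domain τ).measurableSet.diff hΩo.measurableSet
  have hint2 : IntegrableOn (surfDens a c b Y) (domain τ \ Ω) :=
    ((integrableOn_surfDens hX a c b).mono_set sdiff_subset).congr
      ((ae_restrict_iff' hmd).2 hae)
  have hsurf : surfaceEnergy a c b τ Y = (∫ p in domain τ \ Ω, surfDens a c b X p) +
      2 * Real.pi * (s / |s| * ∫ x in f..|s|, prDens a (frameDet e * c) b r z x) := by
    have h1 : surfaceEnergy a c b τ Y = ∫ p in (domain τ \ Ω) ∪ Ω, surfDens a c b Y p := by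
      rw [sdiff_union_of_subset hΩd]; rfl
    rw [h1, setIntegral_union disjoint_sdiff_left hΩo.measurableSet hint2 hint1,
      setIntegral_congr_ae hmd hae, hc.sign_mul_integral,
      setIntegral_radial (le_min hf0.le hs0.le) min_le_max hd]
  have hbd : ∑ s' ∈ boundaryLabels τ, curveEnergy α β (bdryCurve Y s') =
      2 * Real.pi * (α / r |s| + β * r |s|) +
      ∑ s' ∈ (boundaryLabels τ).erase s, curveEnergy α β (bdryCurve X s') := by
    rw [← Finset.add_sum_erase _ _ hc.mem_labels]
    congr 1
    · apply curveEnergy_circle (Q := q + z |s| • e 2) he (hrz |s| right_mem_uIcc).2.2.1 (sign_sq hs)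
      intro θ
      rw [bdryCurve, hin _ (by rw [rad_bdryPoint]; exact right_mem_uIcc), revol_bdryPoint hs]
    · apply Finset.sum_congr rfl
      intro s' hs'
      rw [Finset.mem_erase] at hs'
      congr 1
      ext1 θ
      refine (hout _ (bdryPoint_mem_domain hs'.2 θ) (Or.inl ?_)).self_of_nhds
      rw [rad_bdryPoint]
      exact hc.notMem_of_ne hs'.2 hs'.1
  rw [energy, hsurf, hbd]
  ring

/-- The energy of an annulus of revolution. -/
lemma energy_annulus {a c b α β : ℝ} {q : Fin 3 → ℝ} {e : Fin 3 → Fin 3 → ℝ} {r z : ℝ → ℝ}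
    {Y : ℝ × ℝ → Fin 3 → ℝ} (he : IsFrame e)
    (hrz : ∀ x ∈ Icc (1 : ℝ) 2,
      ContDiffAt ℝ 2 r x ∧ ContDiffAt ℝ 2 z x ∧ 0 < r x ∧ 0 < prSpeed r z x)
    (hin : ∀ p ∈ domain SurfaceType.annulus, Y p = revol q e r z p) :
    energy a c b α β SurfaceType.annulus Y =
      2 * Real.pi * ((∫ x in (1 : ℝ)..2, prDens a (frameDet e * c) b r z x) +
        (α / r 2 + β * r 2) + (α / r 1 + β * r 1)) := by
  set Ω := {p : ℝ × ℝ | 1 < rad p ∧ rad p < 2} with hΩ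
  have hΩo : IsOpen Ω := (isOpen_lt continuous_const continuous_rad).inter
    (isOpen_lt continuous_rad continuous_const)
  have hΩd : Ω ⊆ domain SurfaceType.annulus := fun p hp => mem_annulus_iff.2 ⟨hp.1.le, hp.2.le⟩
  have hd : ∀ p, 1 < rad p → rad p < 2 →
      surfDens a c b Y p = prDens a (frameDet e * c) b r z (rad p) / rad p := by
    intro p h1 h2
    have hY : Y =ᶠ[𝓝 p] revol q e r z := by
      filter_upwards [hΩo.mem_nhds ⟨h1, h2⟩] with p' hp' using hin p' (hΩd hp')
    rw [surfDens_congr hY]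
    obtain ⟨i1, i2, i3, i4⟩ := hrz (rad p) ⟨h1.le, h2.le⟩
    exact surfDens_revol he (one_pos.trans h1) i1 i2 i3 i4
  have hsurf : surfaceEnergy a c b SurfaceType.annulus Y =
      2 * Real.pi * ∫ x in (1 : ℝ)..2, prDens a (frameDet e * c) b r z x := by
    rw [← setIntegral_radial zero_le_one one_le_two hd]
    apply setIntegral_congr_set
    have h1 := ae_rad_ne 1
    have h2 := ae_rad_ne 2
    filter_upwards [h1, h2] with p hp1 hp2
    apply propext
    change p ∈ domain SurfaceType.annulus ↔ _
    rw [mem_annulus_iff]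
    exact ⟨fun h => ⟨lt_of_le_of_ne h.1 hp1.symm, lt_of_le_of_ne h.2 hp2⟩,
      fun h => ⟨h.1.le, h.2.le⟩⟩
  have hbd : ∀ s ∈ boundaryLabels SurfaceType.annulus, curveEnergy α β (bdryCurve Y s) =
      2 * Real.pi * (α / r |s| + β * r |s|) := by
    intro s hs
    have hs0 : s ≠ 0 := by
      rintro rfl
      simp [boundaryLabels] at hs
    have hm : |s| ∈ Icc (1 : ℝ) 2 := by
      have := rad_mem_radii (bdryPoint_mem_domain hs 0)
        (by rw [rad_bdryPoint]; exact abs_pos.2 hs0)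
      rwa [rad_bdryPoint] at this
    apply curveEnergy_circle (Q := q + z |s| • e 2) he (hrz |s| hm).2.2.1 (sign_sq hs0)
    intro θ
    rw [bdryCurve, hin _ (bdryPoint_mem_domain hs θ), revol_bdryPoint hs0]
  rw [energy, hsurf, Finset.sum_congr rfl hbd, boundaryLabels, Finset.sum_pair (by norm_num),
    abs_neg, abs_one, abs_of_pos (two_pos : (0 : ℝ) < 2)]
  ring

/-! ### The profile curve of an axially symmetric immersion -/

/-- `(r, z)` is a profile curve of class `C⁴`, at positive distance from the axis, of the axially
symmetric immersion `X`. -/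
structure IsProfile (τ : SurfaceType) (X : ℝ × ℝ → Fin 3 → ℝ) (q : Fin 3 → ℝ)
    (e : Fin 3 → Fin 3 → ℝ) (r z : ℝ → ℝ) : Prop where
  frame : IsFrame e
  smooth_r : ∀ x ∈ radii τ, ContDiffAt ℝ 4 r x
  smooth_z : ∀ x ∈ radii τ, ContDiffAt ℝ 4 z x
  pos : ∀ x ∈ radii τ, 0 < r x
  speed_pos : ∀ x ∈ radii τ, 0 < prSpeed r z x
  eq_revol : ∀ p ∈ domain τ, 0 < rad p → X p = revol q e r z p

lemma radii_pos {τ : SurfaceType} {x : ℝ} (hx : x ∈ radii τ) : 0 < x := by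
  cases τ
  · exact hx.1
  · exact one_pos.trans_le hx.1

lemma uniqueDiffOn_radii (τ : SurfaceType) : UniqueDiffOn ℝ (radii τ) := by
  cases τ
  · exact uniqueDiffOn_Ioc 0 1
  · exact uniqueDiffOn_Icc one_lt_two

lemma isPreconnected_radii (τ : SurfaceType) : IsPreconnected (radii τ) := by
  cases τ
  · exact isPreconnected_Ioc
  · exact isPreconnected_Icc

lemma radii_subset_closure_interior (τ : SurfaceType) :
    radii τ ⊆ closure (interior (radii τ)) := by
  cases τ
  · simp only [radii, interior_Ioc]
    rw [closure_Ioo zero_ne_one]; exact Ioc_subset_Icc_self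
  · simp only [radii, interior_Icc]
    rw [closure_Ioo (by norm_num)]

lemma exists_polar (p : ℝ × ℝ) : ∃ θ, p = (rad p * Real.cos θ, rad p * Real.sin θ) := by
  refine ⟨Complex.arg ⟨p.1, p.2⟩, ?_⟩
  have h : rad p = ‖(⟨p.1, p.2⟩ : ℂ)‖ := by
    rw [Complex.norm_def, Complex.normSq_mk, rad]; congr 1; ring
  rw [h, Complex.norm_mul_cos_arg, Complex.norm_mul_sin_arg]

lemma revol_polar {q : Fin 3 → ℝ} {e : Fin 3 → Fin 3 → ℝ} {r z : ℝ → ℝ} {x : ℝ} (hx : 0 < x)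
    (θ : ℝ) : revol q e r z (x * Real.cos θ, x * Real.sin θ) =
      q + r x • (Real.cos θ • e 0 + Real.sin θ • e 1) + z x • e 2 := by
  have h := rad_polar hx.le θ
  simp only [rad] at h
  simp only [revol, sqSurf, h, smul_add, smul_smul]
  rw [show r x / x * (x * Real.cos θ) = r x * Real.cos θ by field_simp,
    show r x / x * (x * Real.sin θ) = r x * Real.sin θ by field_simp]

lemma hasDerivAt_dotProduct_const {f : ℝ → Fin 3 → ℝ} {f' : Fin 3 → ℝ} {x : ℝ}
    (hf : HasDerivAt f f' x) (v : Fin 3 → ℝ) : HasDerivAt (fun x => f x ⬝ᵥ v) (f' ⬝ᵥ v) x := by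
  simp only [dotProduct, Fin.sum_univ_three]
  have h := hasDerivAt_pi.1 hf
  exact (((h 0).mul_const _).add ((h 1).mul_const _)).add ((h 2).mul_const _)

/-- The given profile functions r₀, z₀ carry no regularity. They are replaced by the frame
coordinates of `X` along the ray of angle 0, which are C⁴ near every radius of the model and agree
with r₀, z₀ on those radii. The immersion property makes the speed positive and the radius nonzero,
and connectedness then fixes the sign of the radius. -/
lemma exists_profile {τ : SurfaceType} {X : ℝ × ℝ → Fin 3 → ℝ} (hX : IsC4Immersion τ X)
    (hsym : IsAxiallySymmetric τ X) : ∃ q e r z, IsProfile τ X q e r z := by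
  obtain ⟨q, e, r₀, z₀, he, hrep⟩ := hsym
  have he : IsFrame e := he
  have hmem : ∀ x ∈ radii τ, (x, (0 : ℝ)) ∈ domain τ := by
    intro x hx
    have := rad_polar (radii_pos hx).le 0
    simp only [Real.cos_zero, Real.sin_zero, mul_one, mul_zero] at this
    exact mem_domain_of_radii (by rwa [this])
  have hpol : ∀ x ∈ radii τ, ∀ θ : ℝ, (x * Real.cos θ, x * Real.sin θ) ∈ domain τ := by
    intro x hx θ
    exact mem_domain_of_radii (by rwa [rad_polar (radii_pos hx).le])
  set γ : ℝ → Fin 3 → ℝ := fun x => X (x, 0) - q with hγ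
  have hγe : ∀ x ∈ radii τ, γ x = r₀ x • e 0 + (0 : ℝ) • e 1 + z₀ x • e 2 := by
    intro x hx
    have := hrep x 0 (radii_pos hx).le (hpol x hx 0)
    simp only [Real.cos_zero, Real.sin_zero, mul_one, mul_zero] at this
    rw [hγ]
    simp only [this]
    module
  have hdot0 : ∀ x ∈ radii τ, γ x ⬝ᵥ e 0 = r₀ x := by
    intro x hx
    rw [hγe x hx]
    simpa using he.dot (r₀ x) 0 (z₀ x) 1 0 0
  have hdot1 : ∀ x ∈ radii τ, γ x ⬝ᵥ e 1 = 0 := by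
    intro x hx
    rw [hγe x hx]
    simpa using he.dot (r₀ x) 0 (z₀ x) 0 1 0
  have hdot2 : ∀ x ∈ radii τ, γ x ⬝ᵥ e 2 = z₀ x := by
    intro x hx
    rw [hγe x hx]
    simpa using he.dot (r₀ x) 0 (z₀ x) 0 0 1
  have hγs : ∀ x ∈ radii τ, ContDiffAt ℝ 4 γ x := by
    intro x hx
    have h1 : ContDiffAt ℝ 4 (fun x : ℝ => (x, (0 : ℝ))) x := contDiffAt_id.prodMk contDiffAt_const
    exact (ContDiffAt.comp (g := X) x (hX _ (hmem x hx)).1 h1).sub contDiffAt_const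
  have hsm : ∀ v : Fin 3 → ℝ, ∀ x ∈ radii τ, ContDiffAt ℝ 4 (fun x => γ x ⬝ᵥ v) x := by
    intro v x hx
    have h := contDiffAt_pi.1 (hγs x hx)
    simp only [dotProduct, Fin.sum_univ_three]
    exact (((h 0).mul contDiffAt_const).add ((h 1).mul contDiffAt_const)).add
      ((h 2).mul contDiffAt_const)
  have hγd : ∀ x ∈ radii τ, HasDerivAt γ (fderiv ℝ X (x, 0) (1, 0)) x := by
    intro x hx
    have h1 : HasDerivAt (fun u : ℝ => (u, (0 : ℝ))) (1, 0) x :=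
      (hasDerivAt_id x).prodMk (hasDerivAt_const _ _)
    exact ((((hX _ (hmem x hx)).1.differentiableAt (by simp)).hasFDerivAt.comp_hasDerivAt
      (f := fun u : ℝ => (u, (0 : ℝ))) x h1)).sub_const q
  set r : ℝ → ℝ := fun x => γ x ⬝ᵥ e 0 with hr
  set z : ℝ → ℝ := fun x => γ x ⬝ᵥ e 2 with hz
  have hS : ∀ x ∈ radii τ, 0 < prSpeed r z x := by
    intro x hx
    apply Real.sqrt_pos.2
    have hd := hγd x hx
    set w := fderiv ℝ X (x, 0) (1, 0) with hw
    rw [(hasDerivAt_dotProduct_const hd (e 0)).deriv, (hasDerivAt_dotProduct_const hd (e 2)).deriv]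
    have h1 : w ⬝ᵥ e 1 = 0 := by
      -- At an end radius the `e 1` coordinate is known to vanish only on one side; unique
      -- differentiability of the interval still determines the derivative.
      have i1 := (hasDerivAt_dotProduct_const hd (e 1)).hasDerivWithinAt (s := radii τ)
      have i2 : HasDerivWithinAt (fun x => γ x ⬝ᵥ e 1) 0 (radii τ) x :=
        (hasDerivWithinAt_const x (radii τ) (0 : ℝ)).congr hdot1 (hdot1 x hx)
      exact (uniqueDiffOn_radii τ x hx).eq_deriv _ i1 i2
    by_contra hcon
    have h0 : w ⬝ᵥ e 0 = 0 := by nlinarith [sq_nonneg (w ⬝ᵥ e 0), sq_nonneg (w ⬝ᵥ e 2)]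
    have h2 : w ⬝ᵥ e 2 = 0 := by nlinarith [sq_nonneg (w ⬝ᵥ e 0), sq_nonneg (w ⬝ᵥ e 2)]
    have hw0 : w = 0 := by rw [he.expand w, h0, h1, h2]; simp
    have := (hX _ (hmem x hx)).2 (hw0.trans (map_zero (fderiv ℝ X (x, 0))).symm)
    simp at this
  have hr0 : ∀ x ∈ radii τ, r x ≠ 0 := by
    intro x hx h0
    have hx0 := radii_pos hx
    have h1 : HasDerivAt (fun θ : ℝ => (x * Real.cos θ, x * Real.sin θ)) (0, x) 0 := by
      have := ((Real.hasDerivAt_cos 0).const_mul x).prodMk ((Real.hasDerivAt_sin 0).const_mul x)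
      simpa using this
    have hp : (x * Real.cos 0, x * Real.sin 0) = (x, (0 : ℝ)) := by simp
    have h2 : HasFDerivAt X (fderiv ℝ X (x, 0)) (x * Real.cos 0, x * Real.sin 0) := by
      rw [hp]; exact ((hX _ (hmem x hx)).1.differentiableAt (by simp)).hasFDerivAt
    have h3 := HasFDerivAt.comp_hasDerivAt (f := fun θ : ℝ => (x * Real.cos θ, x * Real.sin θ))
      (0 : ℝ) h2 h1
    -- If the radius vanished, a whole parallel would collapse to a point and the angular derivative
    -- of `X` would be zero.
    have h4 : (X ∘ fun θ : ℝ => (x * Real.cos θ, x * Real.sin θ)) = fun _ => q + z₀ x • e 2 := by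
      ext1 θ
      have h5 := hrep x θ hx0.le (hpol x hx θ)
      rw [← hdot0 x hx, show γ x ⬝ᵥ e 0 = 0 from h0] at h5
      simpa using h5
    rw [h4] at h3
    have h5 := h3.unique (hasDerivAt_const _ _)
    have := (hX _ (hmem x hx)).2 (h5.trans (map_zero (fderiv ℝ X (x, 0))).symm)
    simp [hx0.ne'] at this
  have hrev : ∀ p ∈ domain τ, 0 < rad p → X p = revol q e r z p := by
    intro p hp h0
    obtain ⟨θ, hθ⟩ := exists_polar p
    have hx := rad_mem_radii hp h0
    rw [hθ, hrep _ θ h0.le (by rwa [← hθ]), revol_polar h0, hr, hz]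
    simp only [hdot0 _ hx, hdot2 _ hx]
  by_cases hneg : ∃ x ∈ radii τ, r x < 0
  · have hall : ∀ x ∈ radii τ, r x < 0 := by
      obtain ⟨x₁, hx₁, h1⟩ := hneg
      intro x hx
      by_contra hcon
      have := (isPreconnected_radii τ).intermediate_value hx₁ hx
        (fun y hy => (hsm (e 0) y hy).continuousAt.continuousWithinAt) ⟨h1.le, not_lt.1 hcon⟩
      obtain ⟨y, hy, hy0⟩ := this
      exact hr0 y hy hy0
    -- A negative radius becomes positive after a half turn of the frame about the axis, which
    -- preserves its orientation.
    refine ⟨q, ![-e 0, -e 1, e 2], fun x => -r x, z, ?_, ?_, ?_, ?_, ?_, ?_⟩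
    · intro i j
      fin_cases i <;> fin_cases j <;> simp [he _ _]
    · exact fun x hx => (hsm (e 0) x hx).neg
    · exact hsm (e 2)
    · intro x hx; have := hall x hx; linarith
    · intro x hx
      have := hS x hx
      simpa [prSpeed, deriv.fun_neg] using this
    · intro p hp h0
      rw [hrev p hp h0]
      simp only [revol, sqSurf, Matrix.cons_val]
      module
  · push Not at hneg
    exact ⟨q, e, r, z, he, hsm (e 0), hsm (e 2),
      fun x hx => lt_of_le_of_ne (hneg x hx) (hr0 x hx).symm, hS, hrev⟩

/-! ### Geometry along the boundary -/

lemma eq_of_eqOn_closure {E : Type*} [TopologicalSpace E] [T2Space E] {f g : ℝ × ℝ → E}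
    {U : Set (ℝ × ℝ)} {p : ℝ × ℝ} (hf : ContinuousAt f p) (hg : ContinuousAt g p)
    (h : ∀ p ∈ U, f p = g p) (hp : p ∈ closure U) : f p = g p := by
  have : (𝓝[U] p).NeBot := mem_closure_iff_nhdsWithin_neBot.1 hp
  have h1 : Tendsto f (𝓝[U] p) (𝓝 (f p)) := hf.mono_left inf_le_left
  have h2 : Tendsto f (𝓝[U] p) (𝓝 (g p)) :=
    (hg.mono_left inf_le_left : Tendsto g (𝓝[U] p) (𝓝 (g p))).congr'
      (eventually_nhdsWithin_of_forall fun p hp => (h p hp).symm)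
  exact tendsto_nhds_unique h1 h2

lemma contDiffAt_rad {n : WithTop ℕ∞} {p : ℝ × ℝ} (hp : 0 < rad p) : ContDiffAt ℝ n rad p := by
  apply ContDiffAt.sqrt
  · exact (contDiffAt_fst.pow 2).add (contDiffAt_snd.pow 2)
  · exact (Real.sqrt_pos.1 hp).ne'

lemma contDiffAt_revol {n : WithTop ℕ∞} {q : Fin 3 → ℝ} {e : Fin 3 → Fin 3 → ℝ} {r z : ℝ → ℝ}
    {p : ℝ × ℝ} (hp : 0 < rad p) (hr : ContDiffAt ℝ n r (rad p)) (hz : ContDiffAt ℝ n z (rad p)) :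
    ContDiffAt ℝ n (revol q e r z) p := by
  have h := contDiffAt_rad (n := n) hp
  have hr' : ContDiffAt ℝ n (fun p => r (rad p)) p := hr.comp p h
  have hz' : ContDiffAt ℝ n (fun p => z (rad p)) p := hz.comp p h
  exact (contDiffAt_const.add ((hr'.div h hp.ne').smul ((contDiffAt_fst.smul contDiffAt_const).add
    (contDiffAt_snd.smul contDiffAt_const)))).add (hz'.smul contDiffAt_const)

section boundary

variable {τ : SurfaceType} {X : ℝ × ℝ → Fin 3 → ℝ} {q : Fin 3 → ℝ} {e : Fin 3 → Fin 3 → ℝ}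
  {r z : ℝ → ℝ}

/-- Over boundary points `X` and the surface of revolution coincide only from inside, so their germs
may differ. The quantities are compared where the germs agree and extended by continuity. -/
lemma IsProfile.geometry (h : IsProfile τ X q e r z) (hX : IsC4Immersion τ X) {p : ℝ × ℝ}
    (hp : p ∈ domain τ) (h0 : 0 < rad p) :
    normal X p = normal (revol q e r z) p ∧ gaussCurv X p = gaussCurv (revol q e r z) p := by
  have hx := rad_mem_radii hp h0
  set U := {p : ℝ × ℝ | rad p ∈ interior (radii τ)} with hU
  have hUo : IsOpen U := isOpen_interior.preimage continuous_rad
  have heq : ∀ p' ∈ U, X =ᶠ[𝓝 p'] revol q e r z := by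
    intro p' hp'
    filter_upwards [hUo.mem_nhds hp'] with p'' hp''
    have h1 := interior_subset (show rad p'' ∈ interior (radii τ) from hp'')
    exact h.eq_revol _ (mem_domain_of_radii h1) (radii_pos h1)
  have hcl : p ∈ closure U := by
    obtain ⟨θ, hθ⟩ := exists_polar p
    rw [hθ]
    have hc : Continuous fun x : ℝ => (x * Real.cos θ, x * Real.sin θ) := by fun_prop
    refine map_mem_closure (f := fun x : ℝ => (x * Real.cos θ, x * Real.sin θ)) hc
      (radii_subset_closure_interior τ hx) ?_
    intro x hx'
    change rad (x * Real.cos θ, x * Real.sin θ) ∈ interior (radii τ)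
    rw [rad_polar (radii_pos (interior_subset hx')).le]
    exact hx'
  have hs1 : ContDiffAt ℝ 2 X p := (hX p hp).1.of_le (by norm_num)
  have hr2 := (h.smooth_r _ hx).of_le (show (2 : WithTop ℕ∞) ≤ 4 by norm_num)
  have hz2 := (h.smooth_z _ hx).of_le (show (2 : WithTop ℕ∞) ≤ 4 by norm_num)
  have hs2 : ContDiffAt ℝ 2 (revol q e r z) p := contDiffAt_revol h0 hr2 hz2
  have hd1 := gDet_pos (hX p hp).2
  have hd2 : 0 < gDet (revol q e r z) p := by
    rw [← Real.sqrt_pos, (revol_geometry h.frame h0 hr2 hz2 (h.pos _ hx) (h.speed_pos _ hx)).1]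
    have := h.pos _ hx
    have := h.speed_pos _ hx
    positivity
  constructor
  · refine eq_of_eqOn_closure (continuousAt_normal hs1 hd1) (continuousAt_normal hs2 hd2) ?_ hcl
    intro p' hp'
    simp only [normal, gDet, gE, gF, gG, du_congr (heq p' hp'), dv_congr (heq p' hp')]
  · refine eq_of_eqOn_closure (continuousAt_curvatures hs1 hd1).2
      (continuousAt_curvatures hs2 hd2).2 ?_ hcl
    intro p' hp'
    have hu : du X =ᶠ[𝓝 p'] du (revol q e r z) :=
      (heq p' hp').eventuallyEq_nhds.mono fun _ h => du_congr h
    have hv : dv X =ᶠ[𝓝 p'] dv (revol q e r z) :=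
      (heq p' hp').eventuallyEq_nhds.mono fun _ h => dv_congr h
    simp only [gaussCurv, gDet, hL, hM, hN, normal, gE, gF, gG, du_congr hu, dv_congr hu,
      dv_congr hv, hu.self_of_nhds, hv.self_of_nhds]

lemma label_ne_zero {s : ℝ} (hs : s ∈ boundaryLabels τ) : s ≠ 0 := by
  rintro rfl
  cases τ <;> simp [boundaryLabels] at hs

lemma abs_label_mem_radii {s : ℝ} (hs : s ∈ boundaryLabels τ) : |s| ∈ radii τ := by
  have := rad_mem_radii (bdryPoint_mem_domain hs 0)
    (by rw [rad_bdryPoint]; exact abs_pos.2 (label_ne_zero hs))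
  rwa [rad_bdryPoint] at this

lemma IsProfile.bdryCurve_eq (h : IsProfile τ X q e r z) {s : ℝ} (hs : s ∈ boundaryLabels τ)
    (θ : ℝ) : bdryCurve X s θ = (q + z |s| • e 2) +
      r |s| • (Real.cos θ • e 0 + (s / |s| * Real.sin θ) • e 1) := by
  rw [bdryCurve, h.eq_revol _ (bdryPoint_mem_domain hs θ)
    (by rw [rad_bdryPoint]; exact abs_pos.2 (label_ne_zero hs)), revol_bdryPoint (label_ne_zero hs)]

lemma IsProfile.gaussCurv_eq (h : IsProfile τ X q e r z) (hX : IsC4Immersion τ X) {s : ℝ}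
    (hs : s ∈ boundaryLabels τ) (θ : ℝ) :
    gaussCurv X (bdryPoint s θ) = prK1 r z |s| * prK2 r z |s| := by
  have hx := abs_label_mem_radii hs
  have h0 : 0 < rad (bdryPoint s θ) := by rw [rad_bdryPoint]; exact radii_pos hx
  rw [(h.geometry hX (bdryPoint_mem_domain hs θ) h0).2]
  rw [← rad_bdryPoint s θ] at hx
  rw [(revol_geometry h.frame h0 ((h.smooth_r _ hx).of_le (by norm_num))
    ((h.smooth_z _ hx).of_le (by norm_num)) (h.pos _ hx) (h.speed_pos _ hx)).2.2.1, rad_bdryPoint]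

/-- The vector T' points towards the axis with length 1/r, and the outward conormal has radial
component ς r'/S. -/
lemma IsProfile.geodCurv_eq (h : IsProfile τ X q e r z) (hX : IsC4Immersion τ X) {s : ℝ}
    (hs : s ∈ boundaryLabels τ) (θ : ℝ) :
    geodCurv X s θ = -(s / |s| * (deriv r |s| / (r |s| * prSpeed r z |s|))) := by
  have hx := abs_label_mem_radii hs
  have hx0 := radii_pos hx
  have h0 : 0 < rad (bdryPoint s θ) := by rw [rad_bdryPoint]; exact hx0
  have hx' := hx
  rw [← rad_bdryPoint s θ] at hx'
  have hn := (revol_geometry (q := q) h.frame h0 ((h.smooth_r _ hx').of_le (by norm_num))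
    ((h.smooth_z _ hx').of_le (by norm_num)) (h.pos _ hx') (h.speed_pos _ hx')).2.2.2
  rw [rad_bdryPoint] at hn
  have hr := h.pos _ hx
  have hS := h.speed_pos _ hx
  have hς := sign_sq (label_ne_zero hs)
  obtain ⟨-, hT, hV, -⟩ := circle_geometry h.frame hr hς (h.bdryCurve_eq hs) θ
  rw [geodCurv, conormal, hT, hV, (h.geometry hX (bdryPoint_mem_domain hs θ) h0).1, hn,
    h.frame.cross, h.frame.dot]
  have hd := h.frame.frameDet_sq
  simp only [bdryPoint]
  set ς := s / |s| with hςd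
  have hid : ς * (deriv r |s| / (r |s| * prSpeed r z |s|)) * (frameDet e ^ 2 *
      (Real.sin θ ^ 2 + Real.cos θ ^ 2)) = ς * (deriv r |s| / (r |s| * prSpeed r z |s|)) := by
    rw [hd, Real.sin_sq_add_cos_sq]; ring
  rw [← hid]
  field_simp
  ring

end boundary

/-! ### Radii of round circles -/

lemma zero_le_dotProduct_self (v : Fin 3 → ℝ) : 0 ≤ v ⬝ᵥ v :=
  Finset.sum_nonneg fun _ _ => mul_self_nonneg _

/-- Two opposite points of the first circle are at distance 2R, while two points of the second are
at distance at most 2R'. Applied in both directions, this makes the radius of a circle well defined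
as a property of its point set. -/
lemma circle_radius_le {Q q u v u' v' : Fin 3 → ℝ} {R R' : ℝ} (hR : 0 < R) (hR' : 0 < R')
    (hu : u ⬝ᵥ u = 1) (hu' : u' ⬝ᵥ u' = 1) (hv' : v' ⬝ᵥ v' = 1) (huv' : u' ⬝ᵥ v' = 0)
    (h : (range fun t : ℝ => Q + R • (Real.cos t • u + Real.sin t • v)) ⊆
      range fun t : ℝ => q + R' • (Real.cos t • u' + Real.sin t • v')) : R ≤ R' := by
  obtain ⟨t, ht⟩ := h ⟨0, rfl⟩
  obtain ⟨t', ht'⟩ := h ⟨Real.pi, rfl⟩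
  simp only [Real.cos_zero, Real.sin_zero, Real.cos_pi, Real.sin_pi] at ht ht'
  set a := Real.cos t • u' + Real.sin t • v'
  set b := Real.cos t' • u' + Real.sin t' • v'
  have hunit : ∀ t : ℝ, (Real.cos t • u' + Real.sin t • v') ⬝ᵥ
      (Real.cos t • u' + Real.sin t • v') = 1 := by
    intro t
    simp only [add_dotProduct, dotProduct_add, smul_dotProduct, dotProduct_smul, smul_eq_mul, hu',
      hv', huv', dotProduct_comm v' u']
    linear_combination Real.sin_sq_add_cos_sq t
  have ha : a ⬝ᵥ a = 1 := hunit t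
  have hb : b ⬝ᵥ b = 1 := hunit t'
  have hab : 0 ≤ (a + b) ⬝ᵥ (a + b) := zero_le_dotProduct_self _
  have hsub : R' • (a - b) = (2 * R) • u := by
    have h1 : R' • (a - b) = (q + R' • a) - (q + R' • b) := by module
    rw [h1, ht, ht']
    module
  have h2 : (R' • (a - b)) ⬝ᵥ (R' • (a - b)) = ((2 * R) • u) ⬝ᵥ ((2 * R) • u) := by rw [hsub]
  simp only [add_dotProduct, dotProduct_add, sub_dotProduct, dotProduct_sub, smul_dotProduct,
    dotProduct_smul, smul_eq_mul, ha, hb, hu, dotProduct_comm b a] at h2 hab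
  nlinarith [mul_nonneg (mul_nonneg hR'.le hR'.le) hab]

lemma IsProfile.radius_eq {τ : SurfaceType} {X : ℝ × ℝ → Fin 3 → ℝ} {q : Fin 3 → ℝ}
    {e : Fin 3 → Fin 3 → ℝ} {r z : ℝ → ℝ} (h : IsProfile τ X q e r z) {s R : ℝ}
    (hs : s ∈ boundaryLabels τ) (hR : IsCircle (range (bdryCurve X s)) R) : r |s| = R := by
  obtain ⟨hR0, q', u, v, hu, hv, huv, hrange⟩ := hR
  have hr := h.pos _ (abs_label_mem_radii hs)
  have hC : bdryCurve X s = fun t => (q + z |s| • e 2) +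
      r |s| • (Real.cos t • e 0 + Real.sin t • ((s / |s|) • e 1)) := by
    ext1 t
    rw [h.bdryCurve_eq hs, smul_smul, mul_comm (Real.sin t)]
  have hς := sign_sq (label_ne_zero hs)
  have he := h.frame
  have h00 : e 0 ⬝ᵥ e 0 = 1 := by simp [he _ _]
  have h11 : ((s / |s|) • e 1) ⬝ᵥ ((s / |s|) • e 1) = 1 := by
    rw [smul_dotProduct, dotProduct_smul, he]
    simp only [if_true, smul_eq_mul, mul_one]
    rw [← sq, hς]
  have h01 : e 0 ⬝ᵥ ((s / |s|) • e 1) = 0 := by simp [dotProduct_smul, he _ _]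
  rw [hC] at hrange
  exact le_antisymm (circle_radius_le hr hR0 h00 hu hv huv hrange.subset)
    (circle_radius_le hR0 hr hu h00 h11 h01 hrange.superset)

/-! ### Integrals depending on a parameter -/

/-- By compactness the integrand is C¹ near a full rectangle [−ε/2, ε/2] × [a, b], where its
parameter derivative is bounded; dominated differentiation applies. -/
lemma hasDerivAt_integral_param {Φ : ℝ → ℝ → ℝ} {a b : ℝ}
    (h : ∀ x ∈ uIcc a b, ContDiffAt ℝ 1 (fun w : ℝ × ℝ => Φ w.1 w.2) (0, x)) :
    ∃ C : ℝ, ∀ᶠ t in 𝓝 (0 : ℝ),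
      HasDerivAt (fun t => ∫ x in a..b, Φ t x) (∫ x in a..b, deriv (fun t => Φ t x) t) t ∧
      |∫ x in a..b, deriv (fun t => Φ t x) t| ≤ C ∧ |∫ x in a..b, Φ t x| ≤ C := by
  have h1 : ∀ᶠ t in 𝓝 (0 : ℝ), ∀ x ∈ uIcc a b,
      ContDiffAt ℝ 1 (fun w : ℝ × ℝ => Φ w.1 w.2) (t, x) :=
    isCompact_uIcc.eventually_forall_of_forall_eventually fun x hx =>
      (h x hx).eventually (by simp)
  obtain ⟨ε, hε, hball⟩ := Metric.eventually_nhds_iff.1 h1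
  have hsm : ∀ t ∈ Icc (-(ε / 2)) (ε / 2), ∀ x ∈ uIcc a b,
      ContDiffAt ℝ 1 (fun w : ℝ × ℝ => Φ w.1 w.2) (t, x) := by
    intro t ht x hx
    apply hball _ x hx
    rw [Real.dist_eq, sub_zero, abs_lt]
    constructor <;> linarith [ht.1, ht.2]
  have hK : IsCompact (Icc (-(ε / 2)) (ε / 2) ×ˢ uIcc a b) := isCompact_Icc.prod isCompact_uIcc
  have hder : ∀ t ∈ Icc (-(ε / 2)) (ε / 2), ∀ x ∈ uIcc a b, HasDerivAt (fun t => Φ t x)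
      (fderiv ℝ (fun w : ℝ × ℝ => Φ w.1 w.2) (t, x) (1, 0)) t := by
    intro t ht x hx
    have i1 : HasDerivAt (fun u : ℝ => (u, x)) (1, 0) t :=
      (hasDerivAt_id t).prodMk (hasDerivAt_const _ _)
    exact HasFDerivAt.comp_hasDerivAt (f := fun u : ℝ => (u, x)) t
      ((hsm t ht x hx).differentiableAt (by simp)).hasFDerivAt i1
  have hcont1 : ContinuousOn (fun w : ℝ × ℝ => fderiv ℝ (fun w : ℝ × ℝ => Φ w.1 w.2) w (1, 0))
      (Icc (-(ε / 2)) (ε / 2) ×ˢ uIcc a b) := by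
    rintro ⟨t, x⟩ hw
    exact (((hsm t hw.1 x hw.2).fderiv_right (m := 0) (by simp)).continuousAt.clm_apply
      continuousAt_const).continuousWithinAt
  have hcont0 : ContinuousOn (fun w : ℝ × ℝ => Φ w.1 w.2)
      (Icc (-(ε / 2)) (ε / 2) ×ˢ uIcc a b) := by
    rintro ⟨t, x⟩ hw
    exact (hsm t hw.1 x hw.2).continuousAt.continuousWithinAt
  obtain ⟨C₁, hC₁⟩ := hK.exists_bound_of_continuousOn hcont1
  obtain ⟨C₀, hC₀⟩ := hK.exists_bound_of_continuousOn hcont0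
  have hslice : ∀ {G : ℝ × ℝ → ℝ}, ContinuousOn G (Icc (-(ε / 2)) (ε / 2) ×ˢ uIcc a b) →
      ∀ t ∈ Icc (-(ε / 2)) (ε / 2), ContinuousOn (fun x => G (t, x)) (uIcc a b) := by
    intro G hG t ht
    exact hG.comp (by fun_prop) fun x hx => ⟨ht, hx⟩
  refine ⟨max (C₁ * |b - a|) (C₀ * |b - a|), ?_⟩
  filter_upwards [Ioo_mem_nhds (show -(ε / 2) < 0 by linarith) (show 0 < ε / 2 by linarith)]
    with t ht
  have ht' := Ioo_subset_Icc_self ht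
  have hderiv : ∀ t ∈ Icc (-(ε / 2)) (ε / 2), ∀ x ∈ uIcc a b, deriv (fun t => Φ t x) t =
      fderiv ℝ (fun w : ℝ × ℝ => Φ w.1 w.2) (t, x) (1, 0) :=
    fun t ht x hx => (hder t ht x hx).deriv
  have hmeas : ∀ t ∈ Icc (-(ε / 2)) (ε / 2), ContinuousOn (fun x => deriv (fun t => Φ t x) t)
      (uIcc a b) := fun t ht => (hslice hcont1 t ht).congr fun x hx => hderiv t ht x hx
  refine ⟨?_, ?_, ?_⟩
  · refine (intervalIntegral.hasDerivAt_integral_of_dominated_loc_of_deriv_le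
      (F' := fun t x => deriv (fun t => Φ t x) t) (bound := fun _ => C₁)
      (s := Ioo (-(ε / 2)) (ε / 2)) (Ioo_mem_nhds ht.1 ht.2) ?_ ?_ ?_ ?_ ?_ ?_).2
    · filter_upwards [Ioo_mem_nhds ht.1 ht.2] with t' ht'
      exact ((hslice hcont0 t' (Ioo_subset_Icc_self ht')).mono
        uIoc_subset_uIcc).aestronglyMeasurable measurableSet_uIoc
    · exact (hslice hcont0 t ht').intervalIntegrable
    · exact ((hmeas t ht').mono uIoc_subset_uIcc).aestronglyMeasurable measurableSet_uIoc
    · refine Eventually.of_forall fun x hx t' ht' => ?_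
      have hx' := uIoc_subset_uIcc hx
      rw [hderiv t' (Ioo_subset_Icc_self ht') x hx']
      exact hC₁ (t', x) ⟨Ioo_subset_Icc_self ht', hx'⟩
    · exact intervalIntegrable_const
    · refine Eventually.of_forall fun x hx t' ht' => ?_
      have hx' := uIoc_subset_uIcc hx
      rw [hderiv t' (Ioo_subset_Icc_self ht') x hx']
      exact hder t' (Ioo_subset_Icc_self ht') x hx'
  · rw [← Real.norm_eq_abs]
    refine (intervalIntegral.norm_integral_le_of_norm_le_const (C := C₁) fun x hx => ?_).trans
      (le_max_left _ _)
    have hx' := uIoc_subset_uIcc hx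
    rw [hderiv t ht' x hx']
    exact hC₁ (t, x) ⟨ht', hx'⟩
  · rw [← Real.norm_eq_abs]
    refine (intervalIntegral.norm_integral_le_of_norm_le_const (C := C₀) fun x hx => ?_).trans
      (le_max_right _ _)
    exact hC₀ (t, x) ⟨ht', uIoc_subset_uIcc hx⟩

/-! ### A fundamental lemma with an end point term -/

/-- Test functions supported strictly between f and x₁ kill `Y`; a bump at x₁ then isolates k. The
sign condition on (x₁ − f)(x − f) describes the open half-line from f towards x₁ in either order of
the two points. -/
lemma eq_zero_of_integral_add_eq_zero {f x₁ : ℝ} (hne : f ≠ x₁) {Y : ℝ → ℝ}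
    (hY : ContinuousOn Y (uIcc f x₁)) {k : ℝ}
    (h : ∀ g : ℝ → ℝ, ContDiff ℝ 4 g → tsupport g ⊆ {x | 0 < (x₁ - f) * (x - f)} →
      (∫ x in f..x₁, Y x * g x) + k * g x₁ = 0) :
    (∀ x ∈ uIcc f x₁, Y x = 0) ∧ k = 0 := by
  have hlt : min f x₁ < max f x₁ := min_lt_max.2 hne
  have hmem : ∀ x ∈ Ioo (min f x₁) (max f x₁), 0 < (x₁ - f) * (x - f) ∧ x ≠ x₁ := by
    intro x hx
    rcases lt_or_gt_of_ne hne with h1 | h1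
    · rw [min_eq_left h1.le, max_eq_right h1.le] at hx
      exact ⟨mul_pos (by linarith) (by linarith [hx.1]), hx.2.ne⟩
    · rw [min_eq_right h1.le, max_eq_left h1.le] at hx
      exact ⟨mul_pos_of_neg_of_neg (by linarith) (by linarith [hx.2]), hx.1.ne'⟩
  have hsub : Ioo (min f x₁) (max f x₁) ⊆ uIcc f x₁ := Ioo_subset_Icc_self
  have h1 : ∀ᵐ x : ℝ, x ∈ Ioo (min f x₁) (max f x₁) → Y x = 0 := by
    apply isOpen_Ioo.ae_eq_zero_of_integral_contDiff_smul_eq_zero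
    · exact (hY.mono hsub).locallyIntegrableOn measurableSet_Ioo
    · intro g hg hgc hgs
      have i1 := h g (by exact_mod_cast contDiff_infty.1 hg 4) fun x hx => (hmem x (hgs hx)).1
      have i2 : g x₁ = 0 := by
        by_contra hcon
        exact (hmem x₁ (hgs (subset_tsupport g hcon))).2 rfl
      rw [i2, mul_zero, add_zero, intervalIntegral.intervalIntegral_eq_integral_uIoc,
        smul_eq_mul] at i1
      have i3 : ∫ x in uIoc f x₁, Y x * g x = 0 := by
        rcases mul_eq_zero.1 i1 with h2 | h2
        · split_ifs at h2 <;> norm_num at h2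
        · exact h2
      rw [uIoc, integral_Ioc_eq_integral_Ioo] at i3
      rw [← i3, ← integral_indicator measurableSet_Ioo]
      congr 1
      ext1 x
      by_cases hx : x ∈ Ioo (min f x₁) (max f x₁)
      · rw [indicator_of_mem hx, smul_eq_mul, mul_comm]
      · rw [indicator_of_notMem hx]
        have : g x = 0 := by
          by_contra hcon
          exact hx (hgs (subset_tsupport g hcon))
        simp [this]
  have h2 : ∀ x ∈ uIcc f x₁, Y x = 0 := by
    have : EqOn Y (fun _ => 0) (Icc (min f x₁) (max f x₁)) := by
      apply Measure.eqOn_Icc_of_ae_eq volume hlt.ne _ hY continuousOn_const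
      rw [Measure.restrict_congr_set Ioo_ae_eq_Icc.symm]
      exact (ae_restrict_iff' measurableSet_Ioo).2 h1
    exact this
  refine ⟨h2, ?_⟩
  have hd : 0 < |x₁ - f| := abs_pos.2 (sub_ne_zero.2 hne.symm)
  let g : ContDiffBump x₁ := ⟨|x₁ - f| / 4, |x₁ - f| / 2, by positivity, by linarith⟩
  have i1 := h g g.contDiff ?_
  · have i2 : g x₁ = 1 := g.one_of_mem_closedBall (Metric.mem_closedBall_self (by positivity))
    have i3 : ∫ x in f..x₁, Y x * g x = 0 := by
      rw [intervalIntegral.integral_congr (g := fun _ => 0)]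
      · simp
      · intro x hx
        simp [h2 x hx]
    rwa [i2, i3, zero_add, mul_one] at i1
  · rw [g.tsupport_eq]
    intro x hx
    have hx' : |x - x₁| ≤ |x₁ - f| / 2 := by simpa [Real.dist_eq] using hx
    change 0 < (x₁ - f) * (x - f)
    rcases lt_or_gt_of_ne hne with h3 | h3
    · rw [abs_of_pos (sub_pos.2 h3)] at hx'
      have := (abs_le.1 hx').1
      exact mul_pos (by linarith) (by linarith)
    · rw [abs_of_neg (sub_neg.2 h3)] at hx'
      have := (abs_le.1 hx').2
      exact mul_pos_of_neg_of_neg (by linarith) (by linarith)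

/-! ### First variation of the bending energy of a profile curve -/

/-- Mean curvature of the profile shifted by the spontaneous curvature. -/
def prH (c : ℝ) (r z : ℝ → ℝ) (x : ℝ) : ℝ := (prK1 r z x + prK2 r z x) / 2 + c

/-- Radial component of the flux of the bending energy. -/
def momU (a c : ℝ) (r z : ℝ → ℝ) (x : ℝ) : ℝ :=
  a * (deriv (prH c r z) x * r x * deriv z x / prSpeed r z x ^ 2 +
    r x * prH c r z x * (prH c r z x - prK2 r z x) * deriv r x / prSpeed r z x)

/-- Axial component of the flux of the bending energy. -/
def momW (a c : ℝ) (r z : ℝ → ℝ) (x : ℝ) : ℝ :=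
  a * (-(deriv (prH c r z) x * r x * deriv r x / prSpeed r z x ^ 2) +
    r x * prH c r z x * (prH c r z x - prK2 r z x) * deriv z x / prSpeed r z x)

/-- Radial derivative of the bending energy density. -/
def momZ (a c : ℝ) (r z : ℝ → ℝ) (x : ℝ) : ℝ :=
  a * (prH c r z x * (prH c r z x - prK1 r z x) * prSpeed r z x)

/-- Infinitesimal rotation of the tangent of the profile under the variation `(φ, η)`. -/
def angVar (r z φ η : ℝ → ℝ) (x : ℝ) : ℝ :=
  (deriv r x * deriv η x - deriv z x * deriv φ x) / prSpeed r z x ^ 2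

/-- The bending energy density as a function of the jet of the profile. -/
def densFn (a c r r₁ z₁ r₂ z₂ : ℝ) : ℝ :=
  a * ((z₁ / (r * Real.sqrt (r₁ ^ 2 + z₁ ^ 2)) +
    (r₁ * z₂ - z₁ * r₂) / Real.sqrt (r₁ ^ 2 + z₁ ^ 2) ^ 3) / 2 + c) ^ 2 *
    (r * Real.sqrt (r₁ ^ 2 + z₁ ^ 2))

lemma prDens_zero_eq (a c : ℝ) (r z : ℝ → ℝ) (x : ℝ) : prDens a c 0 r z x =
    densFn a c (r x) (deriv r x) (deriv z x) (deriv (deriv r) x) (deriv (deriv z) x) := by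
  simp [prDens, densFn, prK1, prK2, prSpeed]

lemma contDiffAt_densFn {E : Type*} [NormedAddCommGroup E] [NormedSpace ℝ E] {n : WithTop ℕ∞}
    {a c : ℝ} {R R₁ Z₁ R₂ Z₂ : E → ℝ} {w : E} (hR : ContDiffAt ℝ n R w)
    (hR₁ : ContDiffAt ℝ n R₁ w) (hZ₁ : ContDiffAt ℝ n Z₁ w) (hR₂ : ContDiffAt ℝ n R₂ w)
    (hZ₂ : ContDiffAt ℝ n Z₂ w) (h0 : 0 < R w) (hS : 0 < R₁ w ^ 2 + Z₁ w ^ 2) :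
    ContDiffAt ℝ n (fun w => densFn a c (R w) (R₁ w) (Z₁ w) (R₂ w) (Z₂ w)) w := by
  have hsq : ContDiffAt ℝ n (fun w => Real.sqrt (R₁ w ^ 2 + Z₁ w ^ 2)) w :=
    ((hR₁.pow 2).add (hZ₁.pow 2)).sqrt hS.ne'
  have hpos : 0 < Real.sqrt (R₁ w ^ 2 + Z₁ w ^ 2) := Real.sqrt_pos.2 hS
  exact (contDiffAt_const.mul (((((hZ₁.div (hR.mul hsq) (by positivity)).add
    (((hR₁.mul hZ₂).sub (hZ₁.mul hR₂)).div (hsq.pow 3) (by positivity))).div_const 2).add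
    contDiffAt_const).pow 2)).mul (hR.mul hsq)

/-- The varied tangent is split as (φ₁, η₁) = τ (r₁, z₁) + ω (−z₁, r₁) into stretch and rotation.
Then δS = τS, δk₁ = (r₁ω − k₁φS)/(rS) and δk₂ = ω'/S − τk₂, and the product rule sorts the result by
rotation, stretch and radial displacement. -/
lemma hasDerivAt_densFn {a c r r₁ z₁ r₂ z₂ φ φ₁ η₁ φ₂ η₂ S k₁ k₂ h τ ω ω' : ℝ} (hr : 0 < r)
    (hS : 0 < S) (hSq : S ^ 2 = r₁ ^ 2 + z₁ ^ 2) (hk₁ : k₁ = z₁ / (r * S))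
    (hk₂ : k₂ = (r₁ * z₂ - z₁ * r₂) / S ^ 3) (hh : h = (k₁ + k₂) / 2 + c)
    (hτ : τ = (r₁ * φ₁ + z₁ * η₁) / S ^ 2) (hω : ω = (r₁ * η₁ - z₁ * φ₁) / S ^ 2)
    (hω' : ω' = (r₁ * η₂ + r₂ * η₁ - z₁ * φ₂ - z₂ * φ₁) / S ^ 2 -
      2 * (r₁ * η₁ - z₁ * φ₁) * (r₁ * r₂ + z₁ * z₂) / S ^ 4) :
    HasDerivAt (fun t => densFn a c (r + t * φ) (r₁ + t * φ₁) (z₁ + t * η₁) (r₂ + t * φ₂)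
      (z₂ + t * η₂)) (a * (h * r * ω' + h * r₁ * ω + S * (r * h * (h - k₂) * τ +
        h * (h - k₁) * φ))) 0 := by
  have hlin : ∀ x y : ℝ, HasDerivAt (fun t : ℝ => x + t * y) y 0 := by
    intro x y
    simpa using ((hasDerivAt_id (0 : ℝ)).mul_const y).const_add x
  have hsqrt : Real.sqrt (r₁ ^ 2 + z₁ ^ 2) = S := by rw [← hSq, Real.sqrt_sq hS.le]
  have hSd : HasDerivAt (fun t : ℝ => Real.sqrt ((r₁ + t * φ₁) ^ 2 + (z₁ + t * η₁) ^ 2))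
      (τ * S) 0 := by
    have := (((hlin r₁ φ₁).pow 2).add ((hlin z₁ η₁).pow 2)).sqrt
      (by simp only [Pi.add_apply, Pi.pow_apply]; simp only [zero_mul, add_zero]; rw [← hSq]
          positivity)
    refine this.congr_deriv ?_
    simp only [Pi.add_apply, Pi.pow_apply, zero_mul, add_zero, hsqrt]
    rw [hτ]
    field_simp
    ring
  set σ : ℝ → ℝ := fun t => Real.sqrt ((r₁ + t * φ₁) ^ 2 + (z₁ + t * η₁) ^ 2) with hσ
  have hσ0 : σ 0 = S := by simp [hσ, hsqrt]
  have hK1 : HasDerivAt (fun t => (z₁ + t * η₁) / ((r + t * φ) * σ t))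
      ((r₁ * ω - k₁ * φ * S) / (r * S)) 0 := by
    have := (hlin z₁ η₁).div ((hlin r φ).mul hSd) (by simp [hσ0, hr.ne', hS.ne'])
    refine this.congr_deriv ?_
    simp only [Pi.mul_apply, zero_mul, add_zero, hσ0]
    have hid : η₁ = r₁ * ω + z₁ * τ := by
      rw [hω, hτ]; field_simp; rw [hSq]; ring
    rw [hk₁]
    field_simp
    linear_combination r * hid
  have hK2 : HasDerivAt (fun t => ((r₁ + t * φ₁) * (z₂ + t * η₂) - (z₁ + t * η₁) * (r₂ + t * φ₂)) /
      σ t ^ 3) ((ω' - τ * k₂ * S) / S) 0 := by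
    have := (((hlin r₁ φ₁).mul (hlin z₂ η₂)).sub ((hlin z₁ η₁).mul (hlin r₂ φ₂))).div (hSd.pow 3)
      (by simp [hσ0, hS.ne'])
    refine this.congr_deriv ?_
    simp only [Pi.mul_apply, Pi.sub_apply, Pi.pow_apply, zero_mul, add_zero, hσ0]
    have hid : (φ₁ * z₂ - η₁ * r₂) * S ^ 2 = (r₁ * z₂ - z₁ * r₂) * (r₁ * φ₁ + z₁ * η₁) -
        (r₁ * η₁ - z₁ * φ₁) * (r₁ * r₂ + z₁ * z₂) := by rw [hSq]; ring
    rw [hω', hk₂, hτ]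
    field_simp
    push_cast
    linear_combination 2 * S ^ 2 * hid
  have hfin := (((((hK1.add hK2).div_const 2).add_const c).pow 2).const_mul a).mul
    ((hlin r φ).mul hSd)
  refine hfin.congr_deriv ?_
  simp only [Pi.mul_apply, Pi.add_apply, Pi.pow_apply, zero_mul, add_zero, hσ0]
  rw [← hk₁, ← hk₂, ← hh]
  push_cast
  field_simp
  ring

section profile

variable {r z : ℝ → ℝ} {x : ℝ}

lemma hasDerivAt_prSpeed (hr : ContDiffAt ℝ 2 r x) (hz : ContDiffAt ℝ 2 z x)
    (hS : 0 < prSpeed r z x) : HasDerivAt (prSpeed r z)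
      ((deriv r x * deriv (deriv r) x + deriv z x * deriv (deriv z) x) / prSpeed r z x) x := by
  have h1 := (hasDerivAt_deriv_of_contDiffAt hr).2
  have h2 := (hasDerivAt_deriv_of_contDiffAt hz).2
  have := ((h1.pow 2).add (h2.pow 2)).sqrt (Real.sqrt_pos.1 hS).ne'
  refine this.congr_deriv ?_
  simp only [Pi.add_apply, Pi.pow_apply]
  rw [← prSpeed]
  field_simp
  ring

/-- If ψ is the angle of the profile tangent, then ψ' = k₂S, and r'/S = cos ψ, z'/S = sin ψ. -/
lemma hasDerivAt_cosAngle (hr : ContDiffAt ℝ 2 r x) (hz : ContDiffAt ℝ 2 z x)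
    (hS : 0 < prSpeed r z x) :
    HasDerivAt (fun x => deriv r x / prSpeed r z x) (-(deriv z x * prK2 r z x)) x := by
  have h1 := (hasDerivAt_deriv_of_contDiffAt hr).2
  refine (h1.div (hasDerivAt_prSpeed hr hz hS) hS.ne').congr_deriv ?_
  have := prSpeed_sq r z x
  rw [prK2]
  field_simp
  rw [this]
  ring

lemma hasDerivAt_sinAngle (hr : ContDiffAt ℝ 2 r x) (hz : ContDiffAt ℝ 2 z x)
    (hS : 0 < prSpeed r z x) :
    HasDerivAt (fun x => deriv z x / prSpeed r z x) (deriv r x * prK2 r z x) x := by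
  have h1 := (hasDerivAt_deriv_of_contDiffAt hz).2
  refine (h1.div (hasDerivAt_prSpeed hr hz hS) hS.ne').congr_deriv ?_
  have := prSpeed_sq r z x
  rw [prK2]
  field_simp
  rw [this]
  ring

/-- Since K r S = z' k₂, the Gauss curvature enters as an exact derivative, that of −r'/S by
`hasDerivAt_cosAngle`. It therefore acts only through the end points. -/
lemma prDens_eq_add {a c b : ℝ} (hr0 : 0 < r x) (hS : 0 < prSpeed r z x) :
    prDens a c b r z x = prDens a c 0 r z x + b * (deriv z x * prK2 r z x) := by
  have : deriv z x = prK1 r z x * (r x * prSpeed r z x) := by rw [prK1]; field_simp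
  rw [this, prDens, prDens]
  ring

/-- The hypotheses on a profile curve over a compact interval. -/
def GoodProfile (n : WithTop ℕ∞) (r z : ℝ → ℝ) (K : Set ℝ) : Prop :=
  ∀ x ∈ K, ContDiffAt ℝ n r x ∧ ContDiffAt ℝ n z x ∧ 0 < r x ∧ 0 < prSpeed r z x

lemma GoodProfile.of_le {m n : WithTop ℕ∞} {K : Set ℝ} (h : GoodProfile n r z K) (hmn : m ≤ n) :
    GoodProfile m r z K := fun x hx =>
  ⟨(h x hx).1.of_le hmn, (h x hx).2.1.of_le hmn, (h x hx).2.2⟩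

/-- The Gauss–Bonnet theorem for a surface of revolution. -/
lemma integral_prDens {a c b u v : ℝ} (h : GoodProfile 2 r z (uIcc u v)) :
    ∫ x in u..v, prDens a c b r z x = (∫ x in u..v, prDens a c 0 r z x) -
      b * (deriv r v / prSpeed r z v - deriv r u / prSpeed r z u) := by
  have hc0 : ContinuousOn (prDens a c 0 r z) (uIcc u v) := fun x hx =>
    (contDiffAt_prDens (m := 0) (h x hx).1 (h x hx).2.1 (by norm_num) (h x hx).2.2.1
      (h x hx).2.2.2).continuousAt.continuousWithinAt
  have hc1 : ContinuousOn (fun x => -(deriv z x * prK2 r z x)) (uIcc u v) := fun x hx => by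
    have i1 : ContDiffAt ℝ 1 (deriv z) x := (h x hx).2.1.derivWithin (by norm_num)
    have i2 := contDiffAt_prK2 (m := 0) (h x hx).1 (h x hx).2.1 (by norm_num) (h x hx).2.2.2
    exact (i1.continuousAt.mul i2.continuousAt).neg.continuousWithinAt
  rw [← intervalIntegral.integral_eq_sub_of_hasDerivAt (fun x hx => hasDerivAt_cosAngle
    (h x hx).1 (h x hx).2.1 (h x hx).2.2.2) hc1.intervalIntegrable,
    ← intervalIntegral.integral_const_mul, ← intervalIntegral.integral_sub hc0.intervalIntegrable
    (hc1.intervalIntegrable.const_mul b)]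
  apply intervalIntegral.integral_congr
  intro x hx
  simp only
  rw [prDens_eq_add (b := b) (h x hx).2.2.1 (h x hx).2.2.2]
  ring

lemma deriv_add_mul {φ : ℝ → ℝ} (hr : ContDiffAt ℝ 2 r x) (hφ : ContDiffAt ℝ 2 φ x) (t : ℝ) :
    deriv (fun y => r y + t * φ y) x = deriv r x + t * deriv φ x ∧
    deriv (deriv fun y => r y + t * φ y) x = deriv (deriv r) x + t * deriv (deriv φ) x := by
  obtain ⟨h1, h2⟩ := hasDerivAt_deriv_of_contDiffAt hr
  obtain ⟨h3, h4⟩ := hasDerivAt_deriv_of_contDiffAt hφ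
  have h5 : ∀ᶠ y in 𝓝 x, deriv (fun y => r y + t * φ y) y = deriv r y + t * deriv φ y := by
    filter_upwards [h1, h3] with y i1 i2 using (i1.add (i2.const_mul t)).deriv
  refine ⟨h5.self_of_nhds, ?_⟩
  rw [EventuallyEq.deriv_eq h5]
  exact (h2.add (h4.const_mul t)).deriv

/-- Profiles close to an admissible one are admissible. -/
lemma eventually_good_add {φ η : ℝ → ℝ} (hr : ContDiffAt ℝ 4 r x) (hz : ContDiffAt ℝ 4 z x)
    (hr0 : 0 < r x) (hS : 0 < prSpeed r z x) (hφ : ContDiffAt ℝ 4 φ x)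
    (hη : ContDiffAt ℝ 4 η x) : ∀ᶠ w in 𝓝 ((0 : ℝ), x),
      ContDiffAt ℝ 4 (fun y => r y + w.1 * φ y) w.2 ∧
      ContDiffAt ℝ 4 (fun y => z y + w.1 * η y) w.2 ∧ 0 < r w.2 + w.1 * φ w.2 ∧
      0 < prSpeed (fun y => r y + w.1 * φ y) (fun y => z y + w.1 * η y) w.2 := by
  have h4 : (2 : WithTop ℕ∞) ≤ 4 := by norm_num
  have hsnd : Tendsto (fun w : ℝ × ℝ => w.2) (𝓝 (0, x)) (𝓝 x) := continuousAt_snd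
  have e1 := hsnd.eventually (hr.eventually (by simp))
  have e2 := hsnd.eventually (hz.eventually (by simp))
  have e3 := hsnd.eventually (hφ.eventually (by simp))
  have e4 := hsnd.eventually (hη.eventually (by simp))
  have lift : ∀ {g : ℝ → ℝ}, ContinuousAt g x → ContinuousAt (fun w : ℝ × ℝ => g w.2) (0, x) :=
    fun hg => ContinuousAt.comp (x := ((0 : ℝ), x)) hg continuousAt_snd
  have hd : ∀ {g : ℝ → ℝ}, ContDiffAt ℝ 4 g x → ContinuousAt (deriv g) x := fun hg =>
    (hg.derivWithin (m := 3) (by norm_num)).continuousAt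
  have c1 : ContinuousAt (fun w : ℝ × ℝ => r w.2 + w.1 * φ w.2) (0, x) :=
    (lift hr.continuousAt).add (continuousAt_fst.mul (lift hφ.continuousAt))
  have c2 : ContinuousAt (fun w : ℝ × ℝ => (deriv r w.2 + w.1 * deriv φ w.2) ^ 2 +
      (deriv z w.2 + w.1 * deriv η w.2) ^ 2) (0, x) :=
    (((lift (hd hr)).add (continuousAt_fst.mul (lift (hd hφ)))).pow 2).add
      (((lift (hd hz)).add (continuousAt_fst.mul (lift (hd hη)))).pow 2)
  have e5 := c1.eventually (lt_mem_nhds (show 0 < r x + 0 * φ x by simpa using hr0))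
  have e6 := c2.eventually (lt_mem_nhds (show 0 < (deriv r x + 0 * deriv φ x) ^ 2 +
    (deriv z x + 0 * deriv η x) ^ 2 by simpa using Real.sqrt_pos.1 hS))
  filter_upwards [e1, e2, e3, e4, e5, e6] with w i1 i2 i3 i4 i5 i6
  refine ⟨i1.add (contDiffAt_const.mul i3), i2.add (contDiffAt_const.mul i4), i5, ?_⟩
  rw [prSpeed, (deriv_add_mul (i1.of_le h4) (i3.of_le h4) w.1).1,
    (deriv_add_mul (i2.of_le h4) (i4.of_le h4) w.1).1]
  exact Real.sqrt_pos.2 i6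

lemma GoodProfile.eventually_add {φ η : ℝ → ℝ} {K : Set ℝ} (hK : IsCompact K)
    (h : GoodProfile 4 r z K) (hφ : ∀ x ∈ K, ContDiffAt ℝ 4 φ x)
    (hη : ∀ x ∈ K, ContDiffAt ℝ 4 η x) :
    ∀ᶠ t in 𝓝 (0 : ℝ),
      GoodProfile 4 (fun y => r y + t * φ y) (fun y => z y + t * η y) K :=
  hK.eventually_forall_of_forall_eventually
    (P := fun t x => ContDiffAt ℝ 4 (fun y => r y + t * φ y) x ∧
      ContDiffAt ℝ 4 (fun y => z y + t * η y) x ∧ 0 < r x + t * φ x ∧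
      0 < prSpeed (fun y => r y + t * φ y) (fun y => z y + t * η y) x)
    fun x hx => eventually_good_add (h x hx).1 (h x hx).2.1 (h x hx).2.2.1 (h x hx).2.2.2
      (hφ x hx) (hη x hx)

lemma hasDerivAt_cosAngle_param {φ η : ℝ → ℝ} (hr : ContDiffAt ℝ 2 r x) (hz : ContDiffAt ℝ 2 z x)
    (hφ : ContDiffAt ℝ 2 φ x) (hη : ContDiffAt ℝ 2 η x) (hS : 0 < prSpeed r z x) :
    HasDerivAt (fun t => deriv (fun y => r y + t * φ y) x /
      prSpeed (fun y => r y + t * φ y) (fun y => z y + t * η y) x)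
      (-(deriv z x / prSpeed r z x * angVar r z φ η x)) 0 := by
  have hlin : ∀ x y : ℝ, HasDerivAt (fun t : ℝ => x + t * y) y 0 := by
    intro x y
    simpa using ((hasDerivAt_id (0 : ℝ)).mul_const y).const_add x
  simp only [prSpeed, (deriv_add_mul hr hφ _).1, (deriv_add_mul hz hη _).1]
  have hSq := prSpeed_sq r z x
  have hsqrt : Real.sqrt (deriv r x ^ 2 + deriv z x ^ 2) = prSpeed r z x := rfl
  have := (hlin (deriv r x) (deriv φ x)).div
    ((((hlin (deriv r x) (deriv φ x)).pow 2).add ((hlin (deriv z x) (deriv η x)).pow 2)).sqrt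
      (by simpa using (Real.sqrt_pos.1 hS).ne')) (by simpa [hsqrt] using hS.ne')
  refine this.congr_deriv ?_
  simp only [Pi.add_apply, Pi.pow_apply, zero_mul, add_zero, hsqrt, angVar]
  field_simp
  rw [hSq]
  push_cast
  ring

lemma contDiffAt_prH {m n : WithTop ℕ∞} {c : ℝ} (hr : ContDiffAt ℝ n r x)
    (hz : ContDiffAt ℝ n z x) (hmn : m + 1 + 1 ≤ n) (hr0 : 0 < r x) (hS : 0 < prSpeed r z x) :
    ContDiffAt ℝ m (prH c r z) x :=
  ((((contDiffAt_prK1 hr hz hmn hr0 hS).of_le le_self_add).add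
    (contDiffAt_prK2 hr hz hmn hS)).div_const 2).add contDiffAt_const

lemma contDiffAt_mom {a c : ℝ} (hr : ContDiffAt ℝ 4 r x) (hz : ContDiffAt ℝ 4 z x)
    (hr0 : 0 < r x) (hS : 0 < prSpeed r z x) :
    ContDiffAt ℝ 1 (momU a c r z) x ∧ ContDiffAt ℝ 1 (momW a c r z) x ∧
      ContDiffAt ℝ 1 (momZ a c r z) x := by
  have h := contDiffAt_prH (m := 2) (c := c) hr hz (by norm_num) hr0 hS
  have h' : ContDiffAt ℝ 1 (deriv (prH c r z)) x := h.derivWithin (by norm_num)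
  have h1 : ContDiffAt ℝ 1 (prH c r z) x := h.of_le (by norm_num)
  have k1 := contDiffAt_prK1 (m := 1) hr hz (by norm_num) hr0 hS
  have k2 := contDiffAt_prK2 (m := 1) hr hz (by norm_num) hS
  have hs := contDiffAt_prSpeed (m := 1) hr hz (by norm_num) hS
  have r0 : ContDiffAt ℝ 1 r x := hr.of_le (by norm_num)
  have r1 : ContDiffAt ℝ 1 (deriv r) x := hr.derivWithin (by norm_num)
  have z1 : ContDiffAt ℝ 1 (deriv z) x := hz.derivWithin (by norm_num)
  refine ⟨?_, ?_, ?_⟩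
  · exact contDiffAt_const.mul ((((h'.mul r0).mul z1).div (hs.pow 2) (by positivity)).add
      ((((r0.mul h1).mul (h1.sub k2)).mul r1).div hs hS.ne'))
  · exact contDiffAt_const.mul ((((h'.mul r0).mul r1).div (hs.pow 2) (by positivity)).neg.add
      ((((r0.mul h1).mul (h1.sub k2)).mul z1).div hs hS.ne'))
  · exact contDiffAt_const.mul ((h1.mul (h1.sub k1)).mul hs)

/-- The first variation of the energy of a piece of a surface of revolution. -/
lemma hasDerivAt_integral_prDens {a c b f x₁ : ℝ} {φ η : ℝ → ℝ}
    (h : GoodProfile 4 r z (uIcc f x₁)) (hφ : ContDiff ℝ 4 φ) (hη : ContDiff ℝ 4 η)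
    (hφf : φ =ᶠ[𝓝 f] 0) (hηf : η =ᶠ[𝓝 f] 0) :
    HasDerivAt (fun t => ∫ x in f..x₁,
      prDens a c b (fun y => r y + t * φ y) (fun y => z y + t * η y) x)
      ((∫ x in f..x₁, (momU a c r z x * deriv φ x + momW a c r z x * deriv η x +
        momZ a c r z x * φ x)) +
        (a * prH c r z x₁ * r x₁ + b * (deriv z x₁ / prSpeed r z x₁)) * angVar r z φ η x₁) 0 := by
  have h4 : (2 : WithTop ℕ∞) ≤ 4 := by norm_num
  have hφ2 : ∀ x, ContDiffAt ℝ 2 φ x := fun x => hφ.contDiffAt.of_le h4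
  have hη2 : ∀ x, ContDiffAt ℝ 2 η x := fun x => hη.contDiffAt.of_le h4
  have hφ1 : ContDiff ℝ 3 (deriv φ) := by
    apply ContDiff.deriv'; exact hφ.of_le (by norm_num)
  have hη1 : ContDiff ℝ 3 (deriv η) := by
    apply ContDiff.deriv'; exact hη.of_le (by norm_num)
  have hφ'' : ContDiff ℝ 2 (deriv (deriv φ)) := by
    apply ContDiff.deriv'; exact hφ1.of_le (by norm_num)
  have hη'' : ContDiff ℝ 2 (deriv (deriv η)) := by
    apply ContDiff.deriv'; exact hη1.of_le (by norm_num)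
  set Φ : ℝ → ℝ → ℝ := fun t x => densFn a c (r x + t * φ x) (deriv r x + t * deriv φ x)
    (deriv z x + t * deriv η x) (deriv (deriv r) x + t * deriv (deriv φ) x)
    (deriv (deriv z) x + t * deriv (deriv η) x) with hΦ
  have hΦeq : ∀ t, ∀ x ∈ uIcc f x₁,
      prDens a c 0 (fun y => r y + t * φ y) (fun y => z y + t * η y) x = Φ t x := by
    intro t x hx
    have i1 := deriv_add_mul ((h x hx).1.of_le h4) (hφ2 x) t
    have i2 := deriv_add_mul ((h x hx).2.1.of_le h4) (hη2 x) t
    rw [prDens_zero_eq, i1.1, i1.2, i2.1, i2.2]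
  have hΦs : ∀ x ∈ uIcc f x₁, ContDiffAt ℝ 1 (fun w : ℝ × ℝ => Φ w.1 w.2) (0, x) := by
    intro x hx
    obtain ⟨hr, hz, hr0, hS⟩ := h x hx
    have lift : ∀ {g : ℝ → ℝ}, ContDiffAt ℝ 1 g x →
        ContDiffAt ℝ 1 (fun w : ℝ × ℝ => g w.2) (0, x) :=
      fun hg => ContDiffAt.comp ((0 : ℝ), x) hg contDiffAt_snd
    have lin : ∀ {g k : ℝ → ℝ}, ContDiffAt ℝ 1 g x → ContDiffAt ℝ 1 k x →
        ContDiffAt ℝ 1 (fun w : ℝ × ℝ => g w.2 + w.1 * k w.2) (0, x) :=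
      fun hg hk => (lift hg).add (contDiffAt_fst.mul (lift hk))
    have r1 : ContDiffAt ℝ 3 (deriv r) x := hr.derivWithin (by norm_num)
    have z1 : ContDiffAt ℝ 3 (deriv z) x := hz.derivWithin (by norm_num)
    have r2 : ContDiffAt ℝ 2 (deriv (deriv r)) x := r1.derivWithin (by norm_num)
    have z2 : ContDiffAt ℝ 2 (deriv (deriv z)) x := z1.derivWithin (by norm_num)
    exact contDiffAt_densFn (lin (hr.of_le (by norm_num)) (hφ.contDiffAt.of_le (by norm_num)))
      (lin (r1.of_le (by norm_num)) (hφ1.contDiffAt.of_le (by norm_num)))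
      (lin (z1.of_le (by norm_num)) (hη1.contDiffAt.of_le (by norm_num)))
      (lin (r2.of_le (by norm_num)) (hφ''.contDiffAt.of_le (by norm_num)))
      (lin (z2.of_le (by norm_num)) (hη''.contDiffAt.of_le (by norm_num)))
      (by simpa using hr0) (by simpa using Real.sqrt_pos.1 hS)
  obtain ⟨_, hC⟩ := hasDerivAt_integral_param hΦs
  have hbulk := hC.self_of_nhds.1
  have hgood := h.eventually_add isCompact_uIcc (fun x _ => hφ.contDiffAt)
    (fun x _ => hη.contDiffAt)
  have hx₁ := h x₁ right_mem_uIcc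
  have hfm := h f left_mem_uIcc
  have hG := hasDerivAt_cosAngle_param (hx₁.1.of_le h4) (hx₁.2.1.of_le h4) (hφ2 x₁) (hη2 x₁)
    hx₁.2.2.2
  -- Gauss–Bonnet takes the b-term out of the integrand. Of its two end terms only the one at x₁
  -- varies, because φ and η vanish near f.
  have hFeq : (fun t => ∫ x in f..x₁,
      prDens a c b (fun y => r y + t * φ y) (fun y => z y + t * η y) x) =ᶠ[𝓝 0]
      fun t => (∫ x in f..x₁, Φ t x) - b * (deriv (fun y => r y + t * φ y) x₁ /
        prSpeed (fun y => r y + t * φ y) (fun y => z y + t * η y) x₁ -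
        deriv r f / prSpeed r z f) := by
    filter_upwards [hgood] with t ht
    rw [integral_prDens (ht.of_le h4), intervalIntegral.integral_congr (hΦeq t)]
    have i1 := (deriv_add_mul (hfm.1.of_le h4) (hφ2 f) t).1
    have i2 := (deriv_add_mul (hfm.2.1.of_le h4) (hη2 f) t).1
    have i3 : deriv φ f = 0 := by rw [hφf.deriv_eq]; simp
    have i4 : deriv η f = 0 := by rw [hηf.deriv_eq]; simp
    rw [i3, mul_zero, add_zero] at i1
    rw [i4, mul_zero, add_zero] at i2
    simp only [prSpeed, i1, i2]
  refine HasDerivAt.congr_of_eventuallyEq ?_ hFeq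
  refine (hbulk.sub ((hG.sub_const _).const_mul b)).congr_deriv ?_
  -- the bulk term
  have hω : ∀ x ∈ uIcc f x₁, HasDerivAt (angVar r z φ η)
      ((deriv r x * deriv (deriv η) x + deriv (deriv r) x * deriv η x -
        deriv z x * deriv (deriv φ) x - deriv (deriv z) x * deriv φ x) / prSpeed r z x ^ 2 -
      2 * (deriv r x * deriv η x - deriv z x * deriv φ x) *
        (deriv r x * deriv (deriv r) x + deriv z x * deriv (deriv z) x) /
        prSpeed r z x ^ 4) x := by
    intro x hx
    obtain ⟨hr, hz, hr0, hS⟩ := h x hx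
    have i1 := (hasDerivAt_deriv_of_contDiffAt (hr.of_le h4)).2
    have i2 := (hasDerivAt_deriv_of_contDiffAt (hz.of_le h4)).2
    have i3 := (hasDerivAt_deriv_of_contDiffAt (hφ2 x)).2
    have i4 := (hasDerivAt_deriv_of_contDiffAt (hη2 x)).2
    have i5 := hasDerivAt_prSpeed (hr.of_le h4) (hz.of_le h4) hS
    refine (((i1.mul i4).sub (i2.mul i3)).div (i5.pow 2) (pow_pos hS 2).ne').congr_deriv ?_
    simp only [Pi.mul_apply, Pi.sub_apply, Pi.pow_apply]
    field_simp
    push_cast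
    ring
  have hHr : ∀ x ∈ uIcc f x₁, HasDerivAt (fun x => prH c r z x * r x)
      (deriv (prH c r z) x * r x + prH c r z x * deriv r x) x := by
    intro x hx
    obtain ⟨hr, hz, hr0, hS⟩ := h x hx
    have i1 := ((contDiffAt_prH (m := 2) (c := c) hr hz (by norm_num) hr0 hS).differentiableAt
      (by simp)).hasDerivAt
    exact i1.mul (hr.differentiableAt (by simp)).hasDerivAt
  -- The terms containing the rotation ω are written as the exact derivative of a h r ω minus a h' r
  -- ω. The latter, joined with the stretch terms, produces the fluxes `momU` and `momW`; the exact
  -- part becomes an end term at x₁.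
  have hdΦ : ∀ x ∈ uIcc f x₁, deriv (fun t => Φ t x) 0 =
      (momU a c r z x * deriv φ x + momW a c r z x * deriv η x + momZ a c r z x * φ x) +
      a * ((deriv (prH c r z) x * r x + prH c r z x * deriv r x) * angVar r z φ η x +
        prH c r z x * r x * deriv (angVar r z φ η) x) := by
    intro x hx
    obtain ⟨hr, hz, hr0, hS⟩ := h x hx
    rw [(hasDerivAt_densFn hr0 hS (prSpeed_sq r z x) rfl rfl rfl rfl rfl rfl).deriv]
    rw [(hω x hx).deriv]
    simp only [momU, momW, momZ, angVar, prH]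
    rw [← prK1, ← prK2]
    field_simp
    ring
  have hcU : ∀ {g : ℝ → ℝ}, (∀ x ∈ uIcc f x₁, ContDiffAt ℝ 1 g x) → ContinuousOn g (uIcc f x₁) :=
    fun hg x hx => (hg x hx).continuousAt.continuousWithinAt
  have hmom := fun x hx => contDiffAt_mom (a := a) (c := c) (h x hx).1 (h x hx).2.1
    (h x hx).2.2.1 (h x hx).2.2.2
  have cU := hcU fun x hx => (hmom x hx).1
  have cW := hcU fun x hx => (hmom x hx).2.1
  have cZ := hcU fun x hx => (hmom x hx).2.2
  have cω : ∀ x ∈ uIcc f x₁, ContDiffAt ℝ 2 (angVar r z φ η) x := by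
    intro x hx
    obtain ⟨hr, hz, hr0, hS⟩ := h x hx
    have r1 : ContDiffAt ℝ 2 (deriv r) x := hr.derivWithin (by norm_num)
    have z1 : ContDiffAt ℝ 2 (deriv z) x := hz.derivWithin (by norm_num)
    have hs := contDiffAt_prSpeed (m := 2) hr hz (by norm_num) hS
    exact ((r1.mul (hη1.contDiffAt.of_le (by norm_num))).sub
      (z1.mul (hφ1.contDiffAt.of_le (by norm_num)))).div (hs.pow 2) (by positivity)
  have cω' := hcU fun x hx => (cω x hx).derivWithin (m := 1) (by norm_num)
  have cωc := hcU fun x hx => (cω x hx).of_le (by norm_num)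
  have cH := hcU fun x hx => (contDiffAt_prH (m := 2) (c := c) (h x hx).1 (h x hx).2.1
    (by norm_num) (h x hx).2.2.1 (h x hx).2.2.2).of_le (by norm_num)
  have cH' := hcU fun x hx => (contDiffAt_prH (m := 2) (c := c) (h x hx).1 (h x hx).2.1
    (by norm_num) (h x hx).2.2.1 (h x hx).2.2.2).derivWithin (m := 1) (by norm_num)
  have cr := hcU fun x hx => (h x hx).1.of_le (by norm_num)
  have cr' := hcU fun x hx => (h x hx).1.derivWithin (m := 1) (by norm_num)
  have cA : ContinuousOn (fun x => deriv (prH c r z) x * r x + prH c r z x * deriv r x)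
      (uIcc f x₁) := (cH'.mul cr).add (cH.mul cr')
  have hparts := intervalIntegral.integral_deriv_mul_eq_sub (fun x hx => hHr x hx)
    (fun x hx => ((cω x hx).differentiableAt (by simp)).hasDerivAt) cA.intervalIntegrable
    cω'.intervalIntegrable
  have hωf : angVar r z φ η f = 0 := by
    simp only [angVar]
    rw [hφf.deriv_eq, hηf.deriv_eq]
    simp
  rw [hωf, mul_zero, sub_zero] at hparts
  have i1 : IntervalIntegrable (fun x => momU a c r z x * deriv φ x + momW a c r z x * deriv η x +
      momZ a c r z x * φ x) volume f x₁ :=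
    (((cU.mul hφ1.continuous.continuousOn).add (cW.mul hη1.continuous.continuousOn)).add
      (cZ.mul hφ.continuous.continuousOn)).intervalIntegrable
  have i2 : IntervalIntegrable (fun x => a * ((deriv (prH c r z) x * r x + prH c r z x * deriv r x)
      * angVar r z φ η x + prH c r z x * r x * deriv (angVar r z φ η) x)) volume f x₁ :=
    (((cA.mul cωc).add ((cH.mul cr).mul cω')).intervalIntegrable).const_mul a
  rw [intervalIntegral.integral_congr hdΦ, intervalIntegral.integral_add i1 i2,
    intervalIntegral.integral_const_mul, hparts]
  ring

end profile

/-! ### Consequences of criticality near a boundary component -/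

section critical

variable {a c b α β : ℝ} {τ : SurfaceType} {X : ℝ × ℝ → Fin 3 → ℝ} {q : Fin 3 → ℝ}
  {e : Fin 3 → Fin 3 → ℝ} {r z : ℝ → ℝ} {s f : ℝ}

/-- The nonpositive product marks the side of f away from the boundary circle, for outer and inner
circles alike. Test functions are required to vanish near that side. -/
lemma IsCollar.outside (hc : IsCollar τ s f) {p : ℝ × ℝ} (hp : p ∈ domain τ)
    (h : rad p ∉ uIcc f |s| ∨ rad p = f) : (|s| - f) * (rad p - f) ≤ 0 := by
  have key : ∀ x₁ : ℝ, f < x₁ → rad p ≤ x₁ → (rad p ∉ uIcc f x₁ ∨ rad p = f) → rad p ≤ f := by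
    intro x₁ h1 h2 h3
    rcases h3 with h3 | h3
    · rw [uIcc_of_le h1.le] at h3
      by_contra hcon
      exact h3 ⟨(not_le.1 hcon).le, h2⟩
    · exact h3.le
  cases τ
  · obtain ⟨rfl, h1, h2⟩ := hc
    rw [abs_one] at *
    exact mul_nonpos_of_nonneg_of_nonpos (by linarith)
      (by linarith [key 1 h2 (mem_disc_iff.1 hp) h])
  · obtain ⟨rfl | rfl, h1, h2⟩ := hc
    · rw [abs_of_pos (two_pos : (0 : ℝ) < 2)] at *
      exact mul_nonpos_of_nonneg_of_nonpos (by linarith)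
        (by linarith [key 2 h2 (mem_annulus_iff.1 hp).2 h])
    · rw [abs_neg, abs_one] at *
      apply mul_nonpos_of_nonpos_of_nonneg (by linarith)
      rcases h with h | h
      · rw [uIcc_of_ge h1.le] at h
        by_contra hcon
        exact h ⟨(mem_annulus_iff.1 hp).1, by linarith⟩
      · linarith

lemma IsCollar.eventually_of_rad_zero (hc : IsCollar τ s f) {p : ℝ × ℝ} (hp : p ∈ domain τ)
    (h : ¬ 0 < rad p) : (|s| - f) * (rad p - f) ≤ 0 := by
  have h0 : rad p = 0 := le_antisymm (not_lt.1 h) (Real.sqrt_nonneg _)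
  cases τ
  · obtain ⟨rfl, h1, h2⟩ := hc
    rw [abs_one, h0]
    exact mul_nonpos_of_nonneg_of_nonpos (by linarith) (by linarith)
  · have := (mem_annulus_iff.1 hp).1
    linarith

lemma IsProfile.good (h : IsProfile τ X q e r z) : GoodProfile 4 r z (radii τ) := fun x hx =>
  ⟨h.smooth_r x hx, h.smooth_z x hx, h.pos x hx, h.speed_pos x hx⟩

lemma GoodProfile.mono {n : WithTop ℕ∞} {K L : Set ℝ} (h : GoodProfile n r z L) (hKL : K ⊆ L) :
    GoodProfile n r z K := fun x hx => h x (hKL hx)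

lemma revol_eventuallyEq_zero {φ η : ℝ → ℝ} {p : ℝ × ℝ} (hφ : φ =ᶠ[𝓝 (rad p)] 0)
    (hη : η =ᶠ[𝓝 (rad p)] 0) : revol 0 e φ η =ᶠ[𝓝 p] 0 := by
  have hc : Tendsto rad (𝓝 p) (𝓝 (rad p)) := continuous_rad.continuousAt
  filter_upwards [hc.eventually hφ, hc.eventually hη] with p' h1 h2
  have h1' : φ (Real.sqrt (p'.1 ^ 2 + p'.2 ^ 2)) = 0 := h1
  have h2' : η (Real.sqrt (p'.1 ^ 2 + p'.2 ^ 2)) = 0 := h2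
  simp [revol, sqSurf, h1', h2']

/-- The variation field is itself a surface of revolution centred at 0. Adding t times it replaces
the profile on the collar by (r + tφ, z + tη) and leaves `X` unchanged elsewhere, in particular near
the axis of a disc. -/
lemma IsProfile.first_variation (h : IsProfile τ X q e r z) (hX : IsC4Immersion τ X)
    (hcrit : IsCritical a c b α β τ X) (hc : IsCollar τ s f) {φ η : ℝ → ℝ} (hφ : ContDiff ℝ 4 φ)
    (hη : ContDiff ℝ 4 η) (hφ0 : ∀ x, (|s| - f) * (x - f) ≤ 0 → φ =ᶠ[𝓝 x] 0)
    (hη0 : ∀ x, (|s| - f) * (x - f) ≤ 0 → η =ᶠ[𝓝 x] 0) :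
    s / |s| * ((∫ x in f..|s|, (momU a (frameDet e * c) r z x * deriv φ x +
      momW a (frameDet e * c) r z x * deriv η x + momZ a (frameDet e * c) r z x * φ x)) +
      (a * prH (frameDet e * c) r z |s| * r |s| + b * (deriv z |s| / prSpeed r z |s|)) *
        angVar r z φ η |s|) + (β - α / r |s| ^ 2) * φ |s| = 0 := by
  have hgood := h.good.mono hc.uIcc_subset
  have hV : ∀ p ∈ domain τ, ContDiffAt ℝ 4 (revol 0 e φ η) p := by
    intro p hp
    by_cases h0 : 0 < rad p
    · exact contDiffAt_revol h0 hφ.contDiffAt hη.contDiffAt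
    · have h1 := hc.eventually_of_rad_zero hp h0
      exact (contDiffAt_const (c := (0 : Fin 3 → ℝ))).congr_of_eventuallyEq
        (revol_eventuallyEq_zero (hφ0 _ h1) (hη0 _ h1))
  have hd := hcrit _ hV
  obtain ⟨K, hK⟩ := energy_eq_of_collar (a := a) (c := c) (b := b) (α := α) (β := β) hX hc
  have hff : (|s| - f) * (f - f) ≤ 0 := by simp
  have hev := hgood.eventually_add isCompact_uIcc (fun x _ => hφ.contDiffAt)
    (fun x _ => hη.contDiffAt)
  have hE : (fun t : ℝ => energy a c b α β τ (fun p => X p + t • revol 0 e φ η p)) =ᶠ[𝓝 0]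
      fun t => K + 2 * Real.pi * (s / |s| * (∫ x in f..|s|, prDens a (frameDet e * c) b
        (fun y => r y + t * φ y) (fun y => z y + t * η y) x) +
        (α / (r |s| + t * φ |s|) + β * (r |s| + t * φ |s|))) := by
    filter_upwards [hev] with t ht
    refine hK q e (fun y => r y + t * φ y) (fun y => z y + t * η y) _ h.frame
      (ht.of_le (by norm_num)) ?_ ?_
    · intro p hp hp'
      have h1 := hc.outside hp hp'
      filter_upwards [revol_eventuallyEq_zero (e := e) (hφ0 _ h1) (hη0 _ h1)] with p' h2
      rw [h2]; simp
    · intro p hp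
      have h1 := hc.uIcc_subset hp
      rw [h.eq_revol p (mem_domain_of_radii h1) (radii_pos h1)]
      simp only [revol, sqSurf]
      module
  have hI := hasDerivAt_integral_prDens (a := a) (c := frameDet e * c) (b := b) hgood hφ hη
    (hφ0 f hff) (hη0 f hff)
  have hr1 : 0 < r |s| := (hgood |s| right_mem_uIcc).2.2.1
  have hlin : HasDerivAt (fun t : ℝ => r |s| + t * φ |s|) (φ |s|) 0 := by
    simpa using ((hasDerivAt_id (0 : ℝ)).mul_const (φ |s|)).const_add (r |s|)
  have hB : HasDerivAt (fun t : ℝ => α / (r |s| + t * φ |s|) + β * (r |s| + t * φ |s|))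
      ((β - α / r |s| ^ 2) * φ |s|) 0 := by
    refine (((hasDerivAt_const (0 : ℝ) α).div hlin (by simpa using hr1.ne')).add
      (hlin.const_mul β)).congr_deriv ?_
    simp only [zero_mul, add_zero, zero_sub]
    field_simp
    ring
  have hfin := (((hI.const_mul (s / |s|)).add hB).const_mul (2 * Real.pi)).const_add K
  have h0 := (hd.congr_of_eventuallyEq hE.symm).unique hfin
  have hpi := Real.pi_pos
  rcases mul_eq_zero.1 h0.symm with h1 | h1
  · exfalso; linarith
  · exact h1

lemma stronglyMeasurableAtFilter_of_contDiffAt {g : ℝ → ℝ} {x : ℝ} (hg : ContDiffAt ℝ 1 g x) :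
    StronglyMeasurableAtFilter g (𝓝 x) := by
  have h1 : ∀ᶠ y in 𝓝 x, ContinuousAt g y := by
    filter_upwards [hg.eventually (by simp)] with y hy using hy.continuousAt
  obtain ⟨t, ht, hto, hxt⟩ := eventually_nhds_iff.1 h1
  exact ContinuousAt.stronglyMeasurableAtFilter hto ht x hxt

/-- The Euler–Lagrange equations in integrated form and the natural boundary conditions. -/
lemma IsProfile.euler_lagrange (h : IsProfile τ X q e r z) (hX : IsC4Immersion τ X)
    (hcrit : IsCritical a c b α β τ X) (hc : IsCollar τ s f) :
    (∀ x ∈ uIcc f |s|, momW a (frameDet e * c) r z x = 0) ∧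
    a * prH (frameDet e * c) r z |s| * r |s| + b * (deriv z |s| / prSpeed r z |s|) = 0 ∧
    ∀ x ∈ uIcc f |s|, momU a (frameDet e * c) r z x +
      (∫ y in x..|s|, momZ a (frameDet e * c) r z y) + s / |s| * (β - α / r |s| ^ 2) = 0 := by
  obtain ⟨hf0, hfs, hs0⟩ := hc.cases
  have hne : f ≠ |s| := by
    rcases hfs with h1 | h1
    · exact h1.2.ne
    · exact h1.2.ne'
  set c' := frameDet e * c with hc'
  have hgood := h.good.mono hc.uIcc_subset
  have hmom := fun x hx => contDiffAt_mom (a := a) (c := c') (hgood x hx).1 (hgood x hx).2.1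
    (hgood x hx).2.2.1 (hgood x hx).2.2.2
  have hς : s / |s| * (s / |s|) = 1 := by rw [← sq]; exact sign_sq (abs_pos.1 hs0)
  have hςne : s / |s| ≠ 0 := left_ne_zero_of_mul_eq_one hς
  have hcU : ∀ {g : ℝ → ℝ}, (∀ x ∈ uIcc f |s|, ContDiffAt ℝ 1 g x) →
      ContinuousOn g (uIcc f |s|) := fun hg x hx => (hg x hx).continuousAt.continuousWithinAt
  have cU := hcU fun x hx => (hmom x hx).1
  have cW := hcU fun x hx => (hmom x hx).2.1
  have cZ := hcU fun x hx => (hmom x hx).2.2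
  -- primitives of test functions
  have hprim : ∀ g : ℝ → ℝ, ContDiff ℝ 4 g → tsupport g ⊆ {x | 0 < (|s| - f) * (x - f)} →
      ContDiff ℝ 4 (fun x => ∫ y in f..x, g y) ∧ (∀ x, deriv (fun x => ∫ y in f..x, g y) x = g x) ∧
      ∀ x, (|s| - f) * (x - f) ≤ 0 → (fun x => ∫ y in f..x, g y) =ᶠ[𝓝 x] 0 := by
    intro g hg hgs
    have hder : ∀ x, HasDerivAt (fun x => ∫ y in f..x, g y) (g x) x := fun x =>
      intervalIntegral.integral_hasDerivAt_right (hg.continuous.intervalIntegrable _ _)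
        hg.continuous.stronglyMeasurable.stronglyMeasurableAtFilter hg.continuous.continuousAt
    have hder' : deriv (fun x => ∫ y in f..x, g y) = g := funext fun x => (hder x).deriv
    refine ⟨?_, fun x => (hder x).deriv, ?_⟩
    · have : ContDiff ℝ (4 + 1) (fun x => ∫ y in f..x, g y) := by
        rw [contDiff_succ_iff_deriv]
        refine ⟨fun x => (hder x).differentiableAt, by simp, by rwa [hder']⟩
      exact this.of_le (by norm_num)
    · intro x hx
      have hzero : ∀ y, y ∉ tsupport g → g y = 0 := fun y hy => image_eq_zero_of_notMem_tsupport hy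
      have hwrong : ∀ y, (|s| - f) * (y - f) ≤ 0 → ∫ u in f..y, g u = 0 := by
        intro y hy
        rw [intervalIntegral.integral_congr (g := fun _ => 0)]
        · simp
        · intro u hu
          apply hzero
          intro hu'
          have h1 : 0 < (|s| - f) * (u - f) := hgs hu'
          rcases lt_or_gt_of_ne hne with h3 | h3
          · have h4 : y - f ≤ 0 := nonpos_of_mul_nonpos_right hy (by linarith)
            have h5 : 0 < u - f := pos_of_mul_pos_right h1 (by linarith)
            rcases mem_uIcc.1 hu with h2 | h2 <;> linarith
          · have h4 : 0 ≤ y - f := nonneg_of_mul_nonpos_right hy (by linarith)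
            have h5 : u - f < 0 := neg_of_mul_pos_right h1 (by linarith)
            rcases mem_uIcc.1 hu with h2 | h2 <;> linarith
      have hxn : x ∉ tsupport g := fun hx' => absurd (hgs hx') (not_lt.2 hx)
      have hopen : (tsupport g)ᶜ ∈ 𝓝 x := (isClosed_tsupport g).isOpen_compl.mem_nhds hxn
      obtain ⟨ε, hε, hball⟩ := Metric.mem_nhds_iff.1 hopen
      filter_upwards [Metric.ball_mem_nhds x hε] with y hy
      have h1 : ∫ u in f..y, g u = (∫ u in f..x, g u) + ∫ u in x..y, g u :=
        (intervalIntegral.integral_add_adjacent_intervals (hg.continuous.intervalIntegrable _ _)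
          (hg.continuous.intervalIntegrable _ _)).symm
      rw [h1, hwrong x hx, zero_add, intervalIntegral.integral_congr (g := fun _ => 0)]
      · simp
      · intro u hu
        apply hzero
        have : uIcc x y ⊆ Metric.ball x ε := by
          rw [Real.ball_eq_Ioo] at hy ⊢
          exact ordConnected_Ioo.uIcc_subset ⟨by linarith, by linarith⟩ hy
        exact hball (this hu)
  have hzero : ∀ x, (|s| - f) * (x - f) ≤ 0 → (fun _ : ℝ => (0 : ℝ)) =ᶠ[𝓝 x] 0 := fun x _ =>
    EventuallyEq.rfl
  set k := a * prH c' r z |s| * r |s| + b * (deriv z |s| / prSpeed r z |s|) with hk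
  have hS := (hgood |s| right_mem_uIcc).2.2.2
  -- axial variations
  obtain ⟨hW, hkr⟩ := eq_zero_of_integral_add_eq_zero hne cW
    (k := k * (deriv r |s| / prSpeed r z |s| ^ 2)) (by
      intro g hg hgs
      obtain ⟨i1, i2, i3⟩ := hprim g hg hgs
      -- The energy is invariant under axial translation, so η enters only through its derivative g.
      -- Since g is arbitrary and the end is free, the axial flux itself vanishes rather than being
      -- merely constant.
      have := h.first_variation hX hcrit hc contDiff_const i1 hzero i3
      simp only [i2, angVar, deriv_const, mul_zero, zero_add, add_zero, sub_zero] at this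
      have h2 := (mul_eq_zero.1 this).resolve_left hςne
      rw [← h2, ← hk]
      ring)
  -- radial variations
  set Zp : ℝ → ℝ := fun x => ∫ y in x..|s|, momZ a c' r z y with hZp
  have hZd : ∀ x ∈ uIcc f |s|, HasDerivAt Zp (-momZ a c' r z x) x := by
    intro x hx
    apply intervalIntegral.integral_hasDerivAt_left
    · exact (cZ.mono (uIcc_subset_uIcc hx right_mem_uIcc)).intervalIntegrable
    · exact stronglyMeasurableAtFilter_of_contDiffAt (hmom x hx).2.2
    · exact (hmom x hx).2.2.continuousAt
  have cZp : ContinuousOn Zp (uIcc f |s|) := fun x hx =>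
    (hZd x hx).continuousAt.continuousWithinAt
  obtain ⟨hU, hkz⟩ := eq_zero_of_integral_add_eq_zero hne
    (Y := fun x => momU a c' r z x + Zp x + s / |s| * (β - α / r |s| ^ 2))
    ((cU.add cZp).add continuousOn_const) (k := k * (-deriv z |s| / prSpeed r z |s| ^ 2)) (by
      intro g hg hgs
      obtain ⟨i1, i2, i3⟩ := hprim g hg hgs
      have h1 := h.first_variation hX hcrit hc i1 contDiff_const i3 hzero
      set φ : ℝ → ℝ := fun x => ∫ y in f..x, g y with hφ
      simp only [i2, angVar, deriv_const, mul_zero, add_zero, zero_sub, ← hc', ← hk] at h1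
      have hφf : φ f = 0 := intervalIntegral.integral_same
      have hZs : Zp |s| = 0 := intervalIntegral.integral_same
      have hφd : ∀ x, HasDerivAt φ (g x) x := fun x => by
        rw [← i2 x]; exact (i1.differentiable (by simp) x).hasDerivAt
      -- This trades φ for its derivative g in the `momZ` term. No end terms arise because `Zp`
      -- vanishes at |s| and φ at f.
      have hparts := intervalIntegral.integral_mul_deriv_eq_deriv_mul (u := Zp) (v := φ) hZd
        (fun x _ => hφd x) cZ.neg.intervalIntegrable (hg.continuous.intervalIntegrable _ _)
      rw [hφf, hZs] at hparts
      have hφs : φ |s| = ∫ x in f..|s|, g x := rfl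
      have j1 : IntervalIntegrable (fun x => momU a c' r z x * g x) volume f |s| :=
        (cU.mul hg.continuous.continuousOn).intervalIntegrable
      have j2 : IntervalIntegrable (fun x => momZ a c' r z x * φ x) volume f |s| :=
        (cZ.mul i1.continuous.continuousOn).intervalIntegrable
      have j3 : IntervalIntegrable (fun x => Zp x * g x) volume f |s| :=
        (cZp.mul hg.continuous.continuousOn).intervalIntegrable
      have j4 : IntervalIntegrable (fun x => s / |s| * (β - α / r |s| ^ 2) * g x) volume f |s| :=
        (hg.continuous.intervalIntegrable _ _).const_mul _
      have hsplit : ∫ x in f..|s|, (momU a c' r z x + Zp x + s / |s| * (β - α / r |s| ^ 2)) * g x =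
          (∫ x in f..|s|, momU a c' r z x * g x) + (∫ x in f..|s|, Zp x * g x) +
            s / |s| * (β - α / r |s| ^ 2) * φ |s| := by
        rw [hφs, ← intervalIntegral.integral_const_mul, ← intervalIntegral.integral_add j1 j3,
          ← intervalIntegral.integral_add (j1.add j3) j4]
        congr 1
        ext1 x
        ring
      have hneg : ∫ x in f..|s|, -momZ a c' r z x * φ x =
          -∫ x in f..|s|, momZ a c' r z x * φ x := by
        rw [← intervalIntegral.integral_neg]
        congr 1
        ext1 x
        ring
      rw [intervalIntegral.integral_add j1 j2] at h1
      rw [hneg] at hparts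
      rw [hsplit, hparts]
      linear_combination (s / |s|) * h1 - ((∫ x in f..|s|, momU a c' r z x * g x) +
        (∫ x in f..|s|, momZ a c' r z x * φ x) +
        k * (-(deriv z |s| * g |s|) / prSpeed r z |s| ^ 2)) * hς)
  refine ⟨hW, ?_, hU⟩
  have hSq := prSpeed_sq r z |s|
  have hSne : prSpeed r z |s| ^ 2 ≠ 0 := by positivity
  -- The axial and radial tests each annihilate k times one component of the tangent; since the
  -- tangent is nonzero, k = 0.
  have h1 : k * deriv r |s| = 0 := by
    have : k * deriv r |s| = k * (deriv r |s| / prSpeed r z |s| ^ 2) * prSpeed r z |s| ^ 2 := by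
      field_simp
    rw [this, hkr, zero_mul]
  have h2 : k * deriv z |s| = 0 := by
    have : k * deriv z |s| = -(k * (-deriv z |s| / prSpeed r z |s| ^ 2) * prSpeed r z |s| ^ 2) := by
      field_simp
    rw [this, hkz, zero_mul, neg_zero]
  have h3 : k * prSpeed r z |s| ^ 2 = 0 := by
    rw [hSq]; linear_combination deriv r |s| * h1 + deriv z |s| * h2
  exact (mul_eq_zero.1 h3).resolve_right hSne

end critical

/-! ### Reparametrized profiles -/

section comp

variable {r z g : ℝ → ℝ} {x : ℝ}

lemma deriv_comp_profile (hr : ContDiffAt ℝ 2 r (g x)) (hg : ContDiffAt ℝ 2 g x) :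
    deriv (fun y => r (g y)) x = deriv r (g x) * deriv g x ∧
    deriv (deriv fun y => r (g y)) x =
      deriv (deriv r) (g x) * deriv g x ^ 2 + deriv r (g x) * deriv (deriv g) x := by
  obtain ⟨h1, h2⟩ := hasDerivAt_deriv_of_contDiffAt hr
  obtain ⟨h3, h4⟩ := hasDerivAt_deriv_of_contDiffAt hg
  have h5 : ∀ᶠ y in 𝓝 x, deriv (fun y => r (g y)) y = deriv r (g y) * deriv g y := by
    filter_upwards [hg.continuousAt.eventually h1, h3] with y i1 i2
    exact (HasDerivAt.comp (h₂ := r) y i1 i2).deriv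
  refine ⟨h5.self_of_nhds, ?_⟩
  rw [EventuallyEq.deriv_eq h5]
  have h6 : HasDerivAt (fun y => deriv r (g y)) (deriv (deriv r) (g x) * deriv g x) x :=
    HasDerivAt.comp (h₂ := deriv r) x h2 h3.self_of_nhds
  refine (h6.mul h4).deriv.trans ?_
  ring

lemma prSpeed_comp (hr : ContDiffAt ℝ 2 r (g x)) (hz : ContDiffAt ℝ 2 z (g x))
    (hg : ContDiffAt ℝ 2 g x) (hg0 : 0 < deriv g x) :
    prSpeed (fun y => r (g y)) (fun y => z (g y)) x = prSpeed r z (g x) * deriv g x := by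
  rw [prSpeed, (deriv_comp_profile hr hg).1, (deriv_comp_profile hz hg).1, prSpeed,
    ← Real.sqrt_sq hg0.le, ← Real.sqrt_mul (by positivity), Real.sqrt_sq hg0.le]
  congr 1
  ring

lemma curvatures_comp (hr : ContDiffAt ℝ 2 r (g x)) (hz : ContDiffAt ℝ 2 z (g x))
    (hg : ContDiffAt ℝ 2 g x) (hg0 : 0 < deriv g x) (hr0 : 0 < r (g x))
    (hS : 0 < prSpeed r z (g x)) :
    prK1 (fun y => r (g y)) (fun y => z (g y)) x = prK1 r z (g x) ∧
    prK2 (fun y => r (g y)) (fun y => z (g y)) x = prK2 r z (g x) := by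
  constructor
  · rw [prK1, prSpeed_comp hr hz hg hg0, (deriv_comp_profile hz hg).1, prK1]
    field_simp
  · rw [prK2, prSpeed_comp hr hz hg hg0, (deriv_comp_profile hz hg).1,
      (deriv_comp_profile hz hg).2, (deriv_comp_profile hr hg).1, (deriv_comp_profile hr hg).2, prK2]
    field_simp
    ring

lemma prDens_comp {a c b : ℝ} (hr : ContDiffAt ℝ 2 r (g x)) (hz : ContDiffAt ℝ 2 z (g x))
    (hg : ContDiffAt ℝ 2 g x) (hg0 : 0 < deriv g x) (hr0 : 0 < r (g x))
    (hS : 0 < prSpeed r z (g x)) :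
    prDens a c b (fun y => r (g y)) (fun y => z (g y)) x = prDens a c b r z (g x) * deriv g x := by
  obtain ⟨h1, h2⟩ := curvatures_comp hr hz hg hg0 hr0 hS
  rw [prDens, h1, h2, prSpeed_comp hr hz hg hg0, prDens]
  ring

/-- Reparametrizing a perturbed profile by a map close to the identity. -/
lemma GoodProfile.eventually_comp {φ η χ : ℝ → ℝ} {K : Set ℝ} (hK : IsCompact K)
    (h : GoodProfile 4 r z K) (hφ : ∀ x ∈ K, ContDiffAt ℝ 4 φ x)
    (hη : ∀ x ∈ K, ContDiffAt ℝ 4 η x) (hχ : ContDiff ℝ 4 χ) :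
    ∀ᶠ t in 𝓝 (0 : ℝ), ∀ x ∈ K,
      (ContDiffAt ℝ 4 (fun y => r y + t * φ y) (x + t * χ x) ∧
      ContDiffAt ℝ 4 (fun y => z y + t * η y) (x + t * χ x) ∧
      0 < r (x + t * χ x) + t * φ (x + t * χ x) ∧
      0 < prSpeed (fun y => r y + t * φ y) (fun y => z y + t * η y) (x + t * χ x)) ∧
      0 < deriv (fun y => y + t * χ y) x := by
  apply hK.eventually_forall_of_forall_eventually (P := fun t x =>
    (ContDiffAt ℝ 4 (fun y => r y + t * φ y) (x + t * χ x) ∧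
      ContDiffAt ℝ 4 (fun y => z y + t * η y) (x + t * χ x) ∧
      0 < r (x + t * χ x) + t * φ (x + t * χ x) ∧
      0 < prSpeed (fun y => r y + t * φ y) (fun y => z y + t * η y) (x + t * χ x)) ∧
      0 < deriv (fun y => y + t * χ y) x)
  intro x hx
  obtain ⟨hr, hz, hr0, hS⟩ := h x hx
  have h1 := eventually_good_add hr hz hr0 hS (hφ x hx) (hη x hx)
  have hc := hχ.continuous
  have h2 : Tendsto (fun w : ℝ × ℝ => (w.1, w.2 + w.1 * χ w.2)) (𝓝 (0, x)) (𝓝 (0, x)) := by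
    have : ContinuousAt (fun w : ℝ × ℝ => (w.1, w.2 + w.1 * χ w.2)) (0, x) := by fun_prop
    simpa [ContinuousAt] using this
  have hd : ∀ t y : ℝ, deriv (fun y => y + t * χ y) y = 1 + t * deriv χ y := fun t y =>
    ((hasDerivAt_id y).add ((hχ.differentiable (by simp) y).hasDerivAt.const_mul t)).deriv
  have hc1 : Continuous (deriv χ) := hχ.continuous_deriv (by norm_num)
  have h3 : ContinuousAt (fun w : ℝ × ℝ => 1 + w.1 * deriv χ w.2) (0, x) := by fun_prop
  have h4 := h3.eventually (lt_mem_nhds (show 0 < 1 + 0 * deriv χ x by simp))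
  filter_upwards [h2.eventually h1, h4] with w i1 i2
  exact ⟨i1, by rw [hd]; exact i2⟩

end comp

/-- Joint regularity of a family of surfaces of revolution. -/
lemma contDiffAt_revol_param {n : WithTop ℕ∞} {q : Fin 3 → ℝ} {e : Fin 3 → Fin 3 → ℝ}
    {ψ₁ ψ₂ : ℝ → ℝ → ℝ} {p : ℝ × ℝ} (hp : 0 < rad p)
    (h₁ : ContDiffAt ℝ n (fun w : ℝ × ℝ => ψ₁ w.1 w.2) (0, rad p))
    (h₂ : ContDiffAt ℝ n (fun w : ℝ × ℝ => ψ₂ w.1 w.2) (0, rad p)) :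
    ContDiffAt ℝ n (fun w : ℝ × (ℝ × ℝ) => revol q e (ψ₁ w.1) (ψ₂ w.1) w.2) (0, p) := by
  have h : ContDiffAt ℝ n (fun w : ℝ × (ℝ × ℝ) => rad w.2) (0, p) :=
    ContDiffAt.comp (g := rad) ((0 : ℝ), p) (contDiffAt_rad (n := n) hp) contDiffAt_snd
  have hw : ContDiffAt ℝ n (fun w : ℝ × (ℝ × ℝ) => (w.1, rad w.2)) (0, p) :=
    contDiffAt_fst.prodMk h
  have h1 : ContDiffAt ℝ n (fun w : ℝ × (ℝ × ℝ) => ψ₁ w.1 (rad w.2)) (0, p) :=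
    ContDiffAt.comp (g := fun w : ℝ × ℝ => ψ₁ w.1 w.2) ((0 : ℝ), p) h₁ hw
  have h2 : ContDiffAt ℝ n (fun w : ℝ × (ℝ × ℝ) => ψ₂ w.1 (rad w.2)) (0, p) :=
    ContDiffAt.comp (g := fun w : ℝ × ℝ => ψ₂ w.1 w.2) ((0 : ℝ), p) h₂ hw
  have hu : ContDiffAt ℝ n (fun w : ℝ × (ℝ × ℝ) => w.2.1) (0, p) := by fun_prop
  have hv : ContDiffAt ℝ n (fun w : ℝ × (ℝ × ℝ) => w.2.2) (0, p) := by fun_prop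
  exact (contDiffAt_const.add ((h1.div h hp.ne').smul ((hu.smul contDiffAt_const).add
    (hv.smul contDiffAt_const)))).add (h2.smul contDiffAt_const)

lemma contDiffAt_shift {n : WithTop ℕ∞} {r χ : ℝ → ℝ} {x : ℝ} (hr : ContDiffAt ℝ n r x)
    (hχ : ContDiff ℝ n χ) : ContDiffAt ℝ n (fun w : ℝ × ℝ => r (w.2 + w.1 * χ w.2)) (0, x) := by
  have h1 : ContDiffAt ℝ n (fun w : ℝ × ℝ => w.2 + w.1 * χ w.2) (0, x) := by
    have : ContDiff ℝ n (fun w : ℝ × ℝ => w.2 + w.1 * χ w.2) := by fun_prop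
    exact this.contDiffAt
  refine ContDiffAt.comp (g := r) ((0 : ℝ), x) ?_ h1
  simpa using hr

lemma iteratedDeriv_two_eq {E G G' : ℝ → ℝ} {v : ℝ} (hE : E =ᶠ[𝓝 0] G)
    (hG : ∀ᶠ t in 𝓝 0, HasDerivAt G (G' t) t) (hG' : HasDerivAt G' v 0) :
    iteratedDeriv 2 E 0 = v := by
  rw [iteratedDeriv_succ, iteratedDeriv_one]
  have h1 : deriv E =ᶠ[𝓝 0] G' := by
    filter_upwards [hE.eventuallyEq_nhds, hG] with t i1 i2
    rw [i1.deriv_eq, i2.deriv]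
  rw [h1.deriv_eq, hG'.deriv]

/-- It confines a shift x ↦ x + tχ(x) to the collar while the end point moves with unit speed. -/
lemma exists_cutoff {f x₁ : ℝ} (hne : f ≠ x₁) : ∃ χ : ℝ → ℝ, ContDiff ℝ 4 χ ∧ χ x₁ = 1 ∧
    ∀ x, (x₁ - f) * (x - f) ≤ 0 → χ =ᶠ[𝓝 x] 0 := by
  have hd : 0 < |x₁ - f| := abs_pos.2 (sub_ne_zero.2 hne.symm)
  let g : ContDiffBump x₁ := ⟨|x₁ - f| / 4, |x₁ - f| / 2, by positivity, by linarith⟩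
  refine ⟨g, g.contDiff,
    g.one_of_mem_closedBall (Metric.mem_closedBall_self (by positivity)), ?_⟩
  intro x hx
  apply notMem_tsupport_iff_eventuallyEq.1
  rw [g.tsupport_eq]
  intro hx'
  have hx' : |x - x₁| ≤ |x₁ - f| / 2 := by simpa [Real.dist_eq] using hx'
  rcases lt_or_gt_of_ne hne with h3 | h3
  · rw [abs_of_pos (sub_pos.2 h3)] at hx'
    have := (abs_le.1 hx').1
    exact absurd (mul_pos (show 0 < x₁ - f by linarith) (show 0 < x - f by linarith))
      (not_lt.2 hx)
  · rw [abs_of_neg (sub_neg.2 h3)] at hx'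
    have := (abs_le.1 hx').2
    exact absurd (mul_pos_of_neg_of_neg (show x₁ - f < 0 by linarith)
      (show x - f < 0 by linarith)) (not_lt.2 hx)

/-! ### Moving a boundary circle along the surface -/

lemma hasDerivAt_prK1 {r z : ℝ → ℝ} {x : ℝ} (hr : ContDiffAt ℝ 2 r x) (hz : ContDiffAt ℝ 2 z x)
    (hr0 : 0 < r x) (hS : 0 < prSpeed r z x) :
    HasDerivAt (prK1 r z) (deriv r x * (prK2 r z x - prK1 r z x) / r x) x := by
  have h1 := (hasDerivAt_sinAngle hr hz hS).div
    (hr.differentiableAt (by simp)).hasDerivAt hr0.ne'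
  have h2 : prK1 r z = (fun x => deriv z x / prSpeed r z x) / r := by
    ext1 y
    simp only [prK1, Pi.div_apply]
    rw [div_div, mul_comm]
  rw [h2]
  refine h1.congr_deriv ?_
  simp only [Pi.div_apply]
  field_simp

/-- With B = β − α/r² and w = 2α/r³, the left side is the parameter derivative of ς times the
density plus B r', i.e. the second derivative of the energy in the position of the end, up to the
factor 2π. The natural condition and the Euler–Lagrange fluxes turn it into an expression in which
neither h nor any derivative of a curvature occurs. -/
lemma second_variation_identity {a b ς B r S r₁ z₁ r₂ z₂ k₁ k₂ dk₁ dk₂ h dh dS w : ℝ} (hr : 0 < r)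
    (hS : 0 < S) (hSq : S ^ 2 = r₁ ^ 2 + z₁ ^ 2) (hς : ς ^ 2 = 1) (hk₁ : k₁ = z₁ / (r * S))
    (hk₂ : k₂ = (r₁ * z₂ - z₁ * r₂) / S ^ 3) (hdS : dS = (r₁ * r₂ + z₁ * z₂) / S)
    (hdk₁ : dk₁ = r₁ * (k₂ - k₁) / r) (hdh : dh = (dk₁ + dk₂) / 2)
    (h1 : a * h * r + b * (z₁ / S) = 0)
    (hU : a * (dh * r * z₁ / S ^ 2 + r * h * (h - k₂) * r₁ / S) + ς * B = 0)
    (hW : a * (-(dh * r * r₁ / S ^ 2) + r * h * (h - k₂) * z₁ / S) = 0) :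
    ς * ((a * (2 * h * dh) + b * (dk₁ * k₂ + k₁ * dk₂)) * (r * S) +
      (a * h ^ 2 + b * (k₁ * k₂)) * (r₁ * S + r * dS)) + w * r₁ ^ 2 + B * r₂ =
    ς * b * r₁ * S * (k₂ - k₁) ^ 2 + (w - B / r) * r₁ ^ 2 - B * S * z₁ * k₂ := by
  have e1 : a * h = -(b * k₁) := by
    have : r * (a * h + b * k₁) = 0 := by
      rw [← h1, hk₁]; field_simp
    have := (mul_eq_zero.1 this).resolve_left hr.ne'
    linarith
  -- This is the component of the flux along the tangent, r₁ times the radial plus z₁ times the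
  -- axial equation; the h' terms cancel.
  have e2 : a * r * h * (h - k₂) * S = -(ς * B * r₁) := by
    have : a * r * h * (h - k₂) * S = (a * r * h * (h - k₂)) * S ^ 2 / S := by field_simp
    rw [this, hSq]
    have h3 : (a * r * h * (h - k₂)) * (r₁ ^ 2 + z₁ ^ 2) / S =
      r₁ * (a * (dh * r * z₁ / S ^ 2 + r * h * (h - k₂) * r₁ / S)) +
      z₁ * (a * (-(dh * r * r₁ / S ^ 2) + r * h * (h - k₂) * z₁ / S)) := by
      field_simp; ring
    rw [h3, hW]
    linear_combination r₁ * hU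
  have e3 : r₂ = r₁ * dS / S - S * z₁ * k₂ := by
    rw [hdS, hk₂]
    field_simp
    rw [hSq]
    ring
  have e4 : ς * (a * h * (h - k₂)) = -(B * r₁ / (r * S)) := by
    rw [eq_neg_iff_add_eq_zero]
    field_simp
    linear_combination ς * e2 - B * r₁ * hς
  have e5 : dk₁ * r = r₁ * (k₂ - k₁) := by rw [hdk₁]; field_simp
  -- The unknown derivative of k₂ occurs with the factor a h + b k₁, which is zero by the natural
  -- condition.
  have e6 : ς * ((a * (2 * h * dh) + b * (dk₁ * k₂ + k₁ * dk₂)) * (r * S) +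
      (a * h ^ 2 + b * (k₁ * k₂)) * (r₁ * S + r * dS)) =
      ς * b * r₁ * S * (k₂ - k₁) ^ 2 + ς * (a * h * (h - k₂)) * (r₁ * S + r * dS) := by
    rw [hdh]
    linear_combination (ς * (dk₁ + dk₂) * r * S + ς * k₂ * (r₁ * S + r * dS)) * e1 +
      ς * b * (k₂ - k₁) * S * e5
  rw [e6, e4, e3]
  field_simp
  ring

section endvar

variable {a c b α β : ℝ} {τ : SurfaceType} {X : ℝ × ℝ → Fin 3 → ℝ} {q : Fin 3 → ℝ}
  {e : Fin 3 → Fin 3 → ℝ} {r z : ℝ → ℝ} {s : ℝ}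

lemma exists_collar (hs : s ∈ boundaryLabels τ) : ∃ f, IsCollar τ s f := by
  cases τ
  · simp only [boundaryLabels, Finset.mem_singleton] at hs
    exact ⟨1 / 2, hs, by norm_num, by norm_num⟩
  · simp only [boundaryLabels, Finset.mem_insert, Finset.mem_singleton] at hs
    exact ⟨3 / 2, hs, by norm_num, by norm_num⟩

lemma IsCollar.ne {f : ℝ} (hc : IsCollar τ s f) : f ≠ |s| := by
  obtain ⟨-, h1 | h1, -⟩ := hc.cases
  · exact h1.2.ne
  · exact h1.2.ne'

/-- The energy along the variation which moves a boundary circle along the surface. -/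
lemma IsProfile.exists_shift_variation (h : IsProfile τ X q e r z) (hX : IsC4Immersion τ X)
    {f : ℝ} (hc : IsCollar τ s f) : ∃ (K : ℝ) (F : ℝ → ℝ × ℝ → Fin 3 → ℝ), IsVariation τ X F ∧
      (fun t => energy a c b α β τ (F t)) =ᶠ[𝓝 0] fun t => K + 2 * Real.pi * (s / |s| *
        (∫ x in f..(|s| + t), prDens a (frameDet e * c) b r z x) +
        (α / r (|s| + t) + β * r (|s| + t))) := by
  obtain ⟨χ, hχ, hχ1, hχ0⟩ := exists_cutoff hc.ne
  have hgood := h.good.mono hc.uIcc_subset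
  obtain ⟨K, hK⟩ := energy_eq_of_collar (a := a) (c := c) (b := b) (α := α) (β := β) hX hc
  -- Over the collar the profile is precomposed with x ↦ x + tχ(x), so the surface slides along
  -- itself and only its edge moves. Beyond the edge the C⁴ prolongation of the profile is used.
  set F : ℝ → ℝ × ℝ → Fin 3 → ℝ := fun t p => X p + revol 0 e (fun x => r (x + t * χ x) - r x)
    (fun x => z (x + t * χ x) - z x) p with hF
  have hFX : ∀ p, (|s| - f) * (rad p - f) ≤ 0 →
      ∀ᶠ w in 𝓝 p, ∀ t, F t w = X w := by
    intro p hp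
    have hcr : Tendsto rad (𝓝 p) (𝓝 (rad p)) := continuous_rad.continuousAt
    filter_upwards [hcr.eventually (hχ0 _ hp)] with w hw t
    have hw' : χ (Real.sqrt (w.1 ^ 2 + w.2 ^ 2)) = 0 := hw
    simp [hF, revol, sqSurf, hw']
  refine ⟨K, F, ⟨?_, ?_⟩, ?_⟩
  · intro p _
    simp [hF, revol, sqSurf]
  · intro p hp
    have hXc : ContDiffAt ℝ 4 (fun w : ℝ × (ℝ × ℝ) => X w.2) (0, p) :=
      ContDiffAt.comp ((0 : ℝ), p) (hX p hp).1 contDiffAt_snd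
    by_cases hside : (|s| - f) * (rad p - f) ≤ 0
    · refine hXc.congr_of_eventuallyEq ?_
      have hsnd : Tendsto (fun w : ℝ × (ℝ × ℝ) => w.2) (𝓝 (0, p)) (𝓝 p) := continuousAt_snd
      filter_upwards [hsnd.eventually (hFX p hside)] with w hw using hw w.1
    · have hmem : rad p ∈ uIcc f |s| := by
        by_contra hcon
        exact hside (hc.outside hp (Or.inl hcon))
      have hp0 := radii_pos (hc.uIcc_subset hmem)
      obtain ⟨i1, i2, -, -⟩ := hgood _ hmem
      have lift : ∀ {g : ℝ → ℝ}, ContDiffAt ℝ 4 g (rad p) →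
          ContDiffAt ℝ 4 (fun w : ℝ × ℝ => g w.2) (0, rad p) :=
        fun hg => ContDiffAt.comp ((0 : ℝ), rad p) hg contDiffAt_snd
      exact hXc.add (contDiffAt_revol_param (ψ₁ := fun t x => r (x + t * χ x) - r x)
        (ψ₂ := fun t x => z (x + t * χ x) - z x) hp0
        ((contDiffAt_shift i1 hχ).sub (lift i1)) ((contDiffAt_shift i2 hχ).sub (lift i2)))
  · have hev := hgood.eventually_comp isCompact_uIcc (φ := fun _ => 0) (η := fun _ => 0)
      (fun _ _ => contDiffAt_const) (fun _ _ => contDiffAt_const) hχ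
    simp only [mul_zero, add_zero] at hev
    filter_upwards [hev] with t ht
    have h4 : (2 : WithTop ℕ∞) ≤ 4 := by norm_num
    set g : ℝ → ℝ := fun x => x + t * χ x with hg
    have hgs : ContDiff ℝ 4 g := by rw [hg]; fun_prop
    have hg2 : ∀ x, ContDiffAt ℝ 2 g x := fun x => hgs.contDiffAt.of_le h4
    have hgf : g f = f := by
      have : χ f = 0 := (hχ0 f (by simp)).self_of_nhds
      simp [hg, this]
    have hg1 : g |s| = |s| + t := by simp [hg, hχ1]
    have hgp : GoodProfile 2 (fun y => r (g y)) (fun y => z (g y)) (uIcc f |s|) := by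
      intro x hx
      obtain ⟨⟨i1, i2, i3, i4⟩, i5⟩ := ht x hx
      refine ⟨(i1.of_le h4).comp x (hg2 x), (i2.of_le h4).comp x (hg2 x), i3, ?_⟩
      rw [prSpeed_comp (g := g) (i1.of_le h4) (i2.of_le h4) (hg2 x) i5]
      exact mul_pos i4 i5
    have hen := hK q e (fun y => r (g y)) (fun y => z (g y)) (F t) h.frame hgp ?_ ?_
    · rw [hen]
      simp only [hg1]
      have hint : ∫ x in f..|s|, prDens a (frameDet e * c) b (fun y => r (g y)) (fun y => z (g y)) x
          = ∫ x in f..(|s| + t), prDens a (frameDet e * c) b r z x := by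
        have i6 := intervalIntegral.integral_comp_mul_deriv' (a := f) (b := |s|) (f := g)
          (f' := deriv g) (g := prDens a (frameDet e * c) b r z)
          (fun x _ => (hgs.differentiable (by simp) x).hasDerivAt)
          (hgs.continuous_deriv (by norm_num)).continuousOn (by
            rintro _ ⟨x, hx, rfl⟩
            obtain ⟨⟨i1, i2, i3, i4⟩, i5⟩ := ht x hx
            exact (contDiffAt_prDens (m := 0) i1 i2 (by norm_num) i3
              i4).continuousAt.continuousWithinAt)
        rw [hgf, hg1] at i6
        rw [← i6]
        apply intervalIntegral.integral_congr
        intro x hx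
        obtain ⟨⟨i1, i2, i3, i4⟩, i5⟩ := ht x hx
        exact prDens_comp (g := g) (i1.of_le h4) (i2.of_le h4) (hg2 x) i5 i3 i4
      rw [hint]
    · intro p hp hp'
      filter_upwards [hFX p (hc.outside hp hp')] with w hw using hw t
    · intro p hp
      have h1 := hc.uIcc_subset hp
      simp only [hF, hg]
      rw [h.eq_revol p (mem_domain_of_radii h1) (radii_pos h1)]
      simp only [revol, sqSurf]
      module

/-- Instability from moving a boundary circle along the surface. -/
lemma IsProfile.isUnstable_of_shift (h : IsProfile τ X q e r z) (hX : IsC4Immersion τ X)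
    (hcrit : IsCritical a c b α β τ X) (hs : s ∈ boundaryLabels τ)
    (hv : s / |s| * b * deriv r |s| * prSpeed r z |s| * (prK2 r z |s| - prK1 r z |s|) ^ 2 +
      (2 * α / r |s| ^ 3 - (β - α / r |s| ^ 2) / r |s|) * deriv r |s| ^ 2 -
      (β - α / r |s| ^ 2) * prSpeed r z |s| * deriv z |s| * prK2 r z |s| < 0) :
    IsUnstable a c b α β τ X := by
  obtain ⟨f, hc⟩ := exists_collar hs
  obtain ⟨hW, hk, hU⟩ := h.euler_lagrange hX hcrit hc
  have hW1 := hW |s| right_mem_uIcc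
  have hU1 := hU |s| right_mem_uIcc
  rw [intervalIntegral.integral_same, add_zero] at hU1
  obtain ⟨K, F, hFv, hFe⟩ :=
    h.exists_shift_variation (a := a) (c := c) (b := b) (α := α) (β := β) hX hc
  refine ⟨F, hFv, ?_⟩
  set c' := frameDet e * c with hc'
  have hgood := h.good.mono hc.uIcc_subset
  set x₁ := |s| with hx₁
  obtain ⟨hr, hz, hr0, hS⟩ := hgood x₁ right_mem_uIcc
  have h4 : (2 : WithTop ℕ∞) ≤ 4 := by norm_num
  have hD1 : ContDiffAt ℝ 1 (prDens a c' b r z) x₁ :=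
    contDiffAt_prDens hr hz (by norm_num) hr0 hS
  have hnear : ∀ᶠ y in 𝓝 x₁, ContDiffAt ℝ 1 (prDens a c' b r z) y ∧ ContDiffAt ℝ 4 r y ∧
      0 < r y := by
    filter_upwards [hD1.eventually (by simp), hr.eventually (by simp),
      hr.continuousAt.eventually (lt_mem_nhds hr0)] with y i1 i2 i3 using ⟨i1, i2, i3⟩
  obtain ⟨ε, hε, hball⟩ := Metric.eventually_nhds_iff_ball.1 hnear
  have hcD : ContinuousOn (prDens a c' b r z) (uIcc f x₁) := fun x hx => by
    obtain ⟨i1, i2, i3, i4⟩ := hgood x hx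
    exact (contDiffAt_prDens (m := 0) i1 i2 (by norm_num) i3 i4).continuousAt.continuousWithinAt
  -- By the fundamental theorem of calculus the first derivative is a function of the moving end
  -- point alone, so the second variation needs no differentiation under the integral.
  have hder : ∀ᶠ t in 𝓝 (0 : ℝ), HasDerivAt (fun t => K + 2 * Real.pi * (s / x₁ *
      (∫ x in f..(x₁ + t), prDens a c' b r z x) + (α / r (x₁ + t) + β * r (x₁ + t))))
      (2 * Real.pi * (s / x₁ * prDens a c' b r z (x₁ + t) +
        (β - α / r (x₁ + t) ^ 2) * deriv r (x₁ + t))) t := by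
    filter_upwards [Metric.ball_mem_nhds (0 : ℝ) hε] with t ht
    have hyb : x₁ + t ∈ Metric.ball x₁ ε := by
      simpa [Real.dist_eq] using ht
    obtain ⟨i1, i2, i3⟩ := hball _ hyb
    have hsub : uIcc x₁ (x₁ + t) ⊆ Metric.ball x₁ ε := by
      rw [Real.ball_eq_Ioo] at hyb ⊢
      exact ordConnected_Ioo.uIcc_subset ⟨by linarith, by linarith⟩ hyb
    have hii : IntervalIntegrable (prDens a c' b r z) volume f (x₁ + t) := by
      refine hcD.intervalIntegrable.trans (ContinuousOn.intervalIntegrable fun y hy => ?_)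
      exact (hball y (hsub hy)).1.continuousAt.continuousWithinAt
    have hsh : HasDerivAt (fun t => x₁ + t) 1 t := (hasDerivAt_id t).const_add x₁
    have j1 := HasDerivAt.comp (h₂ := fun y => ∫ x in f..y, prDens a c' b r z x) t
      (intervalIntegral.integral_hasDerivAt_right hii
        (stronglyMeasurableAtFilter_of_contDiffAt i1) i1.continuousAt) hsh
    have j2 := HasDerivAt.comp (h₂ := r) t (i2.differentiableAt (by simp)).hasDerivAt hsh
    have j3 := (((j1.const_mul (s / x₁)).add (((hasDerivAt_const t α).div j2 i3.ne').add
      (j2.const_mul β))).const_mul (2 * Real.pi)).const_add K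
    refine j3.congr_deriv ?_
    simp only [Function.comp_def]
    field_simp
    ring
  have hk1' := hasDerivAt_prK1 (hr.of_le h4) (hz.of_le h4) hr0 hS
  have hk2' : HasDerivAt (prK2 r z) (deriv (prK2 r z) x₁) x₁ :=
    ((contDiffAt_prK2 (m := 1) hr hz (by norm_num) hS).differentiableAt (by simp)).hasDerivAt
  have hS' := hasDerivAt_prSpeed (hr.of_le h4) (hz.of_le h4) hS
  have hr' := (hr.differentiableAt (by simp)).hasDerivAt
  have hr'' := (hasDerivAt_deriv_of_contDiffAt (hr.of_le h4)).2
  have hH' : deriv (prH c' r z) x₁ = (deriv r x₁ * (prK2 r z x₁ - prK1 r z x₁) / r x₁ +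
      deriv (prK2 r z) x₁) / 2 := (((hk1'.add hk2').div_const 2).add_const c').deriv
  have hDd : HasDerivAt (fun y => s / x₁ * prDens a c' b r z y + (β - α / r y ^ 2) * deriv r y)
      _ x₁ :=
    ((((((((hk1'.add hk2').div_const 2).add_const c').pow 2).const_mul a).add
      ((hk1'.mul hk2').const_mul b)).mul (hr'.mul hS')).const_mul (s / x₁)).add
      ((((hasDerivAt_const x₁ α).div (hr'.pow 2) (pow_pos hr0 2).ne').const_sub β).mul hr'')
  have hid := second_variation_identity (w := 2 * α / r x₁ ^ 3) (k₁ := prK1 r z x₁)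
    (k₂ := prK2 r z x₁) (ς := s / x₁) hr0 hS (prSpeed_sq r z x₁)
    (sign_sq (label_ne_zero hs)) rfl rfl rfl rfl hH' hk hU1 hW1
  have hG' : HasDerivAt (fun t => 2 * Real.pi * (s / x₁ * prDens a c' b r z (x₁ + t) +
        (β - α / r (x₁ + t) ^ 2) * deriv r (x₁ + t)))
      (2 * Real.pi * (s / x₁ * b * deriv r x₁ * prSpeed r z x₁ * (prK2 r z x₁ - prK1 r z x₁) ^ 2 +
      (2 * α / r x₁ ^ 3 - (β - α / r x₁ ^ 2) / r x₁) * deriv r x₁ ^ 2 -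
      (β - α / r x₁ ^ 2) * prSpeed r z x₁ * deriv z x₁ * prK2 r z x₁)) 0 := by
    have hsh : HasDerivAt (fun t => x₁ + t) 1 0 := (hasDerivAt_id 0).const_add x₁
    have hDd' := HasDerivAt.comp (h₂ := fun y => s / x₁ * prDens a c' b r z y +
      (β - α / r y ^ 2) * deriv r y) 0 (by simpa only [add_zero] using hDd) hsh
    refine (hDd'.const_mul (2 * Real.pi)).congr_deriv ?_
    rw [← hid]
    simp only [Pi.mul_apply, Pi.add_apply, Pi.pow_apply, Pi.div_apply]
    rw [hH', prH]
    generalize s / x₁ = ς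
    field_simp
    push_cast
    ring
  rw [iteratedDeriv_two_eq hFe hder hG']
  exact mul_neg_of_pos_of_neg (by positivity) hv

end endvar

/-! ### Critical surfaces which are free of bending at a boundary circle -/

/-- A linear differential inequality with vanishing datum at an end point. -/
lemma eq_zero_of_abs_deriv_le {w : ℝ → ℝ} {f x₁ C : ℝ} (hc : ContinuousOn w (uIcc f x₁))
    (hd : ∀ x ∈ interior (uIcc f x₁), DifferentiableAt ℝ w x)
    (hle : ∀ x ∈ interior (uIcc f x₁), |deriv w x| ≤ C * w x) (h0 : ∀ x ∈ uIcc f x₁, 0 ≤ w x)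
    (h1 : w x₁ = 0) : ∀ x ∈ uIcc f x₁, w x = 0 := by
  -- An integrating factor: with k = C the product is nondecreasing, used when x₁ is the right end,
  -- and with k = −C it is nonincreasing, used when x₁ is the left end. Either way it is at most its
  -- value 0 at x₁.
  have key : ∀ k : ℝ, ContinuousOn (fun x => Real.exp (k * x) * w x) (uIcc f x₁) ∧
      ∀ x ∈ interior (uIcc f x₁), HasDerivAt (fun x => Real.exp (k * x) * w x)
        (Real.exp (k * x) * (k * w x + deriv w x)) x := by
    intro k
    refine ⟨(Continuous.continuousOn (by fun_prop)).mul hc, fun x hx => ?_⟩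
    have i1 : HasDerivAt (fun x => Real.exp (k * x)) (Real.exp (k * x) * k) x := by
      simpa using ((hasDerivAt_id x).const_mul k).exp
    exact (i1.mul (hd x hx).hasDerivAt).congr_deriv (by ring)
  intro x hx
  apply le_antisymm _ (h0 x hx)
  rcases le_total f x₁ with hf | hf
  · obtain ⟨i1, i2⟩ := key C
    have hm := monotoneOn_of_deriv_nonneg (convex_uIcc f x₁) i1
      (fun y hy => (i2 y hy).differentiableAt.differentiableWithinAt) (fun y hy => by
        rw [(i2 y hy).deriv]
        exact mul_nonneg (Real.exp_pos _).le (by linarith [(abs_le.1 (hle y hy)).1]))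
    have := hm hx right_mem_uIcc (by rw [uIcc_of_le hf] at hx; exact hx.2)
    simp only [h1, mul_zero] at this
    exact nonpos_of_mul_nonpos_right this (Real.exp_pos _)
  · obtain ⟨i1, i2⟩ := key (-C)
    have hm := antitoneOn_of_deriv_nonpos (convex_uIcc f x₁) i1
      (fun y hy => (i2 y hy).differentiableAt.differentiableWithinAt) (fun y hy => by
        rw [(i2 y hy).deriv]
        exact mul_nonpos_of_nonneg_of_nonpos (Real.exp_pos _).le
          (by linarith [(abs_le.1 (hle y hy)).2]))
    have := hm right_mem_uIcc hx (by rw [uIcc_of_ge hf] at hx; exact hx.1)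
    simp only [h1, mul_zero] at this
    exact nonpos_of_mul_nonpos_right this (Real.exp_pos _)

section rigid

variable {a c b α β : ℝ} {τ : SurfaceType} {X : ℝ × ℝ → Fin 3 → ℝ} {q : Fin 3 → ℝ}
  {e : Fin 3 → Fin 3 → ℝ} {r z : ℝ → ℝ} {s : ℝ}

/-- Since the axial flux vanishes, h' = U z'/(a r) and U' = a h (h − k₁) S, where U is the radial
flux. This is homogeneous linear in (h, U) once the coefficients are regarded as given, and B = 0
makes the data at the end zero. Uniqueness is obtained from h² + U². -/
lemma IsProfile.prH_eq_zero_of_collar (h : IsProfile τ X q e r z) (hX : IsC4Immersion τ X)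
    (hcrit : IsCritical a c b α β τ X) (ha : 0 < a) (hR : β - α / r |s| ^ 2 = 0)
    (h0 : prH (frameDet e * c) r z |s| = 0) {f : ℝ} (hc : IsCollar τ s f) :
    ∀ x ∈ uIcc f |s|, prH (frameDet e * c) r z x = 0 := by
  obtain ⟨hW, -, hU⟩ := h.euler_lagrange hX hcrit hc
  simp only [hR, mul_zero, add_zero] at hU
  have hgood := h.good.mono hc.uIcc_subset
  set c' := frameDet e * c with hc'
  have hmom := fun x hx => contDiffAt_mom (a := a) (c := c') (hgood x hx).1 (hgood x hx).2.1
    (hgood x hx).2.2.1 (hgood x hx).2.2.2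
  have hH : ∀ x ∈ uIcc f |s|, ContDiffAt ℝ 2 (prH c' r z) x := fun x hx =>
    contDiffAt_prH (hgood x hx).1 (hgood x hx).2.1 (by norm_num) (hgood x hx).2.2.1
      (hgood x hx).2.2.2
  have hU' : ∀ x ∈ interior (uIcc f |s|), HasDerivAt (momU a c' r z) (momZ a c' r z x) x := by
    intro x hx
    have hx' := interior_subset hx
    have cZ : ContinuousOn (momZ a c' r z) (uIcc x |s|) := fun y hy =>
      (hmom y (uIcc_subset_uIcc_right hx' hy)).2.2.continuousAt.continuousWithinAt
    have i1 := intervalIntegral.integral_hasDerivAt_left cZ.intervalIntegrable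
      (stronglyMeasurableAtFilter_of_contDiffAt (hmom x hx').2.2) (hmom x hx').2.2.continuousAt
    have i2 : momU a c' r z =ᶠ[𝓝 x] fun x => -∫ y in x..|s|, momZ a c' r z y := by
      filter_upwards [mem_interior_iff_mem_nhds.1 hx] with y hy
      linarith [hU y hy]
    exact (i1.neg.congr_of_eventuallyEq i2).congr_deriv (neg_neg _)
  have hH' : ∀ x ∈ uIcc f |s|, deriv (prH c' r z) x = momU a c' r z x * deriv z x / (a * r x) := by
    intro x hx
    obtain ⟨-, -, hr0, hS⟩ := hgood x hx
    have hSq := prSpeed_sq r z x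
    -- The component of the flux normal to the profile contains h' alone.
    have i1 : momU a c' r z x * deriv z x - momW a c' r z x * deriv r x =
        a * r x * deriv (prH c' r z) x := by
      have i2 : (deriv r x ^ 2 + deriv z x ^ 2) / prSpeed r z x ^ 2 = 1 := by
        rw [← hSq]; field_simp
      rw [← mul_one (a * r x * deriv (prH c' r z) x), ← i2]
      simp only [momU, momW]
      field_simp
      ring
    rw [hW x hx, zero_mul, sub_zero] at i1
    rw [i1]
    field_simp
  have hbd : ∃ C, ∀ x ∈ uIcc f |s|, ‖deriv z x / (a * r x) + a * ((prH c' r z x - prK1 r z x) *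
      prSpeed r z x)‖ ≤ C := by
    apply isCompact_uIcc.exists_bound_of_continuousOn
    intro x hx
    obtain ⟨hr, hz, hr0, hS⟩ := hgood x hx
    have z1 : ContDiffAt ℝ 1 (deriv z) x := hz.derivWithin (by norm_num)
    have k1 := contDiffAt_prK1 (m := 1) hr hz (by norm_num) hr0 hS
    have hs := contDiffAt_prSpeed (m := 1) hr hz (by norm_num) hS
    exact ((z1.continuousAt.div (continuousAt_const.mul hr.continuousAt)
      (mul_pos ha hr0).ne').add (continuousAt_const.mul (((hH x hx).continuousAt.sub
      k1.continuousAt).mul hs.continuousAt))).continuousWithinAt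
  obtain ⟨C, hC⟩ := hbd
  have hU1 : momU a c' r z |s| = 0 := by
    simpa using hU |s| right_mem_uIcc
  have hder : ∀ x ∈ interior (uIcc f |s|),
      HasDerivAt (fun x => prH c' r z x ^ 2 + momU a c' r z x ^ 2)
        (2 * (prH c' r z x * momU a c' r z x) * (deriv z x / (a * r x) +
          a * ((prH c' r z x - prK1 r z x) * prSpeed r z x))) x := by
    intro x hx
    have hx' := interior_subset hx
    refine ((((hH x hx').differentiableAt (by simp)).hasDerivAt.pow 2).add
      ((hU' x hx).pow 2)).congr_deriv ?_
    rw [hH' x hx', momZ]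
    push_cast
    ring
  have hw := eq_zero_of_abs_deriv_le (w := fun x => prH c' r z x ^ 2 + momU a c' r z x ^ 2)
    (f := f) (x₁ := |s|) (C := C)
    (fun x hx => (((hH x hx).continuousAt.pow 2).add
      ((hmom x hx).1.continuousAt.pow 2)).continuousWithinAt)
    (fun x hx => (hder x hx).differentiableAt) (fun x hx => by
      rw [(hder x hx).deriv, abs_mul]
      have i1 := hC x (interior_subset hx)
      rw [Real.norm_eq_abs] at i1
      have i2 : |2 * (prH c' r z x * momU a c' r z x)| ≤
          prH c' r z x ^ 2 + momU a c' r z x ^ 2 := by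
        rw [abs_le]
        constructor <;> nlinarith [sq_nonneg (prH c' r z x + momU a c' r z x),
          sq_nonneg (prH c' r z x - momU a c' r z x)]
      rw [mul_comm]
      exact mul_le_mul i1 i2 (abs_nonneg _) ((abs_nonneg _).trans i1))
    (fun x _ => by positivity) (by simp [h0, hU1])
  intro x hx
  have := hw x hx
  exact pow_eq_zero_iff (two_ne_zero) |>.1
    (le_antisymm (by linarith [sq_nonneg (momU a c' r z x)]) (sq_nonneg _))

/-- Every interior radius is the far end of some collar of the given circle; the remaining radii are
reached by continuity. -/
lemma IsProfile.prH_eq_zero (h : IsProfile τ X q e r z) (hX : IsC4Immersion τ X)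
    (hcrit : IsCritical a c b α β τ X) (ha : 0 < a) (hs : s ∈ boundaryLabels τ)
    (hR : β - α / r |s| ^ 2 = 0) (h0 : prH (frameDet e * c) r z |s| = 0) :
    ∀ x ∈ radii τ, prH (frameDet e * c) r z x = 0 := by
  have hint : ∀ x ∈ interior (radii τ), prH (frameDet e * c) r z x = 0 := by
    intro x hx
    have hc : IsCollar τ s x := by
      cases τ
      · simp only [boundaryLabels, Finset.mem_singleton] at hs
        simp only [radii, interior_Ioc] at hx
        exact ⟨hs, hx.1, hx.2⟩
      · simp only [boundaryLabels, Finset.mem_insert, Finset.mem_singleton] at hs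
        simp only [radii, interior_Icc] at hx
        exact ⟨hs, hx.1, hx.2⟩
    exact h.prH_eq_zero_of_collar hX hcrit ha hR h0 hc x left_mem_uIcc
  intro x hx
  obtain ⟨hr, hz, hr0, hS⟩ := h.good x hx
  have hcont : ContinuousAt (prH (frameDet e * c) r z) x :=
    (contDiffAt_prH (m := 2) hr hz (by norm_num) hr0 hS).continuousAt
  have hmem := radii_subset_closure_interior τ hx
  have hne : (𝓝[interior (radii τ)] x).NeBot := mem_closure_iff_nhdsWithin_neBot.1 hmem
  refine tendsto_nhds_unique (hcont.mono_left nhdsWithin_le_nhds :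
    Tendsto _ (𝓝[interior (radii τ)] x) _) ?_
  exact tendsto_const_nhds.congr' (eventually_nhdsWithin_of_forall fun y hy => (hint y hy).symm)

/-- The profile of a surface of constant mean curvature. -/
lemma IsProfile.sinAngle_eq (h : IsProfile τ X q e r z) {c' : ℝ} {x₁ : ℝ} (hx₁ : x₁ ∈ radii τ)
    (hH : ∀ x ∈ radii τ, prH c' r z x = 0) (hz1 : deriv z x₁ = 0) :
    ∀ x ∈ radii τ, r x * (deriv z x / prSpeed r z x) = c' * (r x₁ ^ 2 - r x ^ 2) := by
  intro x hx
  have hsub : uIcc x₁ x ⊆ radii τ := (isPreconnected_radii τ).ordConnected.uIcc_subset hx₁ hx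
  -- First integral of the constant mean curvature equation: the derivative of r z'/S is r r'(k₁ +
  -- k₂), so that of r z'/S + c' r² is 2 r r' h = 0.
  have hd : ∀ y ∈ uIcc x₁ x, HasDerivAt
      (fun y => r y * (deriv z y / prSpeed r z y) + c' * r y ^ 2) 0 y := by
    intro y hy
    obtain ⟨hr, hz, hr0, hS⟩ := h.good y (hsub hy)
    have i0 := (hr.differentiableAt (by simp)).hasDerivAt
    have i1 := hasDerivAt_sinAngle (hr.of_le (by norm_num)) (hz.of_le (by norm_num)) hS
    refine ((i0.mul i1).add ((i0.pow 2).const_mul c')).congr_deriv ?_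
    have i2 := hH y (hsub hy)
    have i3 : deriv z y / prSpeed r z y = prK1 r z y * r y := by
      rw [prK1]; field_simp
    rw [prH] at i2
    rw [i3]
    push_cast
    linear_combination 2 * r y * deriv r y * i2
  have := intervalIntegral.integral_eq_sub_of_hasDerivAt hd intervalIntegrable_const
  rw [intervalIntegral.integral_zero, hz1, zero_div, mul_zero] at this
  linarith

/-- On a disc the axis is reached. -/
lemma IsProfile.tendsto_radius (h : IsProfile SurfaceType.disc X q e r z)
    (hX : IsC4Immersion SurfaceType.disc X) : Tendsto r (𝓝[>] 0) (𝓝 0) := by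
  have hXc : ContinuousAt X (0, 0) := (hX (0, 0) (by simp [domain])).1.continuousAt
  have key : ∀ σ : ℝ, Tendsto (fun x : ℝ => X (x * σ, 0)) (𝓝[>] 0) (𝓝 (X (0, 0))) := by
    intro σ
    refine hXc.tendsto.comp (Tendsto.mono_left ?_ nhdsWithin_le_nhds)
    have : Continuous fun x : ℝ => (x * σ, (0 : ℝ)) := by fun_prop
    simpa using this.tendsto 0
  -- Opposite points of a small parallel both tend to the centre of the disc, and their difference
  -- is 2r along `e 0`.
  have h1 := (key 1).sub (key (-1))
  rw [sub_self] at h1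
  have hlin : Continuous fun v : Fin 3 → ℝ => (v ⬝ᵥ e 0) / 2 := by
    simp only [dotProduct]; fun_prop
  have h2 := (hlin.tendsto 0).comp h1
  simp only [zero_dotProduct, zero_div] at h2
  refine h2.congr' ?_
  filter_upwards [Ioc_mem_nhdsGT (zero_lt_one' ℝ)] with x hx
  have hp : ∀ θ : ℝ, X (x * Real.cos θ, x * Real.sin θ) =
      q + r x • (Real.cos θ • e 0 + Real.sin θ • e 1) + z x • e 2 := by
    intro θ
    have hrad := rad_polar hx.1.le θ
    rw [← revol_polar hx.1]
    exact h.eq_revol _ (mem_disc_iff.2 (by rw [hrad]; exact hx.2)) (by rw [hrad]; exact hx.1)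
  have p0 := hp 0
  have p1 := hp Real.pi
  simp only [Real.cos_zero, Real.sin_zero, Real.cos_pi, Real.sin_pi, mul_zero] at p0 p1
  simp only [Function.comp_apply, p0, p1]
  have he : e 0 ⬝ᵥ e 0 = 1 := by simpa using h.frame 0 0
  have : q + r x • ((1 : ℝ) • e 0 + (0 : ℝ) • e 1) + z x • e 2 -
      (q + r x • ((-1 : ℝ) • e 0 + (0 : ℝ) • e 1) + z x • e 2) = (2 * r x) • e 0 := by module
  rw [this, smul_dotProduct, he, smul_eq_mul]
  ring

/-- At the axis r tends to 0, so the left side of the first integral tends to 0, while the right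
side tends to c'R² ≠ 0. -/
lemma IsProfile.not_disc (h : IsProfile SurfaceType.disc X q e r z)
    (hX : IsC4Immersion SurfaceType.disc X) {c' R : ℝ} (hc' : c' ≠ 0) (hR : R ≠ 0)
    (hsin : ∀ x ∈ radii SurfaceType.disc,
      r x * (deriv z x / prSpeed r z x) = c' * (R ^ 2 - r x ^ 2)) : False := by
  have h0 := h.tendsto_radius hX
  have h1 : Tendsto (fun x => c' * (R ^ 2 - r x ^ 2)) (𝓝[>] 0) (𝓝 (c' * (R ^ 2 - 0 ^ 2))) :=
    (tendsto_const_nhds.sub (h0.pow 2)).const_mul c'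
  have h2 : Tendsto (fun x => c' * (R ^ 2 - r x ^ 2)) (𝓝[>] 0) (𝓝 0) := by
    refine squeeze_zero_norm' ?_ h0
    filter_upwards [Ioc_mem_nhdsGT (zero_lt_one' ℝ)] with x hx
    obtain ⟨-, -, hr0, hS⟩ := h.good x hx
    rw [← hsin x hx, norm_mul, Real.norm_of_nonneg hr0.le]
    refine mul_le_of_le_one_right hr0.le ?_
    rw [Real.norm_eq_abs, abs_div, abs_of_pos hS, div_le_one hS]
    exact Real.abs_le_sqrt (by linarith [sq_nonneg (deriv r x)])
  have := tendsto_nhds_unique h1 h2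
  simp [hc', hR] at this

end rigid

/-! ### Second derivatives in the parameter -/

/-- `f` is differentiable near `0` and its derivative has derivative `v` at `0`. -/
def HasSecondDeriv (f : ℝ → ℝ) (v : ℝ) : Prop :=
  ∃ f' : ℝ → ℝ, (∀ᶠ t in 𝓝 0, HasDerivAt f (f' t) t) ∧ HasDerivAt f' v 0

lemma HasSecondDeriv.add {f g : ℝ → ℝ} {v w : ℝ} (hf : HasSecondDeriv f v)
    (hg : HasSecondDeriv g w) : HasSecondDeriv (fun t => f t + g t) (v + w) := by
  obtain ⟨f', h1, h2⟩ := hf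
  obtain ⟨g', h3, h4⟩ := hg
  exact ⟨fun t => f' t + g' t, by filter_upwards [h1, h3] with t i1 i2 using i1.add i2, h2.add h4⟩

lemma HasSecondDeriv.const_mul {f : ℝ → ℝ} {v : ℝ} (hf : HasSecondDeriv f v) (k : ℝ) :
    HasSecondDeriv (fun t => k * f t) (k * v) := by
  obtain ⟨f', h1, h2⟩ := hf
  exact ⟨fun t => k * f' t, by filter_upwards [h1] with t i1 using i1.const_mul k, h2.const_mul k⟩

lemma HasSecondDeriv.iteratedDeriv_eq {f g : ℝ → ℝ} {v : ℝ} (hf : HasSecondDeriv f v)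
    (h : g =ᶠ[𝓝 0] f) : iteratedDeriv 2 g 0 = v := by
  obtain ⟨f', h1, h2⟩ := hf
  exact iteratedDeriv_two_eq h h1 h2

/-- The function h vanishes to first order at t = 0, so h² contributes nothing up to second order,
whatever the weight σ. -/
lemma hasSecondDeriv_integral_sq {h σ : ℝ → ℝ → ℝ} {u v : ℝ}
    (hh : ∀ x ∈ uIcc u v, ContDiffAt ℝ 2 (fun w : ℝ × ℝ => h w.1 w.2) (0, x))
    (hσ : ∀ x ∈ uIcc u v, ContDiffAt ℝ 2 (fun w : ℝ × ℝ => σ w.1 w.2) (0, x))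
    (h0 : ∀ x ∈ uIcc u v, h 0 x = 0) (h1 : ∀ x ∈ uIcc u v, HasDerivAt (fun t => h t x) 0 0) :
    HasSecondDeriv (fun t => ∫ x in u..v, h t x ^ 2 * σ t x) 0 := by
  have hΦ : ∀ x ∈ uIcc u v, ContDiffAt ℝ 2 (fun w : ℝ × ℝ => h w.1 w.2 ^ 2 * σ w.1 w.2) (0, x) :=
    fun x hx => ((hh x hx).pow 2).mul (hσ x hx)
  obtain ⟨_, hC⟩ := hasDerivAt_integral_param (Φ := fun t x => h t x ^ 2 * σ t x)
    fun x hx => (hΦ x hx).of_le (by norm_num)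
  have hΨ : ∀ x ∈ uIcc u v, ContDiffAt ℝ 1 (fun w : ℝ × ℝ =>
      deriv (fun t => h t w.2 ^ 2 * σ t w.2) w.1) (0, x) := by
    intro x hx
    have i1 : ContDiffAt ℝ 1 (fun w : ℝ × ℝ =>
        fderiv ℝ (fun w : ℝ × ℝ => h w.1 w.2 ^ 2 * σ w.1 w.2) w (1, 0)) (0, x) :=
      ((hΦ x hx).fderiv_right (m := 1) (by norm_num)).clm_apply contDiffAt_const
    refine i1.congr_of_eventuallyEq ?_
    filter_upwards [(hΦ x hx).eventually (by simp)] with w hw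
    have i2 : HasDerivAt (fun s : ℝ => (s, w.2)) (1, 0) w.1 :=
      (hasDerivAt_id w.1).prodMk (hasDerivAt_const _ _)
    exact (HasFDerivAt.comp_hasDerivAt (f := fun s : ℝ => (s, w.2)) w.1
      (hw.differentiableAt (by simp)).hasFDerivAt i2).deriv
  obtain ⟨_, hC'⟩ := hasDerivAt_integral_param
    (Φ := fun t x => deriv (fun t => h t x ^ 2 * σ t x) t) hΨ
  refine ⟨_, hC.mono fun t ht => ht.1, hC'.self_of_nhds.1.congr_deriv ?_⟩
  refine (intervalIntegral.integral_congr (g := fun _ => 0) fun x hx => ?_).trans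
    intervalIntegral.integral_zero
  have slice : ∀ {k : ℝ → ℝ → ℝ}, ContDiffAt ℝ 2 (fun w : ℝ × ℝ => k w.1 w.2) (0, x) →
      ContDiffAt ℝ 2 (fun t => k t x) 0 := fun {k} hk =>
    ContDiffAt.comp (g := fun w : ℝ × ℝ => k w.1 w.2) (f := fun t : ℝ => (t, x)) (0 : ℝ) hk
      (contDiffAt_id.prodMk contDiffAt_const)
  obtain ⟨a1, a2⟩ := hasDerivAt_deriv_of_contDiffAt (slice (hh x hx))
  obtain ⟨b1, b2⟩ := hasDerivAt_deriv_of_contDiffAt (slice (hσ x hx))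
  have hev : (fun t => deriv (fun t => h t x ^ 2 * σ t x) t) =ᶠ[𝓝 0] fun t =>
      h t x * (2 * deriv (fun t => h t x) t * σ t x + h t x * deriv (fun t => σ t x) t) := by
    filter_upwards [a1, b1] with t i1 i2
    refine ((i1.pow 2).mul i2).deriv.trans ?_
    simp only [Pi.pow_apply]
    push_cast
    ring
  refine hev.deriv_eq.trans ?_
  refine (a1.self_of_nhds.mul (((a2.const_mul 2).mul b1.self_of_nhds).add
    (a1.self_of_nhds.mul b2))).deriv.trans ?_
  rw [(h1 x hx).deriv, h0 x hx]
  simp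

/-- The bending energy of a boundary circle of the critical radius. -/
lemma hasSecondDeriv_circle {α β R ρ' : ℝ} {ρ : ℝ → ℝ} (hρ : ContDiffAt ℝ 2 ρ 0) (hR : 0 < R)
    (h0 : ρ 0 = R) (h1 : HasDerivAt ρ ρ' 0) (hβ : β - α / R ^ 2 = 0) :
    HasSecondDeriv (fun t => α / ρ t + β * ρ t) (2 * α / R ^ 3 * ρ' ^ 2) := by
  obtain ⟨a1, a2⟩ := hasDerivAt_deriv_of_contDiffAt hρ
  refine ⟨fun t => (β - α / ρ t ^ 2) * deriv ρ t, ?_, ?_⟩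
  · filter_upwards [a1, hρ.continuousAt.eventually (lt_mem_nhds (h0 ▸ hR))] with t i1 i2
    have := ((hasDerivAt_const t α).div i1 i2.ne').add (i1.const_mul β)
    refine this.congr_deriv ?_
    field_simp
    ring
  · have i0 : ρ 0 ^ 2 ≠ 0 := by rw [h0]; positivity
    have := ((((hasDerivAt_const (0 : ℝ) α).div (h1.pow 2) i0).const_sub β).mul a2)
    refine this.congr_deriv ?_
    simp only [Pi.div_apply, Pi.pow_apply]
    -- At the critical radius α/ρ + βρ is stationary in ρ, which removes the second derivative of ρ
    -- and leaves the square of its velocity.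
    rw [h0, hβ, h1.deriv]
    field_simp
    push_cast
    ring

/-! ### Second-order behaviour of the direction, and deformations preserving it -/

section profile

variable {r z : ℝ → ℝ} {x : ℝ}

lemma hasDerivAt_shift_param {g : ℝ → ℝ} {d k : ℝ} (hg : HasDerivAt g d x) :
    HasDerivAt (fun t => g (x + t * k)) (d * k) 0 := by
  have h1 : HasDerivAt (fun t : ℝ => x + t * k) k 0 := by
    simpa using ((hasDerivAt_id (0 : ℝ)).mul_const k).const_add x
  exact HasDerivAt.comp (h₂ := g) 0 (by simpa using hg) h1

/-- The direction of the profile at a point where the tangent plane is orthogonal to the axis. -/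
lemma hasSecondDeriv_cosAngle (hr : ContDiffAt ℝ 4 r x) (hz : ContDiffAt ℝ 4 z x)
    (hS : 0 < prSpeed r z x) (hz1 : deriv z x = 0) (k : ℝ) :
    HasSecondDeriv (fun t => deriv r (x + t * k) / prSpeed r z (x + t * k))
      (-(prK2 r z x ^ 2 * (deriv r x / prSpeed r z x) * (deriv r x * k) ^ 2)) := by
  have h4 : (2 : WithTop ℕ∞) ≤ 4 := by norm_num
  have hsh : Tendsto (fun t : ℝ => x + t * k) (𝓝 0) (𝓝 x) := by
    have : Continuous fun t : ℝ => x + t * k := by fun_prop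
    simpa using this.tendsto 0
  have hsc := (contDiffAt_prSpeed (m := 3) hr hz (by norm_num) hS).continuousAt
  refine ⟨fun t => -(deriv z (x + t * k) * prK2 r z (x + t * k)) * k, ?_, ?_⟩
  · filter_upwards [hsh.eventually (hr.eventually (by simp)),
      hsh.eventually (hz.eventually (by simp)),
      hsh.eventually (hsc.eventually (lt_mem_nhds hS))] with t i1 i2 i3
    have h1 : HasDerivAt (fun t : ℝ => x + t * k) k t := by
      simpa using ((hasDerivAt_id t).mul_const k).const_add x
    exact HasDerivAt.comp (h₂ := fun y => deriv r y / prSpeed r z y) t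
      (hasDerivAt_cosAngle (i1.of_le h4) (i2.of_le h4) i3) h1
  · have i1 := (hasDerivAt_deriv_of_contDiffAt (hz.of_le h4)).2
    have i2 : HasDerivAt (prK2 r z) (deriv (prK2 r z) x) x :=
      ((contDiffAt_prK2 (m := 1) hr hz (by norm_num) hS).differentiableAt (by simp)).hasDerivAt
    have hSq := prSpeed_sq r z x
    rw [hz1, zero_pow two_ne_zero, add_zero] at hSq
    -- Because z' = 0 at the point, differentiating z' k₂ leaves only z'' k₂, and z'' is determined
    -- by k₂.
    have i3 : deriv (deriv z) x = prK2 r z x * (deriv r x / prSpeed r z x) * deriv r x ^ 2 := by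
      rw [prK2, hz1, ← hSq]
      field_simp
      rw [hSq]
      ring
    refine ((hasDerivAt_shift_param (i1.mul i2).neg (k := k)).mul_const k).congr_deriv ?_
    rw [hz1, i3]
    ring

/-- Perturbations which preserve the direction of the profile. -/
lemma curvatures_parallel {φ η lam : ℝ → ℝ} {t : ℝ} (hr : ContDiffAt ℝ 2 r x)
    (hz : ContDiffAt ℝ 2 z x) (hφ : ∀ᶠ y in 𝓝 x, HasDerivAt φ (lam y * deriv r y) y)
    (hη : ∀ᶠ y in 𝓝 x, HasDerivAt η (lam y * deriv z y) y) (hl : DifferentiableAt ℝ lam x)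
    (hS : 0 < prSpeed r z x) (hr0 : 0 < r x) (ht : 0 < 1 + t * lam x) (hRt : 0 < r x + t * φ x) :
    deriv (fun y => r y + t * φ y) x / prSpeed (fun y => r y + t * φ y) (fun y => z y + t * η y) x =
      deriv r x / prSpeed r z x ∧
    prSpeed (fun y => r y + t * φ y) (fun y => z y + t * η y) x = (1 + t * lam x) * prSpeed r z x ∧
    prK1 (fun y => r y + t * φ y) (fun y => z y + t * η y) x =
      prK1 r z x * r x / (r x + t * φ x) ∧
    prK2 (fun y => r y + t * φ y) (fun y => z y + t * η y) x = prK2 r z x / (1 + t * lam x) := by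
  have key : ∀ {g ψ : ℝ → ℝ}, ContDiffAt ℝ 2 g x →
      (∀ᶠ y in 𝓝 x, HasDerivAt ψ (lam y * deriv g y) y) →
      deriv (fun y => g y + t * ψ y) x = (1 + t * lam x) * deriv g x ∧
      deriv (deriv fun y => g y + t * ψ y) x =
        t * deriv lam x * deriv g x + (1 + t * lam x) * deriv (deriv g) x := by
    intro g ψ hg hψ
    obtain ⟨h1, h2⟩ := hasDerivAt_deriv_of_contDiffAt hg
    have h5 : deriv (fun y => g y + t * ψ y) =ᶠ[𝓝 x] fun y => (1 + t * lam y) * deriv g y := by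
      filter_upwards [h1, hψ] with y i1 i2
      refine (i1.add (i2.const_mul t)).deriv.trans ?_
      ring
    refine ⟨h5.self_of_nhds, ?_⟩
    rw [h5.deriv_eq]
    exact (((hl.hasDerivAt.const_mul t).const_add 1).mul h2).deriv
  obtain ⟨r1, r2⟩ := key hr hφ
  obtain ⟨z1, z2⟩ := key hz hη
  have hsp : prSpeed (fun y => r y + t * φ y) (fun y => z y + t * η y) x =
      (1 + t * lam x) * prSpeed r z x := by
    rw [prSpeed, r1, z1, prSpeed]
    nth_rewrite 3 [← Real.sqrt_sq ht.le]
    rw [← Real.sqrt_mul (by positivity)]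
    congr 1
    ring
  refine ⟨?_, hsp, ?_, ?_⟩
  · rw [r1, hsp]; field_simp
  · rw [prK1, hsp, z1, prK1]; field_simp
  · rw [prK2, hsp, z1, z2, r1, r2, prK2]; field_simp; ring

end profile

/-- A primitive near a compact interval. -/
lemma exists_primitive {g : ℝ → ℝ} {u v : ℝ} (hg : ∀ x ∈ Icc u v, ContDiffAt ℝ 3 g x) :
    ∃ η : ℝ → ℝ, ∀ x ∈ Icc u v, ContDiffAt ℝ 4 η x ∧ ∀ᶠ y in 𝓝 x, HasDerivAt η (g y) y := by
  refine ⟨fun y => ∫ t in u..y, g t, fun x hx => ?_⟩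
  have hev : ∀ᶠ y in 𝓝 x, HasDerivAt (fun y => ∫ t in u..y, g t) (g y) y := by
    obtain ⟨ε, hε, hball⟩ := Metric.eventually_nhds_iff_ball.1
      ((hg x hx).eventually (by simp))
    filter_upwards [Metric.ball_mem_nhds x hε] with y hy
    have h1 : IntervalIntegrable g volume u x := by
      refine ContinuousOn.intervalIntegrable fun w hw => ?_
      rw [uIcc_of_le hx.1] at hw
      exact (hg w ⟨hw.1, hw.2.trans hx.2⟩).continuousAt.continuousWithinAt
    have h2 : IntervalIntegrable g volume x y := by
      refine ContinuousOn.intervalIntegrable fun w hw => ?_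
      refine (hball w ?_).continuousAt.continuousWithinAt
      rw [Real.ball_eq_Ioo] at hy ⊢
      exact ordConnected_Ioo.uIcc_subset ⟨by linarith, by linarith⟩ hy hw
    exact intervalIntegral.integral_hasDerivAt_right (h1.trans h2)
      (stronglyMeasurableAtFilter_of_contDiffAt ((hball y hy).of_le (by norm_num)))
      (hball y hy).continuousAt
  refine ⟨?_, hev⟩
  rw [show (4 : WithTop ℕ∞) = (3 : ℕ) + 1 by norm_num]
  rw [contDiffAt_succ_iff_hasFDerivAt]
  exact ⟨fun y => ContinuousLinearMap.toSpanSingleton ℝ (g y),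
    ⟨_, hev, fun y hy => hy.hasFDerivAt⟩,
    ContDiffAt.comp x (g := fun y => ContinuousLinearMap.toSpanSingleton ℝ y)
      (ContinuousLinearMap.toSpanSingletonCLE (𝕜 := ℝ) (E := ℝ)).contDiff.contDiffAt (hg x hx)⟩

/-- The worst case is D₂ = −D₁, say with D = D₁ < 0. The exact critical speeds are −A/(A ± D); their
first-order approximations −1 ± D/A avoid a denominator that may vanish and still give the value
−2D²/A. -/
lemma exists_quadratic_neg {A D₁ D₂ : ℝ} (hA : 0 < A) (hD : D₁ ^ 2 = D₂ ^ 2)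
    (hneg : D₁ < 0 ∨ D₂ < 0) :
    ∃ ξ₁ ξ₂ : ℝ, A * (ξ₁ + 1) ^ 2 + A * (ξ₂ + 1) ^ 2 + D₁ * ξ₁ ^ 2 + D₂ * ξ₂ ^ 2 < 0 := by
  have key : ∀ D D' : ℝ, D ^ 2 = D' ^ 2 → D < 0 →
      A * (-1 + D / A + 1) ^ 2 + A * (-1 - D / A + 1) ^ 2 + D * (-1 + D / A) ^ 2 +
        D' * (-1 - D / A) ^ 2 < 0 := by
    intro D D' h hn
    have h1 : D' ≤ -D := abs_le_of_sq_le_sq' (by rw [neg_sq, h]) (by linarith) |>.2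
    have h2 : D' * (-1 - D / A) ^ 2 ≤ -D * (-1 - D / A) ^ 2 :=
      mul_le_mul_of_nonneg_right h1 (sq_nonneg _)
    have h3 : A * (-1 + D / A + 1) ^ 2 + A * (-1 - D / A + 1) ^ 2 + D * (-1 + D / A) ^ 2 +
        -D * (-1 - D / A) ^ 2 = -(2 * D ^ 2 / A) := by
      field_simp
      ring
    have h4 : 0 < 2 * D ^ 2 / A := by have := hn.ne; positivity
    linarith
  rcases hneg with h | h
  · exact ⟨-1 + D₁ / A, -1 - D₁ / A, key D₁ D₂ hD h⟩
  · exact ⟨-1 - D₂ / A, -1 + D₂ / A, by linarith [key D₂ D₁ hD.symm h]⟩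

/-! ### Annuli of constant mean curvature -/

lemma eventually_shift {P : ℝ → ℝ → Prop} {χ : ℝ → ℝ} {K : Set ℝ} (hK : IsCompact K)
    (hχ : Continuous χ) (hP : ∀ x ∈ K, ∀ᶠ w in 𝓝 ((0 : ℝ), x), P w.1 w.2) :
    ∀ᶠ t in 𝓝 (0 : ℝ), ∀ x ∈ K, P t (x + t * χ x) := by
  apply hK.eventually_forall_of_forall_eventually (P := fun t x => P t (x + t * χ x))
  intro x hx
  have h2 : Tendsto (fun w : ℝ × ℝ => (w.1, w.2 + w.1 * χ w.2)) (𝓝 (0, x)) (𝓝 (0, x)) := by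
    have : ContinuousAt (fun w : ℝ × ℝ => (w.1, w.2 + w.1 * χ w.2)) (0, x) := by fun_prop
    simpa [ContinuousAt] using this
  exact h2.eventually (hP x hx)

/-- Radial component of the deformation of a Delaunay profile which keeps its directions. -/
def delRad (R : ℝ) (r : ℝ → ℝ) (x : ℝ) : ℝ := 2 * R * r x / (r x ^ 2 + R ^ 2)

/-- Relative stretching of the deformation of a Delaunay profile which keeps its directions. -/
def delStretch (R : ℝ) (r : ℝ → ℝ) (x : ℝ) : ℝ := 2 * R * (R ^ 2 - r x ^ 2) / (r x ^ 2 + R ^ 2) ^ 2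

section delaunay

variable {R : ℝ} {r z : ℝ → ℝ} {x : ℝ} {n : WithTop ℕ∞}

lemma contDiffAt_delRad (hR : 0 < R) (hr : ContDiffAt ℝ n r x) : ContDiffAt ℝ n (delRad R r) x :=
  (contDiffAt_const.mul hr).div ((hr.pow 2).add contDiffAt_const) (by positivity)

lemma contDiffAt_delStretch (hR : 0 < R) (hr : ContDiffAt ℝ n r x) :
    ContDiffAt ℝ n (delStretch R r) x :=
  (contDiffAt_const.mul (contDiffAt_const.sub (hr.pow 2))).div
    (((hr.pow 2).add contDiffAt_const).pow 2) (by positivity)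

lemma hasDerivAt_delRad (hR : 0 < R) {r' : ℝ} (hr : HasDerivAt r r' x) :
    HasDerivAt (delRad R r) (delStretch R r x * r') x := by
  have hd : r x ^ 2 + R ^ 2 ≠ 0 := by positivity
  refine ((hr.const_mul (2 * R)).div ((hr.pow 2).add_const (R ^ 2)) hd).congr_deriv ?_
  simp only [Pi.pow_apply, delStretch]
  field_simp
  push_cast
  ring

/-- Differentiating c'(R² − r²)/r = sin ψ in R at fixed ψ gives δr = 2Rr/(r² + R²), which is
`delRad`; its derivative along the profile is `delStretch` times r'. Thus the deformation is the
derivative of the Delaunay family with fixed mean curvature, compared at points of equal tangent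
direction, and the linearized mean curvature vanishes. -/
lemma del_linear_eq_zero {c' : ℝ} (hR : 0 < R) (hr : 0 < r x) (hS : 0 < prSpeed r z x)
    (hH : prH c' r z x = 0)
    (hsin : r x * (deriv z x / prSpeed r z x) = c' * (R ^ 2 - r x ^ 2)) :
    prK1 r z x * delRad R r x / r x + prK2 r z x * delStretch R r x = 0 := by
  have h1 : prK1 r z x = c' * (R ^ 2 - r x ^ 2) / r x ^ 2 := by
    rw [← hsin, prK1]; field_simp
  have h2 : prK2 r z x = -(2 * c') - prK1 r z x := by rw [prH] at hH; linarith
  rw [h2, h1, delRad, delStretch]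
  field_simp
  ring

/-- Mean curvature of the deformed profile. -/
def delH (c' R : ℝ) (r z : ℝ → ℝ) (t x : ℝ) : ℝ :=
  (prK1 r z x * r x / (r x + t * delRad R r x) + prK2 r z x / (1 + t * delStretch R r x)) / 2 + c'

/-- Area density of the deformed profile. -/
def delArea (R : ℝ) (r z : ℝ → ℝ) (t x : ℝ) : ℝ :=
  (r x + t * delRad R r x) * ((1 + t * delStretch R r x) * prSpeed r z x)

lemma contDiffAt_delH {c' : ℝ} (hR : 0 < R) (hr : ContDiffAt ℝ 4 r x) (hz : ContDiffAt ℝ 4 z x)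
    (hr0 : 0 < r x) (hS : 0 < prSpeed r z x) :
    ContDiffAt ℝ 2 (fun w : ℝ × ℝ => delH c' R r z w.1 w.2) (0, x) ∧
    ContDiffAt ℝ 2 (fun w : ℝ × ℝ => delArea R r z w.1 w.2) (0, x) := by
  have lift : ∀ {g : ℝ → ℝ}, ContDiffAt ℝ 2 g x → ContDiffAt ℝ 2 (fun w : ℝ × ℝ => g w.2) (0, x) :=
    fun hg => ContDiffAt.comp ((0 : ℝ), x) hg contDiffAt_snd
  have h2 : ContDiffAt ℝ 2 r x := hr.of_le (by norm_num)
  have hP := (lift h2).add (contDiffAt_fst.mul (lift (contDiffAt_delRad hR h2)))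
  have hL := (contDiffAt_const (c := (1 : ℝ))).add
    (contDiffAt_fst.mul (lift (contDiffAt_delStretch hR h2)))
  have k1 := lift (contDiffAt_prK1 (m := 2) hr hz (by norm_num) hr0 hS)
  have k2 := lift (contDiffAt_prK2 (m := 2) hr hz (by norm_num) hS)
  have hs := lift (contDiffAt_prSpeed (m := 2) hr hz (by norm_num) hS)
  exact ⟨((((k1.mul (lift h2)).div hP (by simpa using hr0.ne')).add
    (k2.div hL (by simp))).div_const 2).add contDiffAt_const, hP.mul (hL.mul hs)⟩

/-- The shift contributes k times the derivative of the constant H, and the deformation contributes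
the linear term of `del_linear_eq_zero`; both are zero. -/
lemma hasDerivAt_delH {c' : ℝ} (hR : 0 < R) (hr : ContDiffAt ℝ 4 r x) (hz : ContDiffAt ℝ 4 z x)
    (hr0 : 0 < r x) (hS : 0 < prSpeed r z x) (hH : prH c' r z x = 0)
    (hH' : deriv (prH c' r z) x = 0)
    (hsin : r x * (deriv z x / prSpeed r z x) = c' * (R ^ 2 - r x ^ 2)) (k : ℝ) :
    HasDerivAt (fun t => delH c' R r z t (x + t * k)) 0 0 := by
  have i1 := ((contDiffAt_prK1 (m := 2) hr hz (by norm_num) hr0 hS).differentiableAt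
    (by simp)).hasDerivAt
  have i2 := ((contDiffAt_prK2 (m := 2) hr hz (by norm_num) hS).differentiableAt
    (by simp)).hasDerivAt
  have i3 := (hr.differentiableAt (by simp)).hasDerivAt
  have i4 := ((contDiffAt_delRad hR hr).differentiableAt (by simp)).hasDerivAt
  have i5 := ((contDiffAt_delStretch hR hr).differentiableAt (by simp)).hasDerivAt
  have hsum : deriv (prK1 r z) x + deriv (prK2 r z) x = 0 := by
    have := (((i1.add i2).div_const 2).add_const c').deriv
    have h0 : (fun y => (prK1 r z + prK2 r z) y / 2 + c') = prH c' r z := rfl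
    rw [h0, hH'] at this
    linarith
  have hlin := del_linear_eq_zero hR hr0 hS hH hsin
  have j1 := hasDerivAt_shift_param (k := k) i1
  have j2 := hasDerivAt_shift_param (k := k) i2
  have j3 := hasDerivAt_shift_param (k := k) i3
  have j4 := (hasDerivAt_id (0 : ℝ)).mul (hasDerivAt_shift_param (k := k) i4)
  have j5 := (hasDerivAt_id (0 : ℝ)).mul (hasDerivAt_shift_param (k := k) i5)
  have := ((((j1.mul j3).div (j3.add j4) (by simpa using hr0.ne')).add
    (j2.div (j5.const_add 1) (by simp))).div_const 2).add_const c'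
  refine this.congr_deriv ?_
  simp only [Pi.mul_apply, Pi.add_apply, id, zero_mul, add_zero, one_mul]
  field_simp at hlin ⊢
  linear_combination k * r x * hsum - hlin

end delaunay

/-- The bending integral drops out of the second variation, so that only end terms remain. The
factor 1 + tχ' is the Jacobian of the shift. -/
lemma hasSecondDeriv_bending {a c' R : ℝ} {r z χ : ℝ → ℝ} (hgood : GoodProfile 4 r z (Icc (1 : ℝ) 2))
    (hR : 0 < R) (hχs : ContDiff ℝ 4 χ) (hH : ∀ x ∈ Icc (1 : ℝ) 2, prH c' r z x = 0)
    (hsin : ∀ x ∈ Icc (1 : ℝ) 2,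
      r x * (deriv z x / prSpeed r z x) = c' * (R ^ 2 - r x ^ 2)) :
    HasSecondDeriv (fun t => ∫ x in (1 : ℝ)..2, delH c' R r z t (x + t * χ x) ^ 2 *
      (a * (delArea R r z t (x + t * χ x) * (1 + t * deriv χ x)))) 0 := by
  have huI : uIcc (1 : ℝ) 2 = Icc 1 2 := uIcc_of_le one_le_two
  have hsh : ∀ x : ℝ, ContDiffAt ℝ 2 (fun w : ℝ × ℝ => (w.1, w.2 + w.1 * χ w.2)) (0, x) := by
    intro x
    have h2 : ContDiff ℝ 2 χ := hχs.of_le (by norm_num)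
    have : ContDiff ℝ 2 (fun w : ℝ × ℝ => (w.1, w.2 + w.1 * χ w.2)) := by fun_prop
    exact this.contDiffAt
  have hcomp : ∀ {G : ℝ → ℝ → ℝ} {x : ℝ}, ContDiffAt ℝ 2 (fun w : ℝ × ℝ => G w.1 w.2) (0, x) →
      ContDiffAt ℝ 2 (fun w : ℝ × ℝ => G w.1 (w.2 + w.1 * χ w.2)) (0, x) := by
    intro G x hG
    refine ContDiffAt.comp (g := fun w : ℝ × ℝ => G w.1 w.2)
      (f := fun w : ℝ × ℝ => (w.1, w.2 + w.1 * χ w.2)) ((0 : ℝ), x) ?_ (hsh x)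
    simpa only [zero_mul, add_zero] using hG
  have hχd : ContDiff ℝ 2 (deriv χ) := by
    apply ContDiff.deriv'; exact hχs.of_le (by norm_num)
  apply hasSecondDeriv_integral_sq (h := fun t x => delH c' R r z t (x + t * χ x))
    (σ := fun t x => a * (delArea R r z t (x + t * χ x) * (1 + t * deriv χ x)))
  · intro x hx
    rw [huI] at hx
    obtain ⟨i1, i2, i3, i4⟩ := hgood x hx
    exact hcomp (contDiffAt_delH hR i1 i2 i3 i4).1
  · intro x hx
    rw [huI] at hx
    obtain ⟨i1, i2, i3, i4⟩ := hgood x hx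
    have j1 := hcomp (contDiffAt_delH (c' := c') hR i1 i2 i3 i4).2
    have j2 : ContDiff ℝ 2 (fun w : ℝ × ℝ => 1 + w.1 * deriv χ w.2) := by fun_prop
    exact contDiffAt_const.mul (j1.mul j2.contDiffAt)
  · intro x hx
    rw [huI] at hx
    obtain ⟨-, -, hr0, -⟩ := hgood x hx
    have := hH x hx
    rw [prH] at this
    simp only [delH, zero_mul, add_zero, div_one]
    rw [mul_div_assoc, div_self hr0.ne', mul_one, this]
  · intro x hx
    rw [huI] at hx
    obtain ⟨i1, i2, i3, i4⟩ := hgood x hx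
    refine hasDerivAt_delH hR i1 i2 i3 i4 (hH x hx) ?_ (hsin x hx) (χ x)
    have j1 : HasDerivWithinAt (prH c' r z) (deriv (prH c' r z) x) (Icc 1 2) x :=
      ((contDiffAt_prH (m := 2) (c := c') i1 i2 (by norm_num) i3 i4).differentiableAt
        (by simp)).hasDerivAt.hasDerivWithinAt
    have j2 : HasDerivWithinAt (prH c' r z) 0 (Icc 1 2) x :=
      (hasDerivWithinAt_const x (Icc (1 : ℝ) 2) (0 : ℝ)).congr hH (hH x hx)
    exact (uniqueDiffOn_Icc one_lt_two x hx).eq_deriv _ j1 j2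

/-- The radius of the boundary circle moves with velocity r'k from the slide plus 1 from the
deformation, since `delRad` equals 1 where r = R. -/
lemma hasSecondDeriv_boundary {α β R x : ℝ} {r : ℝ → ℝ} (hr : ContDiffAt ℝ 2 r x) (hR : 0 < R)
    (hβ : β - α / R ^ 2 = 0) (hrx : r x = R) (hφx : delRad R r x = 1) (k : ℝ) : HasSecondDeriv
      (fun t => α / (r (x + t * k) + t * delRad R r (x + t * k)) +
        β * (r (x + t * k) + t * delRad R r (x + t * k)))
      (2 * α / R ^ 3 * (deriv r x * k + 1) ^ 2) := by
  have i2 := contDiffAt_delRad hR hr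
  have hl : ContDiffAt ℝ 2 (fun t : ℝ => x + t * k) 0 :=
    contDiffAt_const.add (contDiffAt_id.mul contDiffAt_const)
  have sh : ∀ {g : ℝ → ℝ}, ContDiffAt ℝ 2 g x → ContDiffAt ℝ 2 (fun t : ℝ => g (x + t * k)) 0 :=
    fun {g} hg => ContDiffAt.comp (g := g) (0 : ℝ) (by simpa only [zero_mul, add_zero] using hg) hl
  apply hasSecondDeriv_circle (ρ := fun t => r (x + t * k) + t * delRad R r (x + t * k))
    ((sh hr).add (contDiffAt_id.mul (sh i2))) hR (by simpa using hrx) ?_ hβ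
  have j1 := hasDerivAt_shift_param (k := k) (hr.differentiableAt (by simp)).hasDerivAt
  have j2 := hasDerivAt_shift_param (k := k) (i2.differentiableAt (by simp)).hasDerivAt
  refine (j1.add ((hasDerivAt_id (0 : ℝ)).mul j2)).congr_deriv ?_
  simp [hφx]

section annulus

variable {a c b α β : ℝ} {X : ℝ × ℝ → Fin 3 → ℝ} {q : Fin 3 → ℝ}
  {e : Fin 3 → Fin 3 → ℝ} {r z : ℝ → ℝ} {R : ℝ}

/-- The energy along deformations of a Delaunay annulus which keep the directions of the profile
and move it along itself. -/
lemma IsProfile.exists_delaunay_variation (h : IsProfile SurfaceType.annulus X q e r z)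
    (hR : 0 < R) {χ : ℝ → ℝ} (hχ : ContDiff ℝ 4 χ) :
    ∃ F : ℝ → ℝ × ℝ → Fin 3 → ℝ, IsVariation SurfaceType.annulus X F ∧
      (fun t => energy a c b α β SurfaceType.annulus (F t)) =ᶠ[𝓝 0] fun t => 2 * Real.pi *
        ((∫ x in (1 : ℝ)..2, delH (frameDet e * c) R r z t (x + t * χ x) ^ 2 *
          (a * (delArea R r z t (x + t * χ x) * (1 + t * deriv χ x)))) +
        -b * (deriv r (2 + t * χ 2) / prSpeed r z (2 + t * χ 2)) +
        b * (deriv r (1 + t * χ 1) / prSpeed r z (1 + t * χ 1)) +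
        (α / (r (2 + t * χ 2) + t * delRad R r (2 + t * χ 2)) +
          β * (r (2 + t * χ 2) + t * delRad R r (2 + t * χ 2))) +
        (α / (r (1 + t * χ 1) + t * delRad R r (1 + t * χ 1)) +
          β * (r (1 + t * χ 1) + t * delRad R r (1 + t * χ 1)))) := by
  have h4 : (2 : WithTop ℕ∞) ≤ 4 := by norm_num
  have hgood : GoodProfile 4 r z (Icc (1 : ℝ) 2) := h.good
  have huI : uIcc (1 : ℝ) 2 = Icc 1 2 := uIcc_of_le one_le_two
  have hm1 : (1 : ℝ) ∈ Icc (1 : ℝ) 2 := by norm_num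
  have hm2 : (2 : ℝ) ∈ Icc (1 : ℝ) 2 := by norm_num
  set φ := delRad R r with hφ
  set lam := delStretch R r with hlam
  -- With φ' = λr' and η' = λz' the deformed tangent is a multiple of the original one, so the
  -- directions at the ends change only through the shift.
  obtain ⟨η, hη⟩ := exists_primitive (g := fun y => lam y * deriv z y) (u := 1) (v := 2)
    fun x hx => ((contDiffAt_delStretch hR (hgood x hx).1).of_le (by norm_num)).mul
      ((hgood x hx).2.1.derivWithin (by norm_num))
  have hφs : ∀ x ∈ Icc (1 : ℝ) 2, ContDiffAt ℝ 4 φ x := fun x hx =>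
    contDiffAt_delRad hR (hgood x hx).1
  set F : ℝ → ℝ × ℝ → Fin 3 → ℝ := fun t p =>
    revol q e (fun x => r (x + t * χ x) + t * φ (x + t * χ x))
      (fun x => z (x + t * χ x) + t * η (x + t * χ x)) p with hF
  refine ⟨F, ⟨?_, ?_⟩, ?_⟩
  · intro p hp
    simp only [hF, zero_mul, add_zero]
    exact (h.eq_revol p hp (one_pos.trans_le (mem_annulus_iff.1 hp).1)).symm
  · intro p hp
    have hp' := mem_annulus_iff.1 hp
    obtain ⟨hr, hz, -, -⟩ := hgood _ hp'
    exact contDiffAt_revol_param (ψ₁ := fun t x => r (x + t * χ x) + t * φ (x + t * χ x))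
      (ψ₂ := fun t x => z (x + t * χ x) + t * η (x + t * χ x)) (one_pos.trans_le hp'.1)
      ((contDiffAt_shift hr hχ).add (contDiffAt_fst.mul (contDiffAt_shift (hφs _ hp') hχ)))
      ((contDiffAt_shift hz hχ).add (contDiffAt_fst.mul (contDiffAt_shift (hη _ hp').1 hχ)))
  have hev1 := hgood.eventually_comp isCompact_Icc hφs (fun x hx => (hη x hx).1) hχ
  have hev2 := eventually_shift (P := fun t y => ContDiffAt ℝ 2 r y ∧ ContDiffAt ℝ 2 z y ∧
    0 < r y ∧ 0 < prSpeed r z y ∧ (∀ᶠ y' in 𝓝 y, HasDerivAt η (lam y' * deriv z y') y') ∧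
    0 < 1 + t * lam y) isCompact_Icc hχ.continuous (K := Icc (1 : ℝ) 2) (by
      intro x hx
      obtain ⟨hr, hz, hr0, hS⟩ := hgood x hx
      have hsnd : Tendsto (fun w : ℝ × ℝ => w.2) (𝓝 (0, x)) (𝓝 x) := continuousAt_snd
      have hlc : ContinuousAt (fun w : ℝ × ℝ => 1 + w.1 * lam w.2) (0, x) :=
        continuousAt_const.add (continuousAt_fst.mul (ContinuousAt.comp (g := lam) (x := ((0 : ℝ), x))
          (contDiffAt_delStretch hR hr).continuousAt continuousAt_snd))
      filter_upwards [hsnd.eventually ((hr.of_le h4).eventually (by simp)),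
        hsnd.eventually ((hz.of_le h4).eventually (by simp)),
        hsnd.eventually (hr.continuousAt.eventually (lt_mem_nhds hr0)),
        hsnd.eventually ((contDiffAt_prSpeed (m := 3) hr hz (by norm_num)
          hS).continuousAt.eventually (lt_mem_nhds hS)),
        hsnd.eventually (hη x hx).2.eventually_nhds,
        hlc.eventually (lt_mem_nhds (show 0 < 1 + 0 * lam x by simp))] with w i1 i2 i3 i4 i5 i6
      exact ⟨i1, i2, i3, i4, i5, i6⟩)
  filter_upwards [hev1, hev2] with t ht1 ht2
  set g : ℝ → ℝ := fun x => x + t * χ x with hg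
  have hgs : ContDiff ℝ 4 g := by rw [hg]; fun_prop
  have hg2 : ∀ x, ContDiffAt ℝ 2 g x := fun x => hgs.contDiffAt.of_le h4
  have hgd : ∀ x, deriv g x = 1 + t * deriv χ x := fun x =>
    ((hasDerivAt_id x).add ((hχ.differentiable (by simp) x).hasDerivAt.const_mul t)).deriv
  set Rt : ℝ → ℝ := fun y => r y + t * φ y with hRt
  set Zt : ℝ → ℝ := fun y => z y + t * η y with hZt
  have hcurv : ∀ x ∈ Icc (1 : ℝ) 2, deriv Rt (g x) / prSpeed Rt Zt (g x) =
      deriv r (g x) / prSpeed r z (g x) ∧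
      prSpeed Rt Zt (g x) = (1 + t * lam (g x)) * prSpeed r z (g x) ∧
      prK1 Rt Zt (g x) = prK1 r z (g x) * r (g x) / (r (g x) + t * φ (g x)) ∧
      prK2 Rt Zt (g x) = prK2 r z (g x) / (1 + t * lam (g x)) := by
    intro x hx
    obtain ⟨i1, i2, i3, i4, i5, i6⟩ := ht2 x hx
    refine curvatures_parallel i1 i2 ?_ i5
      ((contDiffAt_delStretch hR i1).differentiableAt (by simp)) i4 i3 i6 (ht1 x hx).1.2.2.1
    filter_upwards [(hasDerivAt_deriv_of_contDiffAt i1).1] with y hy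
      using hasDerivAt_delRad hR hy
  have hcomp : ∀ x ∈ Icc (1 : ℝ) 2, prSpeed (fun y => Rt (g y)) (fun y => Zt (g y)) x =
      prSpeed Rt Zt (g x) * deriv g x ∧ deriv (fun y => Rt (g y)) x = deriv Rt (g x) * deriv g x := by
    intro x hx
    obtain ⟨⟨i1, i2, -, -⟩, i5⟩ := ht1 x hx
    exact ⟨prSpeed_comp (g := g) (i1.of_le h4) (i2.of_le h4) (hg2 x) i5,
      (deriv_comp_profile (g := g) (i1.of_le h4) (hg2 x)).1⟩
  have hgp : GoodProfile 2 (fun y => Rt (g y)) (fun y => Zt (g y)) (Icc (1 : ℝ) 2) := by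
    intro x hx
    obtain ⟨⟨i1, i2, i3, i4⟩, i5⟩ := ht1 x hx
    refine ⟨ContDiffAt.comp (g := Rt) x (i1.of_le h4) (hg2 x),
      ContDiffAt.comp (g := Zt) x (i2.of_le h4) (hg2 x), i3, ?_⟩
    rw [(hcomp x hx).1]
    exact mul_pos i4 i5
  have hcos : ∀ x ∈ Icc (1 : ℝ) 2, deriv (fun y => Rt (g y)) x /
      prSpeed (fun y => Rt (g y)) (fun y => Zt (g y)) x =
      deriv r (g x) / prSpeed r z (g x) := by
    intro x hx
    rw [(hcomp x hx).1, (hcomp x hx).2, ← (hcurv x hx).1,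
      mul_div_mul_right _ _ (ht1 x hx).2.ne']
  have hdens : ∀ x ∈ Icc (1 : ℝ) 2,
      prDens a (frameDet e * c) 0 (fun y => Rt (g y)) (fun y => Zt (g y)) x =
      delH (frameDet e * c) R r z t (g x) ^ 2 *
        (a * (delArea R r z t (g x) * (1 + t * deriv χ x))) := by
    intro x hx
    obtain ⟨⟨i1, i2, i3, i4⟩, i5⟩ := ht1 x hx
    obtain ⟨-, j2, j3, j4⟩ := hcurv x hx
    rw [prDens_comp (g := g) (i1.of_le h4) (i2.of_le h4) (hg2 x) i5 i3 i4, prDens, j2, j3, j4, hgd,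
      delH, delArea]
    simp only [hRt]
    ring
  rw [energy_annulus (r := fun y => Rt (g y)) (z := fun y => Zt (g y)) h.frame hgp
    (fun p _ => rfl), integral_prDens (huI.symm ▸ hgp), hcos 1 hm1, hcos 2 hm2,
    intervalIntegral.integral_congr (huI.symm ▸ hdens)]
  simp only [hg, hRt]
  ring

/-- An annulus of constant mean curvature between circles of the critical radius is unstable if one
of its boundary circles has the unfavourable direction. -/
lemma IsProfile.isUnstable_annulus (h : IsProfile SurfaceType.annulus X q e r z) (hR : 0 < R)
    (hα : 0 < α) (hβ : β - α / R ^ 2 = 0) (hc : c ≠ 0)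
    (hH : ∀ x ∈ Icc (1 : ℝ) 2, prH (frameDet e * c) r z x = 0)
    (hsin : ∀ x ∈ Icc (1 : ℝ) 2,
      r x * (deriv z x / prSpeed r z x) = frameDet e * c * (R ^ 2 - r x ^ 2))
    (h1 : r 1 = R) (h2 : r 2 = R) (hneg : 0 < b * deriv r 1 ∨ b * deriv r 2 < 0) :
    IsUnstable a c b α β SurfaceType.annulus X := by
  have hgood : GoodProfile 4 r z (Icc (1 : ℝ) 2) := h.good
  have huI : uIcc (1 : ℝ) 2 = Icc 1 2 := uIcc_of_le one_le_two
  have hm1 : (1 : ℝ) ∈ Icc (1 : ℝ) 2 := by norm_num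
  have hm2 : (2 : ℝ) ∈ Icc (1 : ℝ) 2 := by norm_num
  set c' := frameDet e * c with hc'
  have hc2 : c' ^ 2 = c ^ 2 := by rw [hc', mul_pow, h.frame.frameDet_sq, one_mul]
  have hend : ∀ x ∈ Icc (1 : ℝ) 2, r x = R → deriv z x = 0 ∧ prK2 r z x = -(2 * c') ∧
      (deriv r x / prSpeed r z x) ^ 2 = 1 ∧ delRad R r x = 1 := by
    intro x hx hrx
    obtain ⟨-, -, hr0, hS⟩ := hgood x hx
    have i1 : deriv z x = 0 := by
      have := hsin x hx
      rw [hrx, sub_self, mul_zero] at this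
      have := (mul_eq_zero.1 this).resolve_left hR.ne'
      exact (div_eq_zero_iff.1 this).resolve_right hS.ne'
    have hSq := prSpeed_sq r z x
    refine ⟨i1, ?_, ?_, ?_⟩
    · have := hH x hx
      rw [prH, prK1, i1, zero_div] at this
      linarith
    · rw [i1, zero_pow two_ne_zero, add_zero] at hSq
      rw [div_pow, ← hSq, div_self (pow_pos hS 2).ne']
    · rw [delRad, hrx]
      field_simp
      ring
  obtain ⟨z1, k1, C1, φ1⟩ := hend 1 hm1 h1
  obtain ⟨z2, k2, C2, φ2⟩ := hend 2 hm2 h2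
  have hne : ∀ x ∈ Icc (1 : ℝ) 2, (deriv r x / prSpeed r z x) ^ 2 = 1 → deriv r x ≠ 0 := by
    intro x _ hx h0
    simp [h0] at hx
  have d1 := hne 1 hm1 C1
  have d2 := hne 2 hm2 C2
  have hS1 := (hgood 1 hm1).2.2.2
  have hS2 := (hgood 2 hm2).2.2.2
  -- The coefficient A comes from α/ρ + βρ at ρ = R, and D₁, D₂ from the Gauss–Bonnet end terms with
  -- k₂² = 4c². Their squares agree because r'/S = ±1 at both ends.
  obtain ⟨ξ₁, ξ₂, hξ⟩ := exists_quadratic_neg (A := 2 * α / R ^ 3)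
    (D₁ := -(4 * c ^ 2 * b * (deriv r 1 / prSpeed r z 1)))
    (D₂ := 4 * c ^ 2 * b * (deriv r 2 / prSpeed r z 2)) (by positivity)
    (by rw [neg_sq, mul_pow, mul_pow (4 * c ^ 2 * b), C1, C2]) (by
      have hcp : 0 < 4 * c ^ 2 := by positivity
      rcases hneg with i | i
      · left
        have : 0 < 4 * c ^ 2 * (b * deriv r 1 / prSpeed r z 1) :=
          mul_pos hcp (div_pos i hS1)
        calc _ = -(4 * c ^ 2 * (b * deriv r 1 / prSpeed r z 1)) := by ring
          _ < 0 := by linarith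
      · right
        calc _ = 4 * c ^ 2 * (b * deriv r 2 / prSpeed r z 2) := by ring
          _ < 0 := mul_neg_of_pos_of_neg hcp (div_neg_of_neg_of_pos i hS2))
  -- Affine interpolation of the shift, normalized so that the slides change the end radii with
  -- velocities ξ₁ and ξ₂.
  set χ : ℝ → ℝ := fun x => ξ₁ / deriv r 1 * (2 - x) + ξ₂ / deriv r 2 * (x - 1) with hχ
  have hχs : ContDiff ℝ 4 χ := by rw [hχ]; fun_prop
  have hχ1 : χ 1 = ξ₁ / deriv r 1 := by simp only [hχ]; ring
  have hχ2 : χ 2 = ξ₂ / deriv r 2 := by simp only [hχ]; ring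
  obtain ⟨F, hF, hFe⟩ := h.exists_delaunay_variation (a := a) (c := c) (b := b) (α := α) (β := β)
    hR hχs
  have hbulk := hasSecondDeriv_bending (a := a) hgood hR hχs hH hsin
  have e1 := hasSecondDeriv_boundary ((hgood 1 hm1).1.of_le (by norm_num)) hR hβ h1 φ1 (χ 1)
  have e2 := hasSecondDeriv_boundary ((hgood 2 hm2).1.of_le (by norm_num)) hR hβ h2 φ2 (χ 2)
  have g1 := hasSecondDeriv_cosAngle (hgood 1 hm1).1 (hgood 1 hm1).2.1 hS1 z1 (χ 1)
  have g2 := hasSecondDeriv_cosAngle (hgood 2 hm2).1 (hgood 2 hm2).2.1 hS2 z2 (χ 2)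
  have htot := ((((hbulk.add (g2.const_mul (-b))).add (g1.const_mul b)).add e2).add e1).const_mul
    (2 * Real.pi)
  refine ⟨F, hF, ?_⟩
  rw [htot.iteratedDeriv_eq hFe]
  refine mul_neg_of_pos_of_neg (by positivity) ?_
  have x1 : deriv r 1 * χ 1 = ξ₁ := by rw [hχ1]; field_simp
  have x2 : deriv r 2 * χ 2 = ξ₂ := by rw [hχ2]; field_simp
  rw [x1, x2, k1, k2, neg_sq, mul_pow, hc2]
  linarith

end annulus

/-! ### The instability criteria -/

section criteria

variable {a c b α β : ℝ} {τ : SurfaceType} {X : ℝ × ℝ → Fin 3 → ℝ} {q : Fin 3 → ℝ}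
  {e : Fin 3 → Fin 3 → ℝ} {r z : ℝ → ℝ} {s : ℝ}

/-- Pointwise consequences of criticality along a boundary circle. -/
lemma IsProfile.boundary_equations (h : IsProfile τ X q e r z) (hX : IsC4Immersion τ X)
    (hcrit : IsCritical a c b α β τ X) (hs : s ∈ boundaryLabels τ) :
    a * prH (frameDet e * c) r z |s| = -(b * prK1 r z |s|) ∧
    a * prH (frameDet e * c) r z |s| * (prH (frameDet e * c) r z |s| - prK2 r z |s|) * r |s| *
      prSpeed r z |s| = -(s / |s| * (β - α / r |s| ^ 2) * deriv r |s|) := by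
  obtain ⟨f, hc⟩ := exists_collar hs
  obtain ⟨hW, hk, hU⟩ := h.euler_lagrange hX hcrit hc
  have hW1 := hW |s| right_mem_uIcc
  have hU1 := hU |s| right_mem_uIcc
  rw [intervalIntegral.integral_same, add_zero] at hU1
  obtain ⟨-, -, hr0, hS⟩ := h.good _ (abs_label_mem_radii hs)
  have hSq := prSpeed_sq r z |s|
  set c' := frameDet e * c
  set x := |s|
  constructor
  · have : r x * (a * prH c' r z x + b * prK1 r z x) = 0 := by
      rw [← hk, prK1]; field_simp
    linarith [(mul_eq_zero.1 this).resolve_left hr0.ne']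
  · have h2 : a * prH c' r z x * (prH c' r z x - prK2 r z x) * r x * prSpeed r z x =
        a * prH c' r z x * (prH c' r z x - prK2 r z x) * r x * (prSpeed r z x ^ 2) /
          prSpeed r z x := by field_simp
    -- The tangential component of the flux; the derivative of h cancels.
    have h3 : a * prH c' r z x * (prH c' r z x - prK2 r z x) * r x *
        (deriv r x ^ 2 + deriv z x ^ 2) / prSpeed r z x =
        deriv r x * momU a c' r z x + deriv z x * momW a c' r z x := by
      simp only [momU, momW]
      field_simp
      ring
    rw [h2, hSq, h3, hW1]
    linear_combination deriv r x * hU1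

lemma IsProfile.deriv_radius_eq_zero (h : IsProfile τ X q e r z) (hX : IsC4Immersion τ X)
    (hs : s ∈ boundaryLabels τ) (hg : ∀ θ, geodCurv X s θ = 0) : deriv r |s| = 0 := by
  obtain ⟨-, -, hr0, hS⟩ := h.good _ (abs_label_mem_radii hs)
  have h1 := hg 0
  rw [h.geodCurv_eq hX hs, neg_eq_zero] at h1
  have h2 := (mul_eq_zero.1 h1).resolve_left
    (div_ne_zero (label_ne_zero hs) (abs_pos.2 (label_ne_zero hs)).ne')
  exact (div_eq_zero_iff.1 h2).resolve_right (mul_pos hr0 hS).ne'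

/-- The criterion for geodesic boundary circles. -/
lemma IsProfile.isUnstable_of_geodesic (h : IsProfile τ X q e r z) (hX : IsC4Immersion τ X)
    (hcrit : IsCritical a c b α β τ X) (hs : s ∈ boundaryLabels τ) (hr1 : deriv r |s| = 0)
    (hK : (α / r |s| ^ 2 - β) * (prK1 r z |s| * prK2 r z |s|) < 0) :
    IsUnstable a c b α β τ X := by
  obtain ⟨-, -, hr0, hS⟩ := h.good _ (abs_label_mem_radii hs)
  apply h.isUnstable_of_shift hX hcrit hs
  have h1 : deriv z |s| = prK1 r z |s| * (r |s| * prSpeed r z |s|) := by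
    rw [prK1]; field_simp
  rw [hr1, h1]
  calc _ = r |s| * prSpeed r z |s| ^ 2 *
        ((α / r |s| ^ 2 - β) * (prK1 r z |s| * prK2 r z |s|)) := by ring
    _ < 0 := mul_neg_of_pos_of_neg (by positivity) hK

/-- On a geodesic circle r' = 0, hence z' ≠ 0 and k₁ ≠ 0. As b ≠ 0, the natural condition gives h ≠
0, so h(h − k₂) = 0 leaves h = k₂, i.e. a k₂ = −b k₁. -/
lemma IsProfile.gaussCurv_of_geodesic (h : IsProfile τ X q e r z) (hX : IsC4Immersion τ X)
    (hcrit : IsCritical a c b α β τ X) (ha : 0 < a) (hb : b ≠ 0) (hs : s ∈ boundaryLabels τ)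
    (hr1 : deriv r |s| = 0) :
    prK1 r z |s| ≠ 0 ∧ prK1 r z |s| * prK2 r z |s| = -(b * (prK1 r z |s| ^ 2 / a)) := by
  obtain ⟨-, -, hr0, hS⟩ := h.good _ (abs_label_mem_radii hs)
  obtain ⟨h1, h2⟩ := h.boundary_equations hX hcrit hs
  rw [hr1, mul_zero, neg_zero] at h2
  have hz1 : deriv z |s| ≠ 0 := by
    intro hz
    have := prSpeed_sq r z |s|
    rw [hr1, hz] at this
    simp [hS.ne'] at this
  have hk1 : prK1 r z |s| ≠ 0 := div_ne_zero hz1 (mul_pos hr0 hS).ne'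
  have hH : prH (frameDet e * c) r z |s| ≠ 0 := by
    intro hH
    rw [hH, mul_zero, zero_eq_neg] at h1
    exact mul_ne_zero hb hk1 h1
  have h3 : prH (frameDet e * c) r z |s| = prK2 r z |s| := by
    have := (mul_eq_zero.1 ((mul_eq_zero.1 h2).resolve_right hS.ne')).resolve_right hr0.ne'
    exact sub_eq_zero.1 ((mul_eq_zero.1 this).resolve_left (mul_ne_zero ha.ne' hH))
  refine ⟨hk1, ?_⟩
  rw [h3] at h1
  field_simp
  linear_combination h1

/-- The case in which the surface has constant mean curvature `-c`. -/
lemma IsProfile.isUnstable_of_prH_eq_zero (h : IsProfile τ X q e r z) (hX : IsC4Immersion τ X)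
    (hcrit : IsCritical a c b α β τ X) (ha : 0 < a) (hα : 0 < α) (hc : c ≠ 0) (hb : b ≠ 0)
    (hs : s ∈ boundaryLabels τ) (hβ : β - α / r |s| ^ 2 = 0)
    (hg : s / |s| * b * deriv r |s| < 0) (hH : prH (frameDet e * c) r z |s| = 0) :
    IsUnstable a c b α β τ X := by
  have hm := abs_label_mem_radii hs
  have hHall := h.prH_eq_zero hX hcrit ha hs hβ hH
  have hc' : frameDet e * c ≠ 0 := by
    have := h.frame.frameDet_sq
    exact mul_ne_zero (fun h0 => by simp [h0] at this) hc
  -- With h = 0 everywhere the natural condition becomes b k₁ = 0 at every boundary circle, not only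
  -- at the given one.
  have hz : ∀ s' ∈ boundaryLabels τ, deriv z |s'| = 0 := by
    intro s' hs'
    obtain ⟨-, -, hr0, hS⟩ := h.good _ (abs_label_mem_radii hs')
    have h1 := (h.boundary_equations hX hcrit hs').1
    rw [hHall _ (abs_label_mem_radii hs'), mul_zero, zero_eq_neg] at h1
    exact (div_eq_zero_iff.1 ((mul_eq_zero.1 h1).resolve_left hb)).resolve_right
      (mul_pos hr0 hS).ne'
  have hR := h.pos _ hm
  have hsin := h.sinAngle_eq hm hHall (hz s hs)
  -- Where z' = 0 the first integral reads c'(R² − r²) = 0.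
  have hrad : ∀ s' ∈ boundaryLabels τ, r |s'| = r |s| := by
    intro s' hs'
    have h1 := hsin _ (abs_label_mem_radii hs')
    rw [hz s' hs', zero_div, mul_zero, zero_eq_mul] at h1
    have h2 := h1.resolve_left hc'
    exact (pow_left_inj₀ (h.pos _ (abs_label_mem_radii hs')).le hR.le two_ne_zero).1 (by linarith)
  cases τ
  · exact (h.not_disc hX hc' hR.ne' hsin).elim
  · have h1 := hrad (-1) (by simp [boundaryLabels])
    have h2 := hrad 2 (by simp [boundaryLabels])
    rw [abs_neg, abs_one] at h1
    rw [abs_of_pos (two_pos : (0 : ℝ) < 2)] at h2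
    apply h.isUnstable_annulus hR hα hβ hc hHall hsin h1 h2
    simp only [boundaryLabels, Finset.mem_insert, Finset.mem_singleton] at hs
    rcases hs with rfl | rfl
    · right
      rw [abs_of_pos (two_pos : (0 : ℝ) < 2), div_self two_ne_zero, one_mul] at hg
      exact hg
    · left
      rw [abs_neg, abs_one, div_one] at hg
      linarith

/-- The inequality behind the criterion for circles of the critical radius. -/
lemma critical_radius_inequality {a b c α β ς r S r₁ z₁ k₁ k₂ : ℝ} (hβ : 0 < β) (hc : c ≠ 0) (ha : 0 < a)
    (hαβ : β ^ 3 * (a + b) ^ 2 / (4 * c ^ 2 * (b ^ 2 * (a + b) ^ 2 * c ^ 2 + a ^ 2 * β ^ 2)) < α)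
    (hς : ς ^ 2 = 1) (hr : 0 < r) (hS : 0 < S) (hSq : S ^ 2 = r₁ ^ 2 + z₁ ^ 2)
    (hk₁ : k₁ = z₁ / (r * S)) (hR : β - α / r ^ 2 = 0) (hg : ς * b * r₁ < 0)
    (h1 : a * k₂ = -(b * k₁)) (h2 : (k₂ - k₁) ^ 2 = 4 * c ^ 2) :
    ς * b * r₁ * S * (k₂ - k₁) ^ 2 + 2 * α / r ^ 3 * r₁ ^ 2 < 0 := by
  have hR' : α = β * r ^ 2 := by field_simp at hR; linarith
  have e1 : (a + b) ^ 2 * k₁ ^ 2 = 4 * a ^ 2 * c ^ 2 := by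
    have : (a + b) * k₁ = -(a * (k₂ - k₁)) := by linarith
    rw [← mul_pow, this, neg_sq, mul_pow, h2]; ring
  have hab : a + b ≠ 0 := by
    intro h0
    rw [h0] at e1
    have : 0 < 4 * a ^ 2 * c ^ 2 := by positivity
    linarith
  -- Up to sign, G is the geodesic curvature and k₁ the normal curvature of the circle; `e2` below
  -- says that G² + k₁² = 1/r².
  set G := r₁ / (r * S) with hG
  have hr₁ : r₁ = G * (r * S) := by rw [hG]; field_simp
  have hz₁ : z₁ = k₁ * (r * S) := by rw [hk₁]; field_simp
  have e2 : (G ^ 2 + k₁ ^ 2) * r ^ 2 = 1 := by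
    have : S ^ 2 * ((G ^ 2 + k₁ ^ 2) * r ^ 2) = S ^ 2 * 1 := by
      rw [mul_one]
      nth_rewrite 2 [hSq]
      rw [hr₁, hz₁]
      ring
    exact mul_left_cancel₀ (pow_pos hS 2).ne' this
  -- The bound on α in disguise: r² = α/β, and k₁² = 4a²c²/(a + b)² is eliminated from G² = 1/r² −
  -- k₁².
  have e3 : β ^ 2 * G ^ 2 < 4 * b ^ 2 * c ^ 4 := by
    rw [div_lt_iff₀ (by positivity), hR'] at hαβ
    have hpos : 0 < (a + b) ^ 2 * r ^ 2 * β := by positivity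
    have : β ^ 2 * G ^ 2 * ((a + b) ^ 2 * r ^ 2 * β) <
        4 * b ^ 2 * c ^ 4 * ((a + b) ^ 2 * r ^ 2 * β) := by
      have e4 : β ^ 2 * G ^ 2 * ((a + b) ^ 2 * r ^ 2 * β) =
          β ^ 3 * (a + b) ^ 2 - β ^ 3 * r ^ 2 * (4 * a ^ 2 * c ^ 2) := by
        rw [← e1]
        linear_combination β ^ 3 * (a + b) ^ 2 * e2
      rw [e4]
      linarith
    exact lt_of_mul_lt_mul_right this hpos.le
  have hg' : ς * b * G < 0 := by
    rw [hr₁] at hg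
    by_contra hcon
    push Not at hcon
    have := mul_nonneg hcon (mul_pos hr hS).le
    linarith
  -- The right side is positive by the sign hypothesis on ςbr₁, so squares may be compared; after
  -- dividing by G² this is `e3`.
  have e5 : β * G ^ 2 < -(ς * b * G) * (2 * c ^ 2) := by
    apply lt_of_pow_lt_pow_left₀ 2 (mul_nonneg (by linarith) (by positivity))
    have hG2 : 0 < G ^ 2 := by
      have : G ≠ 0 := by rintro h0; rw [h0] at hg'; simp at hg'
      positivity
    calc (β * G ^ 2) ^ 2 = (β ^ 2 * G ^ 2) * G ^ 2 := by ring
      _ < 4 * b ^ 2 * c ^ 4 * G ^ 2 := mul_lt_mul_of_pos_right e3 hG2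
      _ = ς ^ 2 * (4 * b ^ 2 * c ^ 4 * G ^ 2) := by rw [hς, one_mul]
      _ = _ := by ring
  rw [h2, hr₁, hR']
  have : ς * b * (G * (r * S)) * S * (4 * c ^ 2) + 2 * (β * r ^ 2) / r ^ 3 * (G * (r * S)) ^ 2 =
      2 * r * S ^ 2 * (β * G ^ 2 - -(ς * b * G) * (2 * c ^ 2)) := by
    field_simp
    ring
  rw [this]
  exact mul_neg_of_pos_of_neg (by positivity) (by linarith)

/-- The criterion for boundary circles of the critical radius. -/
lemma IsProfile.isUnstable_of_critical_radius (h : IsProfile τ X q e r z) (hX : IsC4Immersion τ X)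
    (hcrit : IsCritical a c b α β τ X) (ha : 0 < a) (hα : 0 < α) (hβ : 0 < β) (hc : c ≠ 0)
    (hαβ : β ^ 3 * (a + b) ^ 2 / (4 * c ^ 2 * (b ^ 2 * (a + b) ^ 2 * c ^ 2 + a ^ 2 * β ^ 2)) < α)
    (hs : s ∈ boundaryLabels τ) (hR : r |s| = Real.sqrt (α / β))
    (hg : 0 < b * geodCurv X s 0) : IsUnstable a c b α β τ X := by
  obtain ⟨-, -, hr0, hS⟩ := h.good _ (abs_label_mem_radii hs)
  have hB : β - α / r |s| ^ 2 = 0 := by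
    rw [hR, Real.sq_sqrt (by positivity)]
    field_simp
    ring
  have hb : b ≠ 0 := by rintro rfl; simp at hg
  have hg' : s / |s| * b * deriv r |s| < 0 := by
    rw [h.geodCurv_eq hX hs] at hg
    have h1 : s / |s| * b * deriv r |s| = -(b * -(s / |s| *
        (deriv r |s| / (r |s| * prSpeed r z |s|))) * (r |s| * prSpeed r z |s|)) := by
      field_simp
    rw [h1, neg_lt_zero]
    exact mul_pos hg (mul_pos hr0 hS)
  obtain ⟨h1, h2⟩ := h.boundary_equations hX hcrit hs
  rw [hB, mul_zero, zero_mul, neg_zero] at h2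
  -- Since B = 0, the tangential boundary equation reads h(h − k₂) = 0. The branch h = 0 is the
  -- constant mean curvature case; in the other one a single slide suffices.
  by_cases hH : prH (frameDet e * c) r z |s| = 0
  · exact h.isUnstable_of_prH_eq_zero hX hcrit ha hα hc hb hs hB hg' hH
  have h3 : prH (frameDet e * c) r z |s| = prK2 r z |s| := by
    have := (mul_eq_zero.1 ((mul_eq_zero.1 h2).resolve_right hS.ne')).resolve_right hr0.ne'
    exact sub_eq_zero.1 ((mul_eq_zero.1 this).resolve_left (mul_ne_zero ha.ne' hH))
  rw [h3] at h1
  have h4 : (prK2 r z |s| - prK1 r z |s|) ^ 2 = 4 * c ^ 2 := by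
    have : prK2 r z |s| - prK1 r z |s| = 2 * (frameDet e * c) := by
      rw [prH] at h3; linarith
    rw [this, mul_pow, mul_pow, h.frame.frameDet_sq]
    ring
  apply h.isUnstable_of_shift hX hcrit hs
  have := critical_radius_inequality hβ hc ha hαβ (sign_sq (label_ne_zero hs)) hr0 hS
    (prSpeed_sq r z |s|) rfl hB hg' h1 h4
  rw [hB, zero_div, sub_zero, zero_mul, zero_mul, zero_mul, sub_zero]
  exact this

end criteria

end EulerHelfrich

end

/-! ### The four instability criteria -/

theorem mainTheorem10 (a c b α β : ℝ) (ha : 0 < a) (hα : 0 < α) (hβ : 0 < β)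
    (τ : EulerHelfrich.SurfaceType) (X : ℝ × ℝ → Fin 3 → ℝ)
    (hX : EulerHelfrich.IsC4Immersion τ X)
    (hsym : EulerHelfrich.IsAxiallySymmetric τ X)
    (hcrit : EulerHelfrich.IsCritical a c b α β τ X)
    (hcase :
      (b = 0 ∧ ∃ s ∈ EulerHelfrich.boundaryLabels τ, ∃ R : ℝ,
        EulerHelfrich.IsGeodesicCircle X s R ∧
        ∀ θ : ℝ, (α / R ^ 2 - β) *
          EulerHelfrich.gaussCurv X (EulerHelfrich.bdryPoint s θ) < 0) ∨
      (b < 0 ∧ ∃ s ∈ EulerHelfrich.boundaryLabels τ, ∃ R : ℝ,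
        EulerHelfrich.IsGeodesicCircle X s R ∧ Real.sqrt (α / β) < R) ∨
      (0 < b ∧ ∃ s ∈ EulerHelfrich.boundaryLabels τ, ∃ R : ℝ,
        EulerHelfrich.IsGeodesicCircle X s R ∧ R < Real.sqrt (α / β)) ∨
      (c ≠ 0 ∧
        β ^ 3 * (a + b) ^ 2 /
          (4 * c ^ 2 * (b ^ 2 * (a + b) ^ 2 * c ^ 2 + a ^ 2 * β ^ 2)) < α ∧
        ∃ s ∈ EulerHelfrich.boundaryLabels τ,
          EulerHelfrich.IsCircle (Set.range (EulerHelfrich.bdryCurve X s))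
            (Real.sqrt (α / β)) ∧
          ∀ θ : ℝ, 0 < b * EulerHelfrich.geodCurv X s θ)) :
    EulerHelfrich.IsUnstable a c b α β τ X := by
  obtain ⟨q, e, r, z, h⟩ := EulerHelfrich.exists_profile hX hsym
  have hsq : 0 ≤ α / β := by positivity
  rcases hcase with ⟨-, s, hs, R, ⟨hC, hg⟩, hK⟩ | ⟨hb, s, hs, R, ⟨hC, hg⟩, hR⟩ |
    ⟨hb, s, hs, R, ⟨hC, hg⟩, hR⟩ | ⟨hc, hαβ, s, hs, hC, hg⟩
  · have hr := h.radius_eq hs hC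
    have hK0 := hK 0
    rw [h.gaussCurv_eq hX hs, ← hr] at hK0
    exact h.isUnstable_of_geodesic hX hcrit hs (h.deriv_radius_eq_zero hX hs hg) hK0
  · have hr1 := h.deriv_radius_eq_zero hX hs hg
    obtain ⟨hk, hK⟩ := h.gaussCurv_of_geodesic hX hcrit ha hb.ne hs hr1
    refine h.isUnstable_of_geodesic hX hcrit hs hr1 ?_
    rw [h.radius_eq hs hC, hK]
    have h1 : α / R ^ 2 < β := by
      rw [Real.sqrt_lt' hC.1, div_lt_iff₀ hβ] at hR
      rw [div_lt_iff₀ (pow_pos hC.1 2)]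
      linarith
    have h2 : b * (EulerHelfrich.prK1 r z |s| ^ 2 / a) < 0 :=
      mul_neg_of_neg_of_pos hb (by positivity)
    exact mul_neg_of_neg_of_pos (by linarith) (by linarith)
  · have hr1 := h.deriv_radius_eq_zero hX hs hg
    obtain ⟨hk, hK⟩ := h.gaussCurv_of_geodesic hX hcrit ha hb.ne' hs hr1
    refine h.isUnstable_of_geodesic hX hcrit hs hr1 ?_
    rw [h.radius_eq hs hC, hK]
    have h1 : β < α / R ^ 2 := by
      rw [Real.lt_sqrt hC.1.le, lt_div_iff₀ hβ] at hR
      rw [lt_div_iff₀ (pow_pos hC.1 2)]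
      linarith
    have h2 : 0 < b * (EulerHelfrich.prK1 r z |s| ^ 2 / a) := mul_pos hb (by positivity)
    exact mul_neg_of_pos_of_neg (by linarith) (by linarith)
  · exact h.isUnstable_of_critical_radius hX hcrit ha hα hβ hc hαβ hs (h.radius_eq hs hC) (hg 0)
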